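/- **Setting.** Let $N>1$, $T>0$, $p>1$, and let $\mathcal G=\bigcup_{i=1}^N J_i\subset\mathbb R^N$, $J_i=\mathbb R_+e_i$, where $(e_i)$ is the canonical basis, with the geodesic distance $d(x,y)=|x-y|$ if $x,y$ lie on a common edge and $d(x,y)=|x|+|y|$ otherwise. For $0\le t\le T$ and $x\in\mathcal G$, $\Gamma_t[x]$ is the set of $y\in C([t,T];\mathcal G)\cap W^{1,p}(t,T;\mathbb R^N)$ with $y(t)=x$; $\Gamma_{t,\bar t}[x]$ is the set of restrictions to $[t,\bar t]$ of elements of $\Gamma_t[x]$; $\Gamma[x]=\Gamma_0[x]$. For $C>0$, $\Gamma_C$ is the set of $y\in\bigcup_x\Gamma[x]$ with $\|y\|_{L^\infty(0,T)}\le C$ and $\|y'\|_{L^p(0,T)}\le C$, with the topology of uniform convergence. $\mathcal P_1(\mathcal G)$ is the set of Borel probability measures on $\mathcal G$ with finite first moment, with the Kantorovich–Rubinstein distance $d_1$. **Costs.** Let $L_i\in C(\mathcal P_1(\mathcal G);C^1(\mathbb R_+\times\mathbb R))$ (with $C^1$ convergence on compact sets), $G_i\in C_b(\mathcal P_1(\mathcal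 G);C_b(\mathbb R_+))$ for $1\le i\le N$, and $L_*,G_*\in C_b(\mathcal P_1(\mathcal G);\mathbb R)$. Assumption $[H_{MFG,1}]$: (1) there is $C_0>0$ with $L_i[m](x,a)\ge C_0(|a|^p-1)$ and $L_*[m]\ge -C_0$ for all $i,m,a$ and $x\ge0$; (2) for every $r>0$ there is a modulus of continuity $\omega_r$ with $|L_i[m_1](x,a)-L_i[m_2](x,a)|\le(1+|a|^p)\,\omega_r(d_1(m_1,m_2))$ for all $i,m_1,m_2,a$ and $x\in[0,r]$; (3) for every $r>0$ there is $\tilde c(r)\ge0$ with $|\partial_xL_i[m](x,a)|\le\tilde c(r)(|a|^p+1)$ and $|\partial_aL_i[m](x,a)|\le\tilde c(r)(|a|^{p-1}+1)$ for all $i,m,a$ and $x\in[0,r]$; (4) $a\mapsto L_i[m](x,a)$ is strictly convex for all $i,m$ and $x\ge0$. Assumption $[H_{MFG,2}]$: $G_i[m]\in C^1(\mathbb R_+)$ for all $i,m$. Set $L_0[m]=\min\{L_*[m],\min_iL_i[m](0,0)\}$. For $y\in\Gamma_t[x]$, let $\bar y=|y|$ and let $L[m](y,y')$ be $L_i[m](\bar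 y,\bar y')$ when $y\in J_i\setminus\{0\}$ and $L_0[m]$ when $y=0$; let $G[m](x)$ be $G_i[m](|x|)$ when $x\in J_i\setminus\{0\}$ and $\min\{G_*[m],\min_iG_i[m](0)\}$ when $x=0$. **Mild solutions.** Let $m_0$ be a Borel probability measure on $\mathcal G$ with bounded support. For a Borel probability measure $\mu$ on $\Gamma_C$, let $m^\mu(t)$ be the image of $\mu$ by $y\mapsto y(t)$ and, for $y\in\Gamma_t[x]$, $J^\mu_t(x;y)=\int_t^TL[m^\mu(\tau)](y(\tau),y'(\tau))\,d\tau+G[m^\mu(T)](y(T))$. The measure $\mu$ is a relaxed equilibrium if $m^\mu(0)=m_0$ and every $y\in\operatorname{supp}\mu$ satisfies $y(0)\in\operatorname{supp}m_0$ and $J^\mu_0(y(0);y)=\min_{z\in\Gamma[y(0)]}J^\mu_0(y(0);z)$. Its mild solution is $(u,m)$ with $m(t)=m^\mu(t)$ and $u(x,t)=\inf_{y\in\Gamma_t[x]}J^\mu_t(x;y)$, for $x\in\mathcal G$ and $t\in[0,T]$. **Statement.** Assume $[H_{MFG,1}]$, let $\mu$ be a relaxed equilibrium on $\Gamma_C$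 with $C>0$, and let $(u,m)$ be its mild solution. Then: 1. For all $0\le t\le\bar t\le T$ and $x\in\mathcal G$, $$u(x,t)=\inf_{y\in\Gamma_{t,\bar t}[x]}\Bigl\{u(y(\bar t),\bar t)+\int_t^{\bar t}L[m(\tau)](y(\tau),y'(\tau))\,d\tau\Bigr\}.$$ 2. $u$ is continuous on $\mathcal G\times[0,T)$; for every $x\in\mathcal G$ the function $t\mapsto u(x,t)$ is continuous on $[0,T]$, and $u(x,T)=G[m(T)](x)$. 3. $u$ is a viscosity solution on $\mathcal G\times(0,T)$ of $$-\partial_tu+H_i(|x|,D_xu,t)=0\ \text{ for }x\in J_i\setminus\{0\},\qquad -\partial_tu+H_0(D_xu,t)=0\ \text{ for }x=0,$$ where $H_i(x,q,t)=\sup_{\zeta\in\mathbb R}\{-q\zeta-L_i[m(t)](x,\zeta)\}$, $H_i^{\downarrow}(x,q,t)=\sup_{\zeta\ge0}\{-q\zeta-L_i[m(t)](x,\zeta)\}$ and $H_0(q,t)=\max\bigl(-L_0[m(t)],\max_iH_i^{\downarrow}(0,q_i,t)\bigr)$ for $q\in\mathbb R^N$. That is, $u$ is continuous on $\mathcal G\times(0,T)$,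 and at every point where a function $\varphi$ touches $u$ from above (respectively below), the corresponding left-hand side evaluated with the derivatives of $\varphi$ is $\le0$ (respectively $\ge0$). Here $\varphi$ is continuous on $\mathcal G\times(0,T)$ with restriction of class $C^1$ to each $J_i\times(0,T)$; $D_x\varphi$ is the derivative along the edge at $x\ne0$, and the vector of the $N$ one-sided derivatives along the edges at $x=0$. 4. If moreover $[H_{MFG,2}]$ holds, then (a) $u$ is locally Lipschitz continuous on $\mathcal G\times[0,T)$; (b) if in addition $G[n]$ is continuous on $\mathcal G$ for every $n\in\mathcal P_1(\mathcal G)$, then $u$ is locally Lipschitz continuous on $\mathcal G\times[0,T]$. -/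

import Mathlib

open Set Filter Topology MeasureTheory
open scoped ENNReal

noncomputable section

namespace JunctionMFG

/-! ### The junction with its geodesic distance -/

/-- The junction with `N` edges: the union of the closed half-lines `ℝ₊ e_i` in `ℝ^N`. -/
def Junction (N : ℕ) : Type :=
  {x : EuclideanSpace ℝ (Fin N) // ∃ (i : Fin N) (r : ℝ), 0 ≤ r ∧ x = EuclideanSpace.single i r}

namespace Junction

variable {N : ℕ}

/-- The underlying vector of `ℝ^N`. -/
def vec (x : Junction N) : EuclideanSpace ℝ (Fin N) := x.1

/-- The Euclidean norm `|x|`. -/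
def abs (x : Junction N) : ℝ := ‖x.vec‖

/-- The closed edge `J_i = ℝ₊ e_i`. -/
def edge (i : Fin N) : Set (Junction N) :=
  {x | ∃ r : ℝ, 0 ≤ r ∧ x.vec = EuclideanSpace.single i r}

/-- The vertex `0`, as a subset of the junction. -/
def vertex : Set (Junction N) := {x | x.vec = 0}

/-- The point `r e_i` of the edge `J_i`, for `r ≥ 0` (negative `r` are sent to the vertex). -/
def pt (i : Fin N) (r : ℝ) : Junction N :=
  ⟨EuclideanSpace.single i (max r 0), i, max r 0, le_max_right _ _, rfl⟩

open Classical in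
/-- The geodesic distance: `|x - y|` if `x, y` lie on a common edge, `|x| + |y|` otherwise. -/
def geodist (x y : Junction N) : ℝ :=
  if ∃ i, x ∈ edge i ∧ y ∈ edge i then ‖x.vec - y.vec‖ else x.abs + y.abs

theorem geodist_eq_sum (x y : Junction N) : geodist x y = ∑ k, |x.vec k - y.vec k| := by
  classical
  unfold geodist
  split_ifs with h
  · obtain ⟨i, ⟨r, _, hx⟩, ⟨s, _, hy⟩⟩ := h
    have hd : x.vec - y.vec = EuclideanSpace.single i (r - s) := by
      rw [hx, hy]; ext k; by_cases hk : k = i <;> simp [hk]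
    rw [hd, PiLp.norm_single, Finset.sum_eq_single i]
    · simp [hx, hy]
    · intro k _ hk; simp [hx, hy, hk]
    · simp
  · obtain ⟨i, r, hr, hx⟩ := x.2
    obtain ⟨j, s, hs, hy⟩ := y.2
    have hx' : x.vec = EuclideanSpace.single i r := hx
    have hy' : y.vec = EuclideanSpace.single j s := hy
    have hij : i ≠ j := by
      rintro rfl; exact h ⟨i, ⟨r, hr, hx'⟩, ⟨s, hs, hy'⟩⟩
    have key : ∀ k, |x.vec k - y.vec k| = (if k = i then |r| else 0) + (if k = j then |s| else 0) := by
      intro k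
      rw [hx', hy']
      by_cases hi : k = i
      · subst hi; simp [hij]
      · by_cases hj : k = j
        · subst hj; simp [hi]
        · simp [hi, hj]
    simp only [key, Finset.sum_add_distrib, Finset.sum_ite_eq', Finset.mem_univ, if_true]
    simp [abs, hx', hy']

instance : MetricSpace (Junction N) where
  dist := geodist
  dist_self x := by rw [geodist_eq_sum]; simp
  dist_comm x y := by
    rw [geodist_eq_sum, geodist_eq_sum]
    exact Finset.sum_congr rfl fun k _ => abs_sub_comm _ _
  dist_triangle x y z := by
    rw [geodist_eq_sum, geodist_eq_sum, geodist_eq_sum, ← Finset.sum_add_distrib]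
    exact Finset.sum_le_sum fun k _ => abs_sub_le _ _ _
  eq_of_dist_eq_zero {x y} h := by
    rw [geodist_eq_sum, Finset.sum_eq_zero_iff_of_nonneg (fun k _ => abs_nonneg _)] at h
    apply Subtype.ext
    ext k
    exact sub_eq_zero.mp (abs_eq_zero.mp (h k (Finset.mem_univ k)))

instance : MeasurableSpace (Junction N) := borel _

instance : BorelSpace (Junction N) := ⟨rfl⟩

theorem lipschitz_abs : LipschitzWith 1 (abs : Junction N → ℝ) := by
  classical
  refine LipschitzWith.of_dist_le_mul fun x y => ?_
  change |x.abs - y.abs| ≤ 1 * geodist x y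
  have hx : 0 ≤ x.abs := norm_nonneg _
  have hy : 0 ≤ y.abs := norm_nonneg _
  unfold geodist
  split_ifs
  · rw [one_mul]; exact abs_norm_sub_norm_le _ _
  · rw [one_mul, abs_le]; constructor <;> linarith

end Junction

open Junction

/-! ### Probability measures with finite first moment -/

/-- Borel probability measures on the junction with finite first moment. -/
def P1 (N : ℕ) : Type :=
  {m : ProbabilityMeasure (Junction N) // Integrable Junction.abs (m : Measure (Junction N))}

/-- The measure underlying an element of `P1 N`. -/
def P1.toMeasure {N : ℕ} (m : P1 N) : Measure (Junction N) := (m.1 : Measure (Junction N))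

/-- The Kantorovich-Rubinstein distance: the supremum of `∫ f dm₁ - ∫ f dm₂` over the functions
`f` that are `1`-Lipschitz for the geodesic distance. -/
def d1 {N : ℕ} (m₁ m₂ : P1 N) : ℝ :=
  sSup {r | ∃ f : Junction N → ℝ, LipschitzWith 1 f ∧
    r = ∫ x, f x ∂m₁.toMeasure - ∫ x, f x ∂m₂.toMeasure}

/-! ### Admissible trajectories -/

/-- `y : [a, b] → ℝ^N` is in `W^{1,p}(a, b)` with derivative `α ∈ L^p(a, b)`: it is
the primitive of `α`. Only the values on `[a, b]` matter. -/
def HasLpDeriv {N : ℕ} (p a b : ℝ) (y α : ℝ → EuclideanSpace ℝ (Fin N)) : Prop :=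
  MemLp α (ENNReal.ofReal p) (volume.restrict (Ioc a b)) ∧
    ∀ s ∈ Icc a b, y s = y a + ∫ τ in a..s, α τ

/-- `Γ_t[x]`: admissible trajectories on `[t, T]` starting from `x` at time `t`, i.e. the elements
of `C([t, T]; 𝒢) ∩ W^{1,p}(t, T; ℝ^N)` with `y t = x`. Only the values on `[t, T]` matter. -/
def Gam {N : ℕ} (p T t : ℝ) (x : Junction N) : Set (ℝ → Junction N) :=
  {y | ContinuousOn y (Icc t T) ∧ (∃ α, HasLpDeriv p t T (fun s => (y s).vec) α) ∧ y t = x}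

/-- `Γ_{t₁,t₂}[x]`: the restrictions to `[t₁, t₂]` of the elements of `Γ_{t₁}[x]`. -/
def GamRestr {N : ℕ} (p T t₁ t₂ : ℝ) (x : Junction N) : Set (ℝ → Junction N) :=
  {z | ∃ y ∈ Gam p T t₁ x, EqOn z y (Icc t₁ t₂)}

/-- The extension to `ℝ`, constant outside `[0, T]`, of a continuous curve on `[0, T]`. -/
def curve {N : ℕ} {T : ℝ} (hT : 0 < T) (y : C(Icc (0 : ℝ) T, Junction N)) (s : ℝ) : Junction N :=
  y (projIcc 0 T hT.le s)

/-- `Γ_C`: admissible trajectories on `[0, T]` with `‖y‖_{L^∞} ≤ C` and `‖y'‖_{L^p} ≤ C`. -/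
def GamC (N : ℕ) (p : ℝ) {T : ℝ} (hT : 0 < T) (C : ℝ) : Type :=
  {y : C(Icc (0 : ℝ) T, Junction N) // (∀ s, (y s).abs ≤ C) ∧
    ∃ α, HasLpDeriv p 0 T (fun s => (curve hT y s).vec) α ∧
      eLpNorm α (ENNReal.ofReal p) (volume.restrict (Ioc 0 T)) ≤ ENNReal.ofReal C}

section GamC

variable {N : ℕ} {p T C : ℝ} {hT : 0 < T}

/-- The topology of uniform convergence on `[0, T]`. -/
instance : TopologicalSpace (GamC N p hT C) :=
  inferInstanceAs (TopologicalSpace (Subtype _))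

instance : MeasurableSpace (GamC N p hT C) := borel _

instance : BorelSpace (GamC N p hT C) := ⟨rfl⟩

/-- The evaluation map `e_t`. -/
def evalAt (t : ℝ) (y : GamC N p hT C) : Junction N := curve hT y.1 t

theorem continuous_evalAt (t : ℝ) : Continuous (evalAt t : GamC N p hT C → Junction N) :=
  (continuous_eval_const (projIcc 0 T hT.le t)).comp continuous_subtype_val

/-- The marginal `m^μ(t) = e_t ♯ μ` for `t ∈ [0, T]`, as an element of `P1 N`. -/
def marginal (μ : ProbabilityMeasure (GamC N p hT C)) (t : ℝ) : P1 N :=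
  ⟨μ.map (continuous_evalAt t).measurable.aemeasurable, by
    have hm : Measurable (evalAt t : GamC N p hT C → Junction N) := (continuous_evalAt t).measurable
    have ha : Continuous (Junction.abs : Junction N → ℝ) := lipschitz_abs.continuous
    rw [ProbabilityMeasure.toMeasure_map,
      integrable_map_measure ha.measurable.aestronglyMeasurable hm.aemeasurable]
    refine Integrable.of_bound (ha.measurable.comp hm).aestronglyMeasurable C
      (ae_of_all _ fun y => ?_)
    have h0 : 0 ≤ (evalAt t y).abs := norm_nonneg _
    rw [Function.comp_apply, Real.norm_of_nonneg h0]
    exact y.2.1 _⟩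

end GamC

/-! ### Costs depending on the distribution of states -/

/-- The data of the game: running costs `L_i[m](x, a)` and `L_*[m]`, terminal costs `G_i[m](x)`
and `G_*[m]`. The arguments `x` are meant in `ℝ₊`; other values are never used. -/
structure Costs (N : ℕ) where
  L : Fin N → P1 N → ℝ → ℝ → ℝ
  Lstar : P1 N → ℝ
  G : Fin N → P1 N → ℝ → ℝ
  Gstar : P1 N → ℝ

namespace Costs

variable {N : ℕ} (c : Costs N)

/-- The partial derivative `∂_x L_i[m](x, a)`, one-sided at `x = 0`. -/
def dxL (i : Fin N) (m : P1 N) (x a : ℝ) : ℝ := derivWithin (fun z => c.L i m z a) (Ici 0) x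

/-- The partial derivative `∂_a L_i[m](x, a)`. -/
def daL (i : Fin N) (m : P1 N) (x a : ℝ) : ℝ := deriv (fun b => c.L i m x b) a

/-- The cost `L_0[m]` for staying at the vertex. -/
def L0 (m : P1 N) : ℝ := min (c.Lstar m) (⨅ i, c.L i m 0 0)

/-- The running cost `L[m]` at a point `x` of the junction, for the signed scalar velocity `a`
along the edge that contains `x`. -/
def running (m : P1 N) (x : Junction N) (a : ℝ) : ℝ :=
  ∑ i, (edge i \ vertex).indicator (fun z => c.L i m z.abs a) x +
    vertex.indicator (fun _ => c.L0 m) x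

/-- The terminal cost `G[m]` on the junction. -/
def terminal (m : P1 N) (x : Junction N) : ℝ :=
  ∑ i, (edge i \ vertex).indicator (fun z => c.G i m z.abs) x +
    vertex.indicator (fun _ => min (c.Gstar m) (⨅ i, c.G i m 0)) x

/-- The standing regularity of the costs: `L_i ∈ C(P₁; C¹(ℝ₊ × ℝ))`, `G_i ∈ C_b(P₁; C_b(ℝ₊))`,
`L_* ∈ C_b(P₁)`, `G_* ∈ C_b(P₁)`, continuity being that for `d1`. -/
structure Regular : Prop where
  L_contDiff : ∀ i m,
    ContDiffOn ℝ 1 (fun q : ℝ × ℝ => c.L i m q.1 q.2) (Ici (0 : ℝ) ×ˢ (univ : Set ℝ))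
  L_cont : ∀ (i : Fin N) (ms : ℕ → P1 N) (m : P1 N),
    Tendsto (fun n => d1 (ms n) m) atTop (𝓝 0) →
    ∀ K : Set (ℝ × ℝ), IsCompact K → K ⊆ Ici (0 : ℝ) ×ˢ (univ : Set ℝ) →
      TendstoUniformlyOn (fun n q => c.L i (ms n) q.1 q.2) (fun q => c.L i m q.1 q.2) atTop K ∧
      TendstoUniformlyOn (fun n q => c.dxL i (ms n) q.1 q.2) (fun q => c.dxL i m q.1 q.2) atTop K ∧
      TendstoUniformlyOn (fun n q => c.daL i (ms n) q.1 q.2) (fun q => c.daL i m q.1 q.2) atTop K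
  G_contOn : ∀ i m, ContinuousOn (c.G i m) (Ici 0)
  G_bdd : ∀ i, ∃ M : ℝ, ∀ m, ∀ x, 0 ≤ x → |c.G i m x| ≤ M
  G_cont : ∀ (i : Fin N) (ms : ℕ → P1 N) (m : P1 N),
    Tendsto (fun n => d1 (ms n) m) atTop (𝓝 0) →
    TendstoUniformlyOn (fun n => c.G i (ms n)) (c.G i m) atTop (Ici 0)
  Lstar_bdd : ∃ M : ℝ, ∀ m, |c.Lstar m| ≤ M
  Lstar_cont : ∀ (ms : ℕ → P1 N) (m : P1 N),
    Tendsto (fun n => d1 (ms n) m) atTop (𝓝 0) →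
    Tendsto (fun n => c.Lstar (ms n)) atTop (𝓝 (c.Lstar m))
  Gstar_bdd : ∃ M : ℝ, ∀ m, |c.Gstar m| ≤ M
  Gstar_cont : ∀ (ms : ℕ → P1 N) (m : P1 N),
    Tendsto (fun n => d1 (ms n) m) atTop (𝓝 0) →
    Tendsto (fun n => c.Gstar (ms n)) atTop (𝓝 (c.Gstar m))

/-- A modulus of continuity. -/
def IsModulus (ω : ℝ → ℝ) : Prop :=
  ω 0 = 0 ∧ MonotoneOn ω (Ici 0) ∧ ContinuousWithinAt ω (Ici 0) 0

/-- Assumption `[H_MFG,1]`. -/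
structure HMFG1 (p : ℝ) : Prop where
  coercive : ∃ C₀ : ℝ, 0 < C₀ ∧
    (∀ i m x a, 0 ≤ x → C₀ * (|a| ^ p - 1) ≤ c.L i m x a) ∧ ∀ m, -C₀ ≤ c.Lstar m
  modulus : ∀ r : ℝ, 0 < r → ∃ ω : ℝ → ℝ, IsModulus ω ∧
    ∀ i m₁ m₂, ∀ x ∈ Icc 0 r, ∀ a,
      |c.L i m₁ x a - c.L i m₂ x a| ≤ (1 + |a| ^ p) * ω (d1 m₁ m₂)
  growth : ∀ r : ℝ, 0 < r → ∃ K : ℝ, 0 ≤ K ∧ ∀ i m, ∀ x ∈ Icc 0 r, ∀ a,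
    |c.dxL i m x a| ≤ K * (|a| ^ p + 1) ∧ |c.daL i m x a| ≤ K * (|a| ^ (p - 1) + 1)
  convex : ∀ i m x, 0 ≤ x → StrictConvexOn ℝ univ (c.L i m x)

/-- Assumption `[H_MFG,2]`: `G_i[m] ∈ C¹(ℝ₊)`. -/
def HMFG2 : Prop := ∀ i m, ContDiffOn ℝ 1 (c.G i m) (Ici 0)

/-! ### The optimal control problem for a given flow of measures -/

/-- The running part `∫_t^s L[m(τ)](y(τ), y'(τ)) dτ` of the cost; the scalar velocity is the
derivative of `|y|`, which exists at almost every time for an admissible trajectory. -/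
def runningCost (m : ℝ → P1 N) (t s : ℝ) (y : ℝ → Junction N) : ℝ :=
  ∫ τ in t..s, c.running (m τ) (y τ) (deriv (fun σ => (y σ).abs) τ)

/-- The cost `J_t` of a trajectory on `[t, T]`. -/
def J (T : ℝ) (m : ℝ → P1 N) (t : ℝ) (y : ℝ → Junction N) : ℝ :=
  c.runningCost m t T y + c.terminal (m T) (y T)

/-- The value function `u(x, t) = inf_{y ∈ Γ_t[x]} J_t(x; y)`. -/
def value (p T : ℝ) (m : ℝ → P1 N) (x : Junction N) (t : ℝ) : ℝ :=
  sInf (c.J T m t '' Gam p T t x)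

/-- `Γ_C^{μ,opt}[x]`: the elements of `Γ_C` starting from `x` at time `0` that minimize the cost
associated with `μ` over all of `Γ[x]`. -/
def optC {p T C : ℝ} {hT : 0 < T} (μ : ProbabilityMeasure (GamC N p hT C)) (x : Junction N) :
    Set (GamC N p hT C) :=
  {y | evalAt 0 y = x ∧
    ∀ z ∈ Gam p T 0 x, c.J T (marginal μ) 0 (curve hT y.1) ≤ c.J T (marginal μ) 0 z}

/-- `μ ∈ P(Γ_C)` is a relaxed equilibrium with initial distribution `m₀`. -/
def IsRelaxedEquilibrium {p T C : ℝ} {hT : 0 < T} (m₀ : ProbabilityMeasure (Junction N))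
    (μ : ProbabilityMeasure (GamC N p hT C)) : Prop :=
  (μ : Measure (GamC N p hT C)).map (evalAt 0) = (m₀ : Measure (Junction N)) ∧
    (μ : Measure (GamC N p hT C)).support ⊆
      ⋃ x ∈ (m₀ : Measure (Junction N)).support, c.optC μ x

/-- `(u, m)` is the mild solution associated with `μ` (the values of `u` and `m` at times in
`[0, T]` are prescribed, the others are irrelevant). -/
def IsMildSolution {p T C : ℝ} {hT : 0 < T} (μ : ProbabilityMeasure (GamC N p hT C))
    (u : Junction N → ℝ → ℝ) (m : ℝ → P1 N) : Prop :=
  (∀ t ∈ Icc 0 T, m t = marginal μ t) ∧ ∀ x, ∀ t ∈ Icc 0 T, u x t = c.value p T m x t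

end Costs

/-! ### Hamilton-Jacobi equations on the junction -/

/-- `H(x, q) = sup_{ζ ∈ ℝ} (-q ζ - ℓ(x, ζ))`. -/
def Ham (ℓ : ℝ → ℝ → ℝ) (x q : ℝ) : ℝ := ⨆ ζ : ℝ, (-q * ζ - ℓ x ζ)

/-- `H^↓(x, q) = sup_{ζ ≥ 0} (-q ζ - ℓ(x, ζ))`. -/
def HamDown (ℓ : ℝ → ℝ → ℝ) (x q : ℝ) : ℝ := ⨆ ζ : {ζ : ℝ // 0 ≤ ζ}, (-q * ζ.1 - ℓ x ζ.1)

/-- The Hamiltonian at the vertex, `max (-ℓ₀, max_i H_i^↓(0, q_i))`. -/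
def HamVertex {N : ℕ} (ℓ : Fin N → ℝ → ℝ → ℝ) (ℓ₀ : ℝ) (q : Fin N → ℝ) : ℝ :=
  max (-ℓ₀) (⨆ i, HamDown (ℓ i) 0 (q i))

section Viscosity

variable {N : ℕ}

/-- `φ ∈ C¹(𝒢 × (0, T))`: continuous, and of class `C¹` on each `J_i × (0, T)`, up to the vertex. -/
def IsC1 (T : ℝ) (φ : Junction N → ℝ → ℝ) : Prop :=
  ContinuousOn (fun q : Junction N × ℝ => φ q.1 q.2) ((univ : Set (Junction N)) ×ˢ Ioo 0 T) ∧
    ∀ i, ContDiffOn ℝ 1 (fun q : ℝ × ℝ => φ (pt i q.1) q.2) (Ici (0 : ℝ) ×ˢ Ioo 0 T)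

/-- The derivative of `φ(·, t)` along the edge `J_i` at `r e_i`, one-sided at `r = 0`. -/
def Dx (φ : Junction N → ℝ → ℝ) (i : Fin N) (r t : ℝ) : ℝ :=
  derivWithin (fun z => φ (pt i z) t) (Ici 0) r

/-- `φ` touches `u` from above at `(x, t)`. -/
def TouchesAbove (φ u : Junction N → ℝ → ℝ) (x : Junction N) (t : ℝ) : Prop :=
  φ x t = u x t ∧ ∀ᶠ q : Junction N × ℝ in 𝓝 (x, t), u q.1 q.2 ≤ φ q.1 q.2

/-- `φ` touches `u` from below at `(x, t)`. -/
def TouchesBelow (φ u : Junction N → ℝ → ℝ) (x : Junction N) (t : ℝ) : Prop :=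
  φ x t = u x t ∧ ∀ᶠ q : Junction N × ℝ in 𝓝 (x, t), φ q.1 q.2 ≤ u q.1 q.2

/-- Viscosity subsolutions on `𝒢 × (0, T)` of the system
`-∂_t u + H_i(|x|, D_x u, t) = 0` on `J_i \ {0}`, `-∂_t u + H_0(D_x u, t) = 0` at the vertex, for
the running costs `ℓ t i` on the edges and `ℓ₀ t` at the vertex. -/
def IsViscositySubsolution (T : ℝ) (ℓ : ℝ → Fin N → ℝ → ℝ → ℝ) (ℓ₀ : ℝ → ℝ)
    (u : Junction N → ℝ → ℝ) : Prop :=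
  ContinuousOn (fun q : Junction N × ℝ => u q.1 q.2) ((univ : Set (Junction N)) ×ˢ Ioo 0 T) ∧
  ∀ φ : Junction N → ℝ → ℝ, IsC1 T φ → ∀ x, ∀ t ∈ Ioo 0 T, TouchesAbove φ u x t →
    (∀ i, x ∈ edge i \ vertex →
      -deriv (fun s => φ x s) t + Ham (ℓ t i) x.abs (Dx φ i x.abs t) ≤ 0) ∧
    (x ∈ vertex →
      -deriv (fun s => φ x s) t + HamVertex (ℓ t) (ℓ₀ t) (fun i => Dx φ i 0 t) ≤ 0)

/-- Viscosity supersolutions of the same system. -/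
def IsViscositySupersolution (T : ℝ) (ℓ : ℝ → Fin N → ℝ → ℝ → ℝ) (ℓ₀ : ℝ → ℝ)
    (u : Junction N → ℝ → ℝ) : Prop :=
  ContinuousOn (fun q : Junction N × ℝ => u q.1 q.2) ((univ : Set (Junction N)) ×ˢ Ioo 0 T) ∧
  ∀ φ : Junction N → ℝ → ℝ, IsC1 T φ → ∀ x, ∀ t ∈ Ioo 0 T, TouchesBelow φ u x t →
    (∀ i, x ∈ edge i \ vertex →
      0 ≤ -deriv (fun s => φ x s) t + Ham (ℓ t i) x.abs (Dx φ i x.abs t)) ∧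
    (x ∈ vertex →
      0 ≤ -deriv (fun s => φ x s) t + HamVertex (ℓ t) (ℓ₀ t) (fun i => Dx φ i 0 t))

/-- Viscosity solutions. -/
def IsViscositySolution (T : ℝ) (ℓ : ℝ → Fin N → ℝ → ℝ → ℝ) (ℓ₀ : ℝ → ℝ)
    (u : Junction N → ℝ → ℝ) : Prop :=
  IsViscositySubsolution T ℓ ℓ₀ u ∧ IsViscositySupersolution T ℓ ℓ₀ u

end Viscosity

end JunctionMFG

end

open JunctionMFG

/-! ### Geometry of the junction -/

namespace JunctionMFG

open JunctionMFG.Junction (pt edge vertex)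

section Geometry

variable {N : ℕ}

/-! Once the flow `m` is frozen, `u` is the value function of a deterministic control problem with
Lagrangian `Costs.lagr` and terminal cost `c.terminal (m T)`. Evaluating the same random curve at
two times couples the two marginals, so the flow is continuous for `d1` (`tendsto_d1_marginal`).
Hence the Lagrangian is `Tame`: jointly continuous, coercive like `C₀ (|a|^p - 1)`, with `p`-growth
and a matching local Lipschitz bound (`Costs.tame_lagr`). The rest concerns a tame Lagrangian and a
bounded terminal cost, and works with nearly optimal curves, so no minimizer has to exist.

Dynamic programming is concatenation in one direction (`value_le_cost_add`) and cutting a curve in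
the other (`cost_add_value_le`).

For regularity, a nearly optimal curve is shifted inside its edge. The cost changes by the size of
the shift and of its speed, times elapsed time plus the energy `∫ |vel|^p`, which `apriori`
controls. The obstruction is the vertex, where a shifted curve may have nowhere to go and the costs
of different edges need not match. The central estimate is `value_vertex_le`: wait at the vertex,
then follow the shifted curve, letting the shift die out if the curve comes back; an excursion with
too much energy is replaced by a straight motion. The other comparisons are bootstrapped from it
with `length_le_cost`: by superlinearity, the cost pays for any multiple of the length, up to a
multiple of the elapsed time. Since the terminal cost may be smaller at the vertex than its limits
along the edges, outward shifts are made to vanish at time `T`, which costs a constant depending on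
the distance to `T` (`value_spatial`). For a terminal cost that is Lipschitz along each edge up to
the vertex, a constant shift suffices up to `T` (`value_spatial'`). Lipschitz continuity in time
follows from that in space (`lipschitz_of_spatial`).

For terminal costs that are only continuous on the edges, a uniform approximation by edgewise
Lipschitz ones (`exists_edgeLip_near`) makes `u` a locally uniform limit of Lipschitz value
functions before `T`. At `T`, lower semicontinuity of the terminal cost is enough.

The subsolution inequality tests constant velocities. For the supersolution inequality, strict
failure would turn the test function into a first order minorant of `u`; integrating along a nearly
optimal curve then contradicts dynamic programming (`not_strict_minorant`). At the vertex the
Hamiltonian sees only outgoing velocities, while nearby curves may also come in. Convexity provides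
a slope `s ≥ 0` extending the lower bound to all velocities (`exists_supporting_slope`), and
lowering the derivative of the test function by `s` still gives a minorant, because the vertex is an
endpoint of every edge. -/

theorem Junction.ext {x y : Junction N} (h : x.vec = y.vec) : x = y := Subtype.ext h

theorem Junction.abs_nn (x : Junction N) : 0 ≤ x.abs := norm_nonneg _

theorem pt_vec (i : Fin N) {r : ℝ} (hr : 0 ≤ r) : (pt i r).vec = EuclideanSpace.single i r := by
  simp [pt, Junction.vec, max_eq_left hr]

theorem pt_abs (i : Fin N) {r : ℝ} (hr : 0 ≤ r) : (pt i r).abs = r := by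
  rw [Junction.abs, pt_vec i hr, PiLp.norm_single, Real.norm_of_nonneg hr]

theorem pt_zero (i j : Fin N) : pt i 0 = pt j 0 := by
  apply Junction.ext; rw [pt_vec i le_rfl, pt_vec j le_rfl]; ext k; simp

theorem exists_eq_pt (x : Junction N) : ∃ i, x = pt i x.abs := by
  obtain ⟨i, r, hr, hx⟩ := x.2
  have hx' : x = pt i r := Junction.ext (by rw [pt_vec i hr]; exact hx)
  exact ⟨i, by conv_rhs => rw [hx', pt_abs i hr]
               exact hx'⟩

theorem mem_edge_iff {i : Fin N} {x : Junction N} : x ∈ edge i ↔ x = pt i x.abs := by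
  constructor
  · rintro ⟨r, hr, hx⟩
    have hx' : x = pt i r := Junction.ext (by rw [pt_vec i hr]; exact hx)
    conv_rhs => rw [hx', pt_abs i hr]
    exact hx'
  · intro h
    exact ⟨x.abs, x.abs_nn, by rw [← pt_vec i x.abs_nn, ← h]⟩

theorem mem_vertex_iff {x : Junction N} : x ∈ (vertex : Set (Junction N)) ↔ x.abs = 0 := by
  simp [vertex, Junction.abs]

theorem pt_mem_edge_diff {i j : Fin N} {r : ℝ} (hr : 0 ≤ r) :
    pt i r ∈ edge j \ vertex ↔ i = j ∧ 0 < r := by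
  rw [Set.mem_sdiff, mem_vertex_iff, mem_edge_iff, pt_abs i hr]
  constructor
  · rintro ⟨h1, h2⟩
    have hr' : 0 < r := lt_of_le_of_ne hr (Ne.symm h2)
    refine ⟨?_, hr'⟩
    by_contra hij
    have := congrArg (fun x : Junction N => x.vec i) h1
    simp only [pt_vec i hr, pt_vec j hr] at this
    simp [hij] at this
    exact h2 this
  · rintro ⟨rfl, h⟩
    exact ⟨rfl, h.ne'⟩

theorem dist_eq_sum (x y : Junction N) : dist x y = ∑ k, |x.vec k - y.vec k| :=
  Junction.geodist_eq_sum x y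

theorem abs_coord_sub_le (x y : Junction N) (k : Fin N) : |x.vec k - y.vec k| ≤ dist x y := by
  rw [dist_eq_sum]
  exact Finset.single_le_sum (f := fun k => |x.vec k - y.vec k|) (fun _ _ => abs_nonneg _)
    (Finset.mem_univ k)

theorem continuous_coord (k : Fin N) : Continuous fun x : Junction N => x.vec k :=
  (LipschitzWith.of_dist_le_mul (K := 1) fun x y => by
    simpa [Real.dist_eq] using abs_coord_sub_le x y k).continuous

theorem continuous_abs' : Continuous (Junction.abs : Junction N → ℝ) :=
  Junction.lipschitz_abs.continuous

theorem abs_sub_abs_le_dist (x y : Junction N) : |x.abs - y.abs| ≤ dist x y := by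
  simpa [Real.dist_eq] using Junction.lipschitz_abs.dist_le_mul x y

theorem dist_pt (i : Fin N) {r s : ℝ} (hr : 0 ≤ r) (hs : 0 ≤ s) :
    dist (pt i r) (pt i s) = |r - s| := by
  rw [dist_eq_sum, pt_vec i hr, pt_vec i hs, Finset.sum_eq_single i]
  · simp
  · intro k _ hk; simp [hk]
  · simp

theorem dist_pt_of_ne {i j : Fin N} (hij : i ≠ j) {r s : ℝ} (hr : 0 ≤ r) (hs : 0 ≤ s) :
    dist (pt i r) (pt j s) = r + s := by
  have key : ∀ k, |(pt i r).vec k - (pt j s).vec k|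
      = (if k = i then r else 0) + (if k = j then s else 0) := by
    intro k
    rw [pt_vec i hr, pt_vec j hs]
    by_cases hi : k = i
    · subst hi; simp [hij, abs_of_nonneg hr]
    · by_cases hj : k = j
      · subst hj; simp [hi, abs_of_nonneg hs]
      · simp [hi, hj]
  rw [dist_eq_sum]
  simp only [key, Finset.sum_add_distrib, Finset.sum_ite_eq', Finset.mem_univ, if_true]

theorem dist_le_abs_add (x y : Junction N) : dist x y ≤ x.abs + y.abs := by
  obtain ⟨i, hx⟩ := exists_eq_pt x
  obtain ⟨j, hy⟩ := exists_eq_pt y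
  have h1 := x.abs_nn
  have h2 := y.abs_nn
  by_cases hij : i = j
  · subst hij
    rw [hx, hy, dist_pt i h1 h2, pt_abs i h1, pt_abs i h2, abs_le]
    constructor <;> linarith
  · rw [hx, hy, dist_pt_of_ne hij h1 h2, pt_abs i h1, pt_abs j h2]

theorem lipschitzWith_pt (i : Fin N) : LipschitzWith 1 (pt i : ℝ → Junction N) := by
  refine LipschitzWith.of_dist_le_mul fun r s => ?_
  have h : ∀ r, pt i r = pt i (max r 0) := fun r =>
    Junction.ext (by simp [pt, Junction.vec])
  rw [h r, h s, dist_pt i (le_max_right _ _) (le_max_right _ _), NNReal.coe_one, one_mul,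
    Real.dist_eq]
  exact abs_max_sub_max_le_abs r s 0

theorem continuous_pt (i : Fin N) : Continuous (pt i : ℝ → Junction N) :=
  (lipschitzWith_pt i).continuous

/-- A point has at most one nonzero coordinate, and it is nonnegative. In this form the norm is the
restriction of a linear functional, which commutes with integration. -/
theorem abs_eq_sum (x : Junction N) : x.abs = ∑ k, x.vec k := by
  obtain ⟨i, hx⟩ := exists_eq_pt x
  conv_rhs => rw [hx, pt_vec i x.abs_nn]
  rw [Finset.sum_eq_single i]
  · simp
  · intro k _ hk; simp [hk]
  · simp

theorem coord_nonneg (x : Junction N) (k : Fin N) : 0 ≤ x.vec k := by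
  obtain ⟨i, hx⟩ := exists_eq_pt x
  rw [hx, pt_vec i x.abs_nn]
  by_cases h : k = i
  · subst h; simpa using x.abs_nn
  · simp [h]

theorem mem_edge_diff_iff {i : Fin N} {x : Junction N} : x ∈ edge i \ vertex ↔ 0 < x.vec i := by
  obtain ⟨j, hx⟩ := exists_eq_pt x
  have h0 := x.abs_nn
  rw [hx, pt_mem_edge_diff h0, pt_vec j h0]
  by_cases h : j = i
  · subst h; simp
  · simp [h, Ne.symm h]

theorem coord_eq_abs {i : Fin N} {x : Junction N} (hx : x ∈ edge i) : x.vec i = x.abs := by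
  conv_lhs => rw [mem_edge_iff.1 hx, pt_vec i x.abs_nn]
  simp

theorem coord_eq_zero {i : Fin N} {x : Junction N} (hx : x ∉ edge i \ vertex) : x.vec i = 0 := by
  rw [mem_edge_diff_iff, not_lt] at hx
  exact le_antisymm hx (coord_nonneg x i)

theorem isOpen_edge_diff (i : Fin N) : IsOpen (edge i \ vertex : Set (Junction N)) := by
  have : (edge i \ vertex : Set (Junction N)) = {x | 0 < x.vec i} := by
    ext x; exact mem_edge_diff_iff
  rw [this]
  exact isOpen_lt continuous_const (continuous_coord i)

theorem measurableSet_vertex : MeasurableSet (vertex : Set (Junction N)) := by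
  have : (vertex : Set (Junction N)) = Junction.abs ⁻¹' {0} := by
    ext x; simp [mem_vertex_iff]
  rw [this]
  exact continuous_abs'.measurable (measurableSet_singleton 0)

theorem abs_vec_pos_cases (x : Junction N) : x.abs = 0 ∨ ∃ i, x ∈ edge i \ vertex := by
  obtain ⟨i, hx⟩ := exists_eq_pt x
  rcases x.abs_nn.eq_or_lt with h | h
  · exact Or.inl h.symm
  · exact Or.inr ⟨i, by rw [hx]; exact (pt_mem_edge_diff x.abs_nn).2 ⟨rfl, h⟩⟩

/-- A curve avoiding the vertex on a preconnected set of times stays in one edge. -/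
theorem eq_pt_of_preconnected {S : Set ℝ} (hS : IsPreconnected S) {y : ℝ → Junction N}
    (hy : ContinuousOn y S) (hpos : ∀ σ ∈ S, 0 < (y σ).abs) {i : Fin N} {a : ℝ} (ha : a ∈ S)
    (hya : y a ∈ edge i) : ∀ σ ∈ S, y σ = pt i (y σ).abs := by
  -- The continuous function `2 (y σ)_i - |y σ|` is `|y σ|` on the edge `i` and `-|y σ|` off it, so
  -- leaving the edge would force it to vanish, that is, a passage through the vertex.
  have hval : ∀ σ ∈ S, (y σ ∈ edge i ∧ 2 * (y σ).vec i - (y σ).abs = (y σ).abs) ∨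
      2 * (y σ).vec i - (y σ).abs = -(y σ).abs := by
    intro σ hσ
    by_cases h : y σ ∈ edge i
    · left; refine ⟨h, ?_⟩; rw [coord_eq_abs h]; ring
    · right; rw [coord_eq_zero (fun h' => h h'.1)]; ring
  intro σ hσ
  rw [← mem_edge_iff]
  rcases hval σ hσ with h | h
  · exact h.1
  · exfalso
    have hc : ContinuousOn (fun σ => 2 * (y σ).vec i - (y σ).abs) S :=
      (continuousOn_const.mul ((continuous_coord i).comp_continuousOn hy)).sub
        (continuous_abs'.comp_continuousOn hy)
    have hivt := hS.intermediate_value hσ ha hc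
    have h0 : (0 : ℝ) ∈ Icc (2 * (y σ).vec i - (y σ).abs) (2 * (y a).vec i - (y a).abs) := by
      rw [h, coord_eq_abs hya]
      constructor
      · linarith [hpos σ hσ]
      · linarith [hpos a ha]
    obtain ⟨τ, hτ, h0⟩ := hivt h0
    have := hpos τ hτ
    rcases hval τ hτ with h' | h' <;> simp only at h0
    · linarith [h'.2]
    · linarith

end Geometry

/-! ### Admissible curves on a subinterval -/

section Paths

variable {N : ℕ} {p a b : ℝ} {y : ℝ → Junction N}

/-- `y` is an admissible trajectory on `[a, b]`. -/
def AdmOn (p a b : ℝ) (y : ℝ → Junction N) : Prop :=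
  ContinuousOn y (Icc a b) ∧ ∃ α, HasLpDeriv p a b (fun s => (y s).vec) α

/-- The signed scalar velocity along the current edge. -/
noncomputable def vel (y : ℝ → Junction N) : ℝ → ℝ := deriv fun σ => (y σ).abs

theorem one_le_ofReal (hp : 1 < p) : (1 : ℝ≥0∞) ≤ ENNReal.ofReal p := by
  rw [← ENNReal.ofReal_one]; exact ENNReal.ofReal_le_ofReal hp.le

theorem MemLp.intervalIntegrable_of_Ioc {E : Type*} [NormedAddCommGroup E] {f : ℝ → E}
    (hp : 1 < p) (hab : a ≤ b)
    (hf : MemLp f (ENNReal.ofReal p) (volume.restrict (Ioc a b))) :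
    IntervalIntegrable f volume a b := by
  rw [intervalIntegrable_iff_integrableOn_Ioc_of_le hab]
  exact hf.integrable (one_le_ofReal hp)

theorem AdmOn.mono {a' b' : ℝ} (hp : 1 < p) (h : AdmOn p a b y) (ha : a ≤ a') (hab : a' ≤ b')
    (hb : b' ≤ b) : AdmOn p a' b' y := by
  obtain ⟨hc, α, hα, he⟩ := h
  have hi := MemLp.intervalIntegrable_of_Ioc hp (ha.trans (hab.trans hb)) hα
  refine ⟨hc.mono (Icc_subset_Icc ha hb), α, hα.mono_measure
    (Measure.restrict_mono (Ioc_subset_Ioc ha hb) le_rfl), fun s hs => ?_⟩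
  have h1 := he s ⟨ha.trans hs.1, hs.2.trans hb⟩
  have h2 := he a' ⟨ha, hab.trans hb⟩
  simp only [h1, h2]
  rw [add_assoc, intervalIntegral.integral_add_adjacent_intervals]
  · exact hi.mono_set (by rw [uIcc_of_le ha, uIcc_of_le (by linarith [hs.1, hs.2])]
                          exact Icc_subset_Icc le_rfl (hab.trans hb))
  · exact hi.mono_set (by rw [uIcc_of_le hs.1, uIcc_of_le (by linarith [hs.1, hs.2])]
                          exact Icc_subset_Icc ha (hs.2.trans hb))

/-- Gluing two admissible curves. -/
theorem AdmOn.concat {z : ℝ → Junction N} {c : ℝ} (hp : 1 < p) (hab : a ≤ b) (hbc : b ≤ c)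
    (hy : AdmOn p a b y) (hz : AdmOn p b c z) (hyz : y b = z b) :
    AdmOn p a c (fun s => if s ≤ b then y s else z s) := by
  obtain ⟨hyc, α, hα, hyi⟩ := hy
  obtain ⟨hzc, β, hβ, hzi⟩ := hz
  have hαi := MemLp.intervalIntegrable_of_Ioc hp hab hα
  have hβi := MemLp.intervalIntegrable_of_Ioc hp hbc hβ
  refine ⟨?_, (Iic b).piecewise α β, ?_, ?_⟩
  · have h1 : ContinuousOn (fun s => if s ≤ b then y s else z s) (Icc a b) :=
      hyc.congr fun s hs => by simp [hs.2]
    have h2 : ContinuousOn (fun s => if s ≤ b then y s else z s) (Icc b c) :=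
      hzc.congr fun s hs => by
        rcases hs.1.eq_or_lt with h | h
        · subst h; simp [hyz]
        · simp [not_le.2 h]
    rw [← Icc_union_Icc_eq_Icc hab hbc]
    exact h1.union_of_isClosed h2 isClosed_Icc isClosed_Icc
  · refine MemLp.piecewise measurableSet_Iic (hα.mono_measure ?_) (hβ.mono_measure ?_)
    · rw [Measure.restrict_restrict measurableSet_Iic]
      exact Measure.restrict_mono (show Iic b ∩ Ioc a c ⊆ Ioc a b from
        fun x hx => ⟨hx.2.1, hx.1⟩) le_rfl
    · rw [Measure.restrict_restrict measurableSet_Iic.compl]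
      exact Measure.restrict_mono (show (Iic b)ᶜ ∩ Ioc a c ⊆ Ioc b c from
        fun x hx => ⟨not_le.1 hx.1, hx.2.2⟩) le_rfl
  · intro s hs
    have ea : (if a ≤ b then y a else z a) = y a := by simp [hab]
    simp only [ea]
    have i1 : ∀ s, a ≤ s → s ≤ b → ∫ τ in a..s, (Iic b).piecewise α β τ = ∫ τ in a..s, α τ := by
      intro s has hsb
      refine intervalIntegral.integral_congr fun τ hτ => ?_
      rw [uIcc_of_le has] at hτ
      exact piecewise_eq_of_mem _ _ _ (hτ.2.trans hsb)
    by_cases hsb : s ≤ b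
    · simp only [hsb, if_true]
      rw [i1 s hs.1 hsb]; exact hyi s ⟨hs.1, hsb⟩
    · simp only [hsb, if_false]
      have hbs : b ≤ s := (not_le.1 hsb).le
      have e2 : ∀ τ ∈ uIoc b s, (Iic b).piecewise α β τ = β τ := by
        intro τ hτ
        rw [uIoc_of_le hbs] at hτ
        exact piecewise_eq_of_notMem _ _ _ (not_le.2 hτ.1)
      have hβs : IntervalIntegrable β volume b s := hβi.mono_set (by
        rw [uIcc_of_le hbs, uIcc_of_le hbc]; exact Icc_subset_Icc le_rfl hs.2)
      have h12 : ∫ τ in a..s, (Iic b).piecewise α β τ = (∫ τ in a..b, α τ) + ∫ τ in b..s, β τ := by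
        rw [← intervalIntegral.integral_add_adjacent_intervals (b := b), i1 b hab le_rfl]
        · congr 1
          exact intervalIntegral.integral_congr_ae (ae_of_all _ e2)
        · refine hαi.congr fun τ hτ => ?_
          rw [uIoc_of_le hab] at hτ
          exact (piecewise_eq_of_mem (Iic b) α β hτ.2).symm
        · exact hβs.congr fun τ hτ => (e2 τ hτ).symm
      have h1 := hzi s ⟨hbs, hs.2⟩
      have h2 := hyi b ⟨hab, le_rfl⟩
      simp only [← hyz] at h1
      simp only at h2
      rw [h12, h1, h2, add_assoc]

/-- A curve inside one edge is admissible when its radial part is. -/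
theorem admOn_pt (i : Fin N) {r β : ℝ → ℝ} (hr : ∀ s ∈ Icc a b, 0 ≤ r s)
    (hc : ContinuousOn r (Icc a b)) (hab : a ≤ b)
    (hβ : MemLp β (ENNReal.ofReal p) (volume.restrict (Ioc a b)))
    (hi : ∀ s ∈ Icc a b, r s = r a + ∫ τ in a..s, β τ) (hβi : IntervalIntegrable β volume a b) :
    AdmOn p a b fun s => pt i (r s) := by
  set A : ℝ →L[ℝ] EuclideanSpace ℝ (Fin N) :=
    (ContinuousLinearMap.id ℝ ℝ).smulRight (EuclideanSpace.single i (1 : ℝ)) with hA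
  have hAr : ∀ x, A x = EuclideanSpace.single i x := by
    intro x; ext k
    by_cases hk : k = i <;> simp [hA, hk]
  refine ⟨(continuous_pt i).comp_continuousOn hc, fun τ => A (β τ), A.comp_memLp' hβ, ?_⟩
  intro s hs
  simp only [pt_vec i (hr s hs), pt_vec i (hr a (left_mem_Icc.2 hab)), ← hAr]
  have hs' : IntervalIntegrable β volume a s := hβi.mono_set (by
    rw [uIcc_of_le hs.1, uIcc_of_le hab]; exact Icc_subset_Icc le_rfl hs.2)
  rw [A.intervalIntegral_comp_comm hs', hi s hs, map_add]

end Paths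

end JunctionMFG

/-! ### Differentiation of admissible curves -/

namespace JunctionMFG

open JunctionMFG.Junction (pt edge vertex)

section PathCalculus

variable {N : ℕ} {p a b : ℝ} {y : ℝ → Junction N}

/-- Lebesgue differentiation. The endpoint `b` is a null set; discarding it leaves a full
neighbourhood of `τ` in `[a, b]`, so the derivative is two-sided. -/
theorem ae_hasDerivAt_of_primitive {f β : ℝ → ℝ} (hab : a ≤ b)
    (hi : IntervalIntegrable β volume a b) (h : ∀ s ∈ Icc a b, f s = f a + ∫ τ in a..s, β τ) :
    ∀ᵐ τ ∂volume.restrict (Ioc a b), τ ∈ Ioo a b ∧ HasDerivAt f (β τ) τ := by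
  rw [ae_restrict_iff' measurableSet_Ioc]
  have hb : ∀ᵐ x : ℝ, x ≠ b := by simp [ae_iff, measure_singleton]
  filter_upwards [hi.ae_hasDerivAt_integral, hb] with τ hτ hτb hmem
  have hIoo : τ ∈ Ioo a b := ⟨hmem.1, lt_of_le_of_ne hmem.2 hτb⟩
  refine ⟨hIoo, ?_⟩
  have h1 := hτ (by rw [uIcc_of_le hab]; exact Ioc_subset_Icc_self hmem) a left_mem_uIcc
  refine (h1.const_add (f a)).congr_of_eventuallyEq ?_
  filter_upwards [Ioo_mem_nhds hIoo.1 hIoo.2] with s hs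
  exact h s (Ioo_subset_Icc_self hs)

/-- On the junction the norm is the sum of the coordinates, so the radial part has as derivative a
linear image of the vector derivative. -/
theorem AdmOn.exists_radial (h : AdmOn p a b y) (hp : 1 < p) (hab : a ≤ b) :
    ∃ β : ℝ → ℝ, MemLp β (ENNReal.ofReal p) (volume.restrict (Ioc a b)) ∧
      ∀ s ∈ Icc a b, (y s).abs = (y a).abs + ∫ τ in a..s, β τ := by
  obtain ⟨hc, α, hα, hi⟩ := h
  set A : EuclideanSpace ℝ (Fin N) →L[ℝ] ℝ := ∑ k, EuclideanSpace.proj k with hA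
  have hAr : ∀ x : Junction N, A x.vec = x.abs := fun x => by
    rw [abs_eq_sum, hA]; simp
  have hαi := MemLp.intervalIntegrable_of_Ioc hp hab hα
  refine ⟨fun τ => A (α τ), A.comp_memLp' hα, fun s hs => ?_⟩
  have hs' : IntervalIntegrable α volume a s := hαi.mono_set (by
    rw [uIcc_of_le hs.1, uIcc_of_le hab]; exact Icc_subset_Icc le_rfl hs.2)
  rw [A.intervalIntegral_comp_comm hs', ← hAr, ← hAr, ← map_add]
  exact congrArg A (hi s hs)

theorem AdmOn.vel_memLp (h : AdmOn p a b y) (hp : 1 < p) (hab : a ≤ b) :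
    MemLp (vel y) (ENNReal.ofReal p) (volume.restrict (Ioc a b)) := by
  obtain ⟨β, hβ, hi⟩ := h.exists_radial hp hab
  refine (memLp_congr_ae ?_).2 hβ
  filter_upwards [ae_hasDerivAt_of_primitive hab (MemLp.intervalIntegrable_of_Ioc hp hab hβ) hi]
    with τ hτ
  exact hτ.2.deriv

theorem AdmOn.vel_integrable (h : AdmOn p a b y) (hp : 1 < p) (hab : a ≤ b) :
    IntervalIntegrable (vel y) volume a b :=
  MemLp.intervalIntegrable_of_Ioc hp hab (h.vel_memLp hp hab)

theorem AdmOn.abs_eq_add_integral (h : AdmOn p a b y) (hp : 1 < p) (hab : a ≤ b) :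
    ∀ s ∈ Icc a b, (y s).abs = (y a).abs + ∫ τ in a..s, vel y τ := by
  obtain ⟨β, hβ, hi⟩ := h.exists_radial hp hab
  have hae := ae_hasDerivAt_of_primitive hab (MemLp.intervalIntegrable_of_Ioc hp hab hβ) hi
  intro s hs
  rw [hi s hs]
  congr 1
  rw [intervalIntegral.integral_of_le hs.1, intervalIntegral.integral_of_le hs.1]
  refine integral_congr_ae ?_
  filter_upwards [ae_restrict_of_ae_restrict_of_subset (Ioc_subset_Ioc_right hs.2) hae] with τ hτ
  exact hτ.2.deriv.symm

theorem AdmOn.ae_hasDerivAt (h : AdmOn p a b y) (hp : 1 < p) (hab : a ≤ b) :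
    ∀ᵐ τ ∂volume.restrict (Ioc a b),
      τ ∈ Ioo a b ∧ HasDerivAt (fun σ => (y σ).abs) (vel y τ) τ :=
  ae_hasDerivAt_of_primitive hab (h.vel_integrable hp hab) (h.abs_eq_add_integral hp hab)

theorem AdmOn.vel_pow_integrable (h : AdmOn p a b y) (hp : 1 < p) (hab : a ≤ b) :
    IntervalIntegrable (fun τ => |vel y τ| ^ p) volume a b := by
  rw [intervalIntegrable_iff_integrableOn_Ioc_of_le hab]
  have hp0 : 0 < p := by linarith
  have := (h.vel_memLp hp hab).integrable_norm_rpow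
    (by simpa using hp0) ENNReal.ofReal_ne_top
  simpa [IntegrableOn, ENNReal.toReal_ofReal hp0.le] using this

/-- The function `|y|` is minimal there, so its derivative vanishes if it exists; otherwise `deriv`
has the default value `0`. Hence this holds at every such time, not only almost every one. -/
theorem vel_eq_zero {τ : ℝ} (h : (y τ).abs = 0) : vel y τ = 0 := by
  refine IsLocalMin.deriv_eq_zero (f := fun σ => (y σ).abs) (Eventually.of_forall fun σ => ?_)
  simpa [h] using (y σ).abs_nn

/-- While the curve is in the open edge `k`, its `k`-th coordinate coincides with `|y|`. Elsewhere
that coordinate is at its minimum `0`, so its derivative vanishes wherever it exists. -/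
theorem AdmOn.coord_eq (h : AdmOn p a b y) (hp : 1 < p) (hab : a ≤ b) (k : Fin N) :
    (y b).vec k - (y a).vec k = ∫ τ in a..b, {τ | y τ ∈ edge k \ vertex}.indicator (vel y) τ := by
  obtain ⟨hc, α, hα, hi⟩ := id h
  have hαi := MemLp.intervalIntegrable_of_Ioc hp hab hα
  set A : EuclideanSpace ℝ (Fin N) →L[ℝ] ℝ := EuclideanSpace.proj k with hA
  have hk : ∀ s ∈ Icc a b, (y s).vec k = (y a).vec k + ∫ τ in a..s, A (α τ) := by
    intro s hs
    have hs' : IntervalIntegrable α volume a s := hαi.mono_set (by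
      rw [uIcc_of_le hs.1, uIcc_of_le hab]; exact Icc_subset_Icc le_rfl hs.2)
    rw [A.intervalIntegral_comp_comm hs']
    have := congrArg A (hi s hs)
    rw [map_add] at this
    exact this
  have hAi : IntervalIntegrable (fun τ => A (α τ)) volume a b :=
    MemLp.intervalIntegrable_of_Ioc hp hab (A.comp_memLp' hα)
  rw [hk b (right_mem_Icc.2 hab), add_sub_cancel_left, intervalIntegral.integral_of_le hab,
    intervalIntegral.integral_of_le hab]
  refine integral_congr_ae ?_
  filter_upwards [ae_hasDerivAt_of_primitive hab hAi hk, h.ae_hasDerivAt hp hab] with τ h1 h2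
  have hcτ : ContinuousAt y τ := hc.continuousAt (Icc_mem_nhds h1.1.1 h1.1.2)
  by_cases hmem : y τ ∈ edge k \ vertex
  · rw [indicator_of_mem (show τ ∈ {τ | y τ ∈ edge k \ vertex} from hmem)]
    refine h1.2.unique (h2.2.congr_of_eventuallyEq ?_)
    filter_upwards [hcτ.preimage_mem_nhds ((isOpen_edge_diff k).mem_nhds hmem)] with s hs
    exact coord_eq_abs hs.1
  · rw [indicator_of_notMem (show τ ∉ {τ | y τ ∈ edge k \ vertex} from hmem)]
    refine IsLocalMin.hasDerivAt_eq_zero (Eventually.of_forall fun s => ?_) h1.2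
    simp only [coord_eq_zero hmem]
    exact coord_nonneg _ _

theorem AdmOn.measurableSet_edge (h : AdmOn p a b y) (k : Fin N) :
    NullMeasurableSet {τ | y τ ∈ edge k \ vertex} (volume.restrict (Ioc a b)) := by
  have := (h.1.mono Ioc_subset_Icc_self).aemeasurable (μ := volume) measurableSet_Ioc
  exact this.nullMeasurableSet_preimage (isOpen_edge_diff k).measurableSet

theorem AdmOn.indicator_integrable (h : AdmOn p a b y) (hp : 1 < p) (hab : a ≤ b) (k : Fin N) :
    IntervalIntegrable ({τ | y τ ∈ edge k \ vertex}.indicator (vel y)) volume a b := by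
  rw [intervalIntegrable_iff_integrableOn_Ioc_of_le hab]
  have := h.vel_integrable hp hab
  rw [intervalIntegrable_iff_integrableOn_Ioc_of_le hab] at this
  exact this.indicator₀ (h.measurableSet_edge k)

/-- The geodesic distance is the `ℓ¹` distance of the coordinates, and at each time at most one
coordinate moves. -/
theorem AdmOn.dist_le (h : AdmOn p a b y) (hp : 1 < p) (hab : a ≤ b) :
    dist (y a) (y b) ≤ ∫ τ in a..b, |vel y τ| := by
  rw [dist_comm, dist_eq_sum]
  have h1 : ∀ k, |(y b).vec k - (y a).vec k| ≤
      ∫ τ in a..b, |{τ | y τ ∈ edge k \ vertex}.indicator (vel y) τ| := by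
    intro k
    rw [h.coord_eq hp hab k]
    exact intervalIntegral.abs_integral_le_integral_abs hab
  refine (Finset.sum_le_sum fun k _ => h1 k).trans ?_
  rw [← intervalIntegral.integral_finsetSum fun k _ => (h.indicator_integrable hp hab k).abs]
  refine intervalIntegral.integral_mono_on hab ?_ (h.vel_integrable hp hab).abs fun τ _ => ?_
  · simpa only [Finset.sum_fn] using IntervalIntegrable.sum Finset.univ
      fun k _ => (h.indicator_integrable hp hab k).abs
  · rcases abs_vec_pos_cases (y τ) with h0 | ⟨i, hi⟩
    · rw [vel_eq_zero h0, abs_zero]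
      refine (Finset.sum_eq_zero fun k _ => ?_).le
      rw [indicator_of_notMem, abs_zero]
      exact fun hk => hk.2 (mem_vertex_iff.2 h0)
    · rw [Finset.sum_eq_single i]
      · rw [indicator_of_mem (show τ ∈ {τ | y τ ∈ edge i \ vertex} from hi)]
      · intro k _ hk
        rw [indicator_of_notMem, abs_zero]
        intro hk'
        have e := mem_edge_iff.1 hi.1
        change y τ ∈ edge k \ vertex at hk'
        rw [e, pt_mem_edge_diff (y τ).abs_nn] at hk'
        exact hk hk'.1.symm
      · simp

theorem AdmOn.exists_abs_le (h : AdmOn p a b y) : ∃ r, 0 ≤ r ∧ ∀ τ ∈ Icc a b, (y τ).abs ≤ r := by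
  obtain ⟨r, hr⟩ := isCompact_Icc.exists_bound_of_continuousOn
    (continuous_abs'.comp_continuousOn h.1)
  refine ⟨max r 0, le_max_right _ _, fun τ hτ => ?_⟩
  have := hr τ hτ
  rw [Function.comp_apply, Real.norm_of_nonneg (y τ).abs_nn] at this
  exact this.trans (le_max_left _ _)

end PathCalculus

end JunctionMFG

/-! ### Time dependent Lagrangians -/

namespace JunctionMFG

open JunctionMFG.Junction (pt edge vertex)

/-- Time dependent running costs on the edges and at the vertex. -/
structure Lagr (N : ℕ) where
  edgeCost : Fin N → ℝ → ℝ → ℝ → ℝ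
  vertexCost : ℝ → ℝ

namespace Lagr

variable {N : ℕ} (Λ : Lagr N)

/-- The running cost at time `τ`, at the point `x`, for the scalar velocity `a`. -/
noncomputable def run (τ : ℝ) (x : Junction N) (a : ℝ) : ℝ :=
  ∑ i, (edge i \ vertex).indicator (fun z => Λ.edgeCost i τ z.abs a) x +
    vertex.indicator (fun _ => Λ.vertexCost τ) x

/-- The cost of a curve over `[a, b]`. -/
noncomputable def cost (a b : ℝ) (y : ℝ → Junction N) : ℝ :=
  ∫ τ in a..b, Λ.run τ (y τ) (vel y τ)

/-- Continuity, coercivity and growth of a Lagrangian, locally uniform in the position. -/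
structure Tame (p C₀ : ℝ) : Prop where
  cont : ∀ i, Continuous fun q : ℝ × ℝ × ℝ => Λ.edgeCost i q.1 q.2.1 q.2.2
  cont_vertex : Continuous Λ.vertexCost
  pos : 0 < C₀
  coercive : ∀ i τ x a, 0 ≤ x → C₀ * (|a| ^ p - 1) ≤ Λ.edgeCost i τ x a
  coercive_vertex : ∀ τ, -C₀ ≤ Λ.vertexCost τ
  vertex_le : ∀ i τ, Λ.vertexCost τ ≤ Λ.edgeCost i τ 0 0
  bound : ∀ r, ∃ K, 0 ≤ K ∧ ∀ i τ, ∀ x ∈ Icc 0 r, ∀ a, |Λ.edgeCost i τ x a| ≤ K * (1 + |a| ^ p)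
  lip : ∀ r, ∃ K, 0 ≤ K ∧ ∀ i τ, ∀ x ∈ Icc 0 r, ∀ x' ∈ Icc 0 r, ∀ a a', |a - a'| ≤ 1 →
    |Λ.edgeCost i τ x a - Λ.edgeCost i τ x' a'| ≤ K * (1 + |a| ^ p) * (|x - x'| + |a - a'|)

variable {Λ} {p C₀ : ℝ} {a b : ℝ} {y z : ℝ → Junction N}

theorem run_of_mem {i : Fin N} {x : Junction N} (hx : x ∈ edge i \ vertex) (τ v : ℝ) :
    Λ.run τ x v = Λ.edgeCost i τ x.abs v := by
  rw [run, indicator_of_notMem hx.2, add_zero, Finset.sum_eq_single i]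
  · rw [indicator_of_mem hx]
  · intro k _ hk
    rw [indicator_of_notMem]
    intro hk'
    have e := mem_edge_iff.1 hx.1
    rw [e, pt_mem_edge_diff x.abs_nn] at hk'
    exact hk hk'.1.symm
  · simp

theorem run_vertex {x : Junction N} (hx : x.abs = 0) (τ v : ℝ) :
    Λ.run τ x v = Λ.vertexCost τ := by
  have hv : x ∈ vertex := mem_vertex_iff.2 hx
  rw [run, indicator_of_mem hv, Finset.sum_eq_zero, zero_add]
  intro k _
  rw [indicator_of_notMem]
  exact fun h => h.2 hv

theorem Tame.le_run (h : Λ.Tame p C₀) (hp : 1 < p) (τ : ℝ) :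
    C₀ * (|vel y τ| ^ p - 1) ≤ Λ.run τ (y τ) (vel y τ) := by
  rcases abs_vec_pos_cases (y τ) with h0 | ⟨i, hi⟩
  · rw [run_vertex h0, vel_eq_zero h0, abs_zero, Real.zero_rpow (by linarith)]
    have := h.coercive_vertex τ
    linarith
  · rw [run_of_mem hi]
    exact h.coercive i τ _ _ (y τ).abs_nn

/-- The vertex cost has no upper bound of its own; `vertex_le` bounds it by the cost of rest on an
edge. -/
theorem Tame.abs_run_le [NeZero N] (h : Λ.Tame p C₀) (r : ℝ) (hr : 0 ≤ r) :
    ∃ K, 0 ≤ K ∧ ∀ τ x v, x.abs ≤ r → |Λ.run τ x v| ≤ K * (1 + |v| ^ p) := by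
  obtain ⟨K, hK, hb⟩ := h.bound r
  have hC := h.pos
  refine ⟨K + C₀, by linarith, fun τ x v hx => ?_⟩
  have hv : 0 ≤ |v| ^ p := Real.rpow_nonneg (abs_nonneg v) p
  rcases abs_vec_pos_cases x with h0 | ⟨i, hi⟩
  · rw [run_vertex h0, abs_le]
    have h1 := h.coercive_vertex τ
    have h2 := h.vertex_le 0 τ
    have h3 := (abs_le.1 (hb 0 τ 0 ⟨le_rfl, hr⟩ 0)).2
    have h4 : |(0 : ℝ)| ^ p ≤ 1 := by
      rw [abs_zero]; exact Real.zero_rpow_le_one p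
    have h5 := h.coercive 0 τ 0 0 le_rfl
    constructor
    · nlinarith
    -- The exponent is arbitrary here, and `0 ^ p` depends on whether `p` vanishes.
    · by_cases hp : p = 0
      · subst hp; simp only [Real.rpow_zero] at *; nlinarith
      · rw [abs_zero, Real.zero_rpow hp] at h3; nlinarith
  · rw [run_of_mem hi]
    have := hb i τ x.abs ⟨x.abs_nn, hx⟩ v
    nlinarith

/-- Equality on the open interval suffices: the velocity is a local quantity and the endpoints are
negligible. -/
theorem cost_congr (hab : a ≤ b) (h : EqOn y z (Ioo a b)) : Λ.cost a b y = Λ.cost a b z := by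
  rw [cost, cost, intervalIntegral.integral_of_le hab, intervalIntegral.integral_of_le hab,
    integral_Ioc_eq_integral_Ioo, integral_Ioc_eq_integral_Ioo]
  refine setIntegral_congr_fun measurableSet_Ioo fun τ hτ => ?_
  have hv : vel y τ = vel z τ := by
    refine Filter.EventuallyEq.deriv_eq ?_
    filter_upwards [Ioo_mem_nhds hτ.1 hτ.2] with s hs
    rw [h hs]
  simp only [hv, h hτ]

theorem integrable_of_pow_bound (hp : 1 < p) (hab : a ≤ b) (hy : AdmOn p a b y) {F : ℝ → ℝ}
    (hF : AEStronglyMeasurable F (volume.restrict (Ioc a b))) {K : ℝ}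
    (hK : ∀ τ ∈ Ioc a b, |F τ| ≤ K * (1 + |vel y τ| ^ p)) : IntervalIntegrable F volume a b := by
  have h1 : IntervalIntegrable (fun τ => K * (1 + |vel y τ| ^ p)) volume a b :=
    (intervalIntegrable_const.add (hy.vel_pow_integrable hp hab)).const_mul K
  refine h1.mono_fun (by rwa [uIoc_of_le hab]) ?_
  rw [uIoc_of_le hab]
  filter_upwards [self_mem_ae_restrict measurableSet_Ioc] with τ hτ
  exact (hK τ hτ).trans (le_abs_self _)

theorem Tame.run_integrable [NeZero N] (h : Λ.Tame p C₀) (hp : 1 < p) (hab : a ≤ b)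
    (hy : AdmOn p a b y) :
    IntervalIntegrable (fun τ => Λ.run τ (y τ) (vel y τ)) volume a b := by
  obtain ⟨r, hr0, hr⟩ := AdmOn.exists_abs_le hy
  obtain ⟨K, hK, hb⟩ := h.abs_run_le r hr0
  refine integrable_of_pow_bound hp hab hy ?_ fun τ hτ => hb τ (y τ) _ (hr τ (Ioc_subset_Icc_self hτ))
  have hym : AEMeasurable y (volume.restrict (Ioc a b)) :=
    (hy.1.mono Ioc_subset_Icc_self).aemeasurable measurableSet_Ioc
  have hq : AEMeasurable (fun τ => (τ, y τ, vel y τ)) (volume.restrict (Ioc a b)) :=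
    aemeasurable_id.prodMk (hym.prodMk (measurable_deriv _).aemeasurable)
  have hg : Measurable fun q : ℝ × Junction N × ℝ => Λ.run q.1 q.2.1 q.2.2 := by
    have hfst : Measurable fun q : ℝ × Junction N × ℝ => q.2.1 := measurable_fst.comp measurable_snd
    refine Measurable.add (Finset.measurable_fun_sum _ fun i _ => ?_) ?_
    · have hm : Measurable fun q : ℝ × Junction N × ℝ => Λ.edgeCost i q.1 q.2.1.abs q.2.2 :=
        (h.cont i).measurable.comp (measurable_fst.prodMk
          ((continuous_abs'.measurable.comp hfst).prodMk (measurable_snd.comp measurable_snd)))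
      exact hm.indicator (hfst (isOpen_edge_diff i).measurableSet)
    · exact (h.cont_vertex.measurable.comp measurable_fst).indicator (hfst measurableSet_vertex)
  exact (hg.comp_aemeasurable hq).aestronglyMeasurable

theorem Tame.edge_integrable (h : Λ.Tame p C₀) (hp : 1 < p) (hab : a ≤ b)
    (hy : AdmOn p a b y) (i : Fin N) :
    IntervalIntegrable (fun τ => Λ.edgeCost i τ (y τ).abs (vel y τ)) volume a b := by
  obtain ⟨r, hr0, hr⟩ := AdmOn.exists_abs_le hy
  obtain ⟨K, hK, hb⟩ := h.bound r
  refine integrable_of_pow_bound hp hab hy ?_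
    fun τ hτ => hb i τ _ ⟨(y τ).abs_nn, hr τ (Ioc_subset_Icc_self hτ)⟩ _
  have hym : AEMeasurable (fun τ => (y τ).abs) (volume.restrict (Ioc a b)) :=
    (continuous_abs'.comp_continuousOn (hy.1.mono Ioc_subset_Icc_self)).aemeasurable
      measurableSet_Ioc
  exact ((h.cont i).measurable.comp_aemeasurable
    (aemeasurable_id.prodMk (hym.prodMk (measurable_deriv _).aemeasurable))).aestronglyMeasurable

theorem Tame.cost_add [NeZero N] (h : Λ.Tame p C₀) (hp : 1 < p) {c : ℝ} (hab : a ≤ b) (hbc : b ≤ c)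
    (hy : AdmOn p a c y) : Λ.cost a b y + Λ.cost b c y = Λ.cost a c y :=
  intervalIntegral.integral_add_adjacent_intervals
    (h.run_integrable hp hab (hy.mono hp le_rfl hab hbc))
    (h.run_integrable hp hbc (hy.mono hp hab hbc le_rfl))

theorem Tame.pow_le_cost [NeZero N] (h : Λ.Tame p C₀) (hp : 1 < p) (hab : a ≤ b)
    (hy : AdmOn p a b y) :
    C₀ * (∫ τ in a..b, |vel y τ| ^ p) - C₀ * (b - a) ≤ Λ.cost a b y := by
  have hi := hy.vel_pow_integrable hp hab
  have e : C₀ * (∫ τ in a..b, |vel y τ| ^ p) - C₀ * (b - a)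
      = ∫ τ in a..b, C₀ * (|vel y τ| ^ p - 1) := by
    rw [intervalIntegral.integral_const_mul, intervalIntegral.integral_sub hi
      intervalIntegrable_const, intervalIntegral.integral_const]
    simp; ring
  rw [e]
  exact intervalIntegral.integral_mono_on hab
    ((hi.sub intervalIntegrable_const).const_mul _)
    (h.run_integrable hp hab hy) fun τ _ => h.le_run hp τ

theorem integral_pow_nonneg (hab : a ≤ b) : 0 ≤ ∫ τ in a..b, |vel y τ| ^ p :=
  intervalIntegral.integral_nonneg hab fun _ _ => Real.rpow_nonneg (abs_nonneg _) _

theorem Tame.neg_le_cost [NeZero N] (h : Λ.Tame p C₀) (hp : 1 < p) (hab : a ≤ b)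
    (hy : AdmOn p a b y) : -C₀ * (b - a) ≤ Λ.cost a b y := by
  have h1 := h.pow_le_cost hp hab hy
  have h2 : 0 ≤ C₀ * ∫ τ in a..b, |vel y τ| ^ p := mul_nonneg h.pos.le (integral_pow_nonneg hab)
  linarith

/-- Superlinearity of `C₀ (|v|^p - 1)`. -/
theorem exists_linear_le_pow (hp : 1 < p) (hC : 0 < C₀) (l : ℝ) :
    ∃ K, 0 ≤ K ∧ ∀ v : ℝ, l * |v| ≤ C₀ * (|v| ^ p - 1) + K := by
  -- Beyond `B` the factor `C₀ |v|^(p-1)` exceeds `l`; below it the linear term is at most `|l|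
  -- |B|`.
  obtain ⟨B, hB⟩ := (((tendsto_rpow_atTop (show 0 < p - 1 by linarith)).const_mul_atTop hC
    ).eventually_ge_atTop l).exists_forall_of_atTop
  refine ⟨|l| * |B| + C₀, by positivity, fun v => ?_⟩
  have hv := abs_nonneg v
  by_cases h : B ≤ |v|
  · have h1 := hB _ h
    have h2 : |v| ^ p = |v| ^ (p - 1) * |v| := by
      rcases hv.eq_or_lt with h0 | h0
      · rw [← h0, Real.zero_rpow (by linarith), mul_zero]
      · rw [← Real.rpow_add_one h0.ne']; ring_nf
    have h3 := mul_le_mul_of_nonneg_right h1 hv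
    have h4 : 0 ≤ |l| * |B| := by positivity
    rw [h2]; nlinarith
  · have h1 : 0 ≤ C₀ * |v| ^ p := mul_nonneg hC.le (Real.rpow_nonneg hv p)
    have h2 : l * |v| ≤ |l| * |v| := mul_le_mul_of_nonneg_right (le_abs_self l) hv
    have h3 : |l| * |v| ≤ |l| * |B| :=
      mul_le_mul_of_nonneg_left ((not_le.1 h).le.trans (le_abs_self B)) (abs_nonneg l)
    linarith

/-- The cost dominates any multiple of the length, up to a multiple of the elapsed time. -/
theorem Tame.length_le_cost [NeZero N] (h : Λ.Tame p C₀) (hp : 1 < p) (l : ℝ) :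
    ∃ K, 0 ≤ K ∧ ∀ (a b : ℝ) (y : ℝ → Junction N), a ≤ b → AdmOn p a b y →
      l * (∫ τ in a..b, |vel y τ|) ≤ Λ.cost a b y + K * (b - a) := by
  obtain ⟨K, hK, hl⟩ := exists_linear_le_pow hp h.pos l
  refine ⟨K, hK, fun a b y hab hy => ?_⟩
  have e : Λ.cost a b y + K * (b - a) = ∫ τ in a..b, (Λ.run τ (y τ) (vel y τ) + K) := by
    rw [intervalIntegral.integral_add (h.run_integrable hp hab hy)
      intervalIntegrable_const, intervalIntegral.integral_const, cost]
    simp; ring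
  rw [e, ← intervalIntegral.integral_const_mul]
  exact intervalIntegral.integral_mono_on hab ((hy.vel_integrable hp hab).abs.const_mul l)
    ((h.run_integrable hp hab hy).add intervalIntegrable_const)
    fun τ _ => (hl _).trans (by have := h.le_run (y := y) hp τ; linarith)

/-- A curve inside the edge `J_i` costs at most its cost for the Lagrangian of `J_i`. -/
theorem Tame.cost_le_edge [NeZero N] (h : Λ.Tame p C₀) (hp : 1 < p) (hab : a ≤ b)
    (hy : AdmOn p a b y) {i : Fin N} (hi : ∀ τ ∈ Ioo a b, y τ = pt i (y τ).abs) :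
    Λ.cost a b y ≤ ∫ τ in a..b, Λ.edgeCost i τ (y τ).abs (vel y τ) := by
  refine intervalIntegral.integral_mono_on_of_le_Ioo hab (h.run_integrable hp hab hy)
    (h.edge_integrable hp hab hy i) fun τ hτ => ?_
  -- At times spent at the vertex the velocity is zero, so the comparison there is exactly
  -- `vertex_le`.
  rcases (y τ).abs_nn.eq_or_lt with h0 | h0
  · rw [run_vertex h0.symm, ← h0, vel_eq_zero h0.symm]
    exact h.vertex_le i τ
  · rw [run_of_mem (i := i)]
    rw [hi τ hτ]; exact (pt_mem_edge_diff h0.le).2 ⟨rfl, h0⟩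

theorem cost_eq_edge (hab : a ≤ b) {i : Fin N} (hi : ∀ τ ∈ Ioo a b, y τ = pt i (y τ).abs)
    (hpos : ∀ τ ∈ Ioo a b, 0 < (y τ).abs) :
    Λ.cost a b y = ∫ τ in a..b, Λ.edgeCost i τ (y τ).abs (vel y τ) := by
  rw [cost, intervalIntegral.integral_of_le hab, intervalIntegral.integral_of_le hab,
    integral_Ioc_eq_integral_Ioo, integral_Ioc_eq_integral_Ioo]
  refine setIntegral_congr_fun measurableSet_Ioo fun τ hτ => ?_
  refine run_of_mem ?_ _ _
  rw [hi τ hτ]; exact (pt_mem_edge_diff (y τ).abs_nn).2 ⟨rfl, hpos τ hτ⟩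

end Lagr

end JunctionMFG

/-! ### The value function -/

namespace JunctionMFG

open JunctionMFG.Junction (pt edge vertex)

section Value

variable {N : ℕ} {p C₀ T M : ℝ} {Λ : Lagr N} {g : Junction N → ℝ}

theorem mem_Gam {t : ℝ} {x : Junction N} {y : ℝ → Junction N} :
    y ∈ Gam p T t x ↔ AdmOn p t T y ∧ y t = x := by
  simp only [Gam, AdmOn]
  exact and_assoc.symm

/-- The value function for the terminal cost `g`. -/
noncomputable def Lagr.value (Λ : Lagr N) (p T : ℝ) (g : Junction N → ℝ) (x : Junction N) (t : ℝ) :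
    ℝ :=
  sInf ((fun y => Λ.cost t T y + g (y T)) '' Gam p T t x)

/-- Affine motion in an edge. -/
theorem admOn_segment (i : Fin N) {a b r v : ℝ} (hab : a ≤ b)
    (hr : ∀ s ∈ Icc a b, 0 ≤ r + v * (s - a)) : AdmOn p a b fun s => pt i (r + v * (s - a)) := by
  refine admOn_pt i (β := fun _ => v) hr (by fun_prop) hab (memLp_const _) (fun s _ => ?_)
    intervalIntegrable_const
  rw [intervalIntegral.integral_const]; simp; ring

theorem vel_pt {i : Fin N} {r : ℝ → ℝ} {τ v : ℝ} (hr : ∀ᶠ s in 𝓝 τ, 0 ≤ r s)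
    (hv : HasDerivAt r v τ) : vel (fun s => pt i (r s)) τ = v := by
  refine (hv.congr_of_eventuallyEq ?_).deriv
  filter_upwards [hr] with s hs
  exact pt_abs i hs

theorem Lagr.Tame.cost_segment_le [NeZero N] (h : Λ.Tame p C₀) (hp : 1 < p) (i : Fin N)
    {a b r v : ℝ} (hab : a ≤ b) (hr : ∀ s ∈ Icc a b, 0 ≤ r + v * (s - a)) :
    Λ.cost a b (fun s => pt i (r + v * (s - a))) ≤
      ∫ τ in a..b, Λ.edgeCost i τ (r + v * (τ - a)) v := by
  refine (h.cost_le_edge hp hab (admOn_segment i hab hr) (i := i) fun τ hτ => ?_).trans_eq ?_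
  · rw [pt_abs i (hr τ (Ioo_subset_Icc_self hτ))]
  · rw [intervalIntegral.integral_of_le hab, intervalIntegral.integral_of_le hab,
      integral_Ioc_eq_integral_Ioo, integral_Ioc_eq_integral_Ioo]
    refine setIntegral_congr_fun measurableSet_Ioo fun τ hτ => ?_
    have hv : vel (fun s => pt i (r + v * (s - a))) τ = v := by
      refine vel_pt ?_ ?_
      · filter_upwards [Ioo_mem_nhds hτ.1 hτ.2] with s hs
        exact hr s (Ioo_subset_Icc_self hs)
      · simpa using (((hasDerivAt_id τ).sub_const a).const_mul v).const_add r
    simp only [hv, pt_abs i (hr τ (Ioo_subset_Icc_self hτ))]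

theorem admOn_const (hab : a ≤ b) (x : Junction N) : AdmOn p a b fun _ => x := by
  obtain ⟨i, hx⟩ := exists_eq_pt x
  have := admOn_segment (p := p) i (r := x.abs) (v := 0) hab (by simpa using fun _ _ _ => x.abs_nn)
  simpa [← hx] using this

theorem const_mem_Gam {t : ℝ} (ht : t ≤ T) (x : Junction N) : (fun _ => x) ∈ Gam p T t x :=
  mem_Gam.2 ⟨admOn_const ht x, rfl⟩

theorem Lagr.exists_lt_value (Λ : Lagr N) {t : ℝ} (ht : t ≤ T) (x : Junction N) {ε : ℝ}
    (hε : 0 < ε) : ∃ y, AdmOn p t T y ∧ y t = x ∧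
      Λ.cost t T y + g (y T) < Λ.value p T g x t + ε := by
  obtain ⟨_, ⟨y, hy, rfl⟩, hlt⟩ := exists_lt_of_csInf_lt
    (Set.Nonempty.image _ ⟨_, const_mem_Gam (p := p) ht x⟩) (lt_add_of_pos_right
      (sInf ((fun y => Λ.cost t T y + g (y T)) '' Gam p T t x)) hε)
  exact ⟨y, (mem_Gam.1 hy).1, (mem_Gam.1 hy).2, hlt⟩

theorem Lagr.le_value (Λ : Lagr N) {t : ℝ} (ht : t ≤ T) {x : Junction N} {B : ℝ}
    (hB : ∀ y, AdmOn p t T y → y t = x → B ≤ Λ.cost t T y + g (y T)) :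
    B ≤ Λ.value p T g x t := by
  refine le_csInf (Set.Nonempty.image _ ⟨_, const_mem_Gam ht x⟩) ?_
  rintro _ ⟨y, hy, rfl⟩
  exact hB y (mem_Gam.1 hy).1 (mem_Gam.1 hy).2

theorem Lagr.value_terminal (Λ : Lagr N) (x : Junction N) : Λ.value p T g x T = g x := by
  have : (fun y => Λ.cost T T y + g (y T)) '' Gam p T T x = {g x} := by
    ext r
    constructor
    · rintro ⟨y, hy, rfl⟩
      simp [Lagr.cost, (mem_Gam.1 hy).2]
    · rintro rfl
      exact ⟨fun _ => x, const_mem_Gam le_rfl x, by simp [Lagr.cost]⟩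
  rw [Lagr.value, this, csInf_singleton]

variable [NeZero N]

theorem Lagr.Tame.bddBelow (h : Λ.Tame p C₀) (hp : 1 < p) (hg : ∀ x, |g x| ≤ M) {t : ℝ} (ht : t ≤ T)
    (x : Junction N) : BddBelow ((fun y => Λ.cost t T y + g (y T)) '' Gam p T t x) := by
  refine ⟨-C₀ * (T - t) - M, ?_⟩
  rintro _ ⟨y, hy, rfl⟩
  have h1 := h.neg_le_cost hp ht (mem_Gam.1 hy).1
  have h2 := (abs_le.1 (hg (y T))).1
  simp only
  linarith

theorem Lagr.Tame.value_le (h : Λ.Tame p C₀) (hp : 1 < p) (hg : ∀ x, |g x| ≤ M) {t : ℝ} (ht : t ≤ T)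
    {x : Junction N} {y : ℝ → Junction N} (hy : y ∈ Gam p T t x) :
    Λ.value p T g x t ≤ Λ.cost t T y + g (y T) :=
  csInf_le (h.bddBelow hp hg ht x) ⟨y, hy, rfl⟩

/-- The curve `z` followed by a nearly optimal curve from its endpoint is a competitor: the upper
half of dynamic programming. -/
theorem Lagr.Tame.value_le_cost_add (h : Λ.Tame p C₀) (hp : 1 < p) (hg : ∀ x, |g x| ≤ M) {t s : ℝ}
    (hts : t ≤ s) (hs : s ≤ T) {z : ℝ → Junction N} (hz : AdmOn p t s z) :
    Λ.value p T g (z t) t ≤ Λ.cost t s z + Λ.value p T g (z s) s := by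
  refine le_of_forall_pos_le_add fun ε hε => ?_
  obtain ⟨y, hy, hys, hlt⟩ := Λ.exists_lt_value (p := p) (g := g) hs (z s) hε
  have hw := hz.concat hp hts hs hy hys.symm
  set w : ℝ → Junction N := fun σ => if σ ≤ s then z σ else y σ with hwd
  have h1 : Λ.cost t s w = Λ.cost t s z := Lagr.cost_congr hts fun σ hσ => by simp [hwd, hσ.2.le]
  have h2 : Λ.cost s T w = Λ.cost s T y := Lagr.cost_congr hs fun σ hσ => by
    simp [hwd, not_le.2 hσ.1]
  have h3 := h.cost_add hp hts hs hw
  have h4 : w T = y T := by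
    rcases hs.eq_or_lt with e | e
    · subst e; simp [hwd, hys]
    · simp [hwd, not_le.2 e]
  have h5 := h.value_le (g := g) hp hg (hts.trans hs)
    (mem_Gam.2 ⟨hw, show w t = z t by simp [hwd, hts]⟩)
  rw [h4] at h5
  linarith

/-- The tail of `y` is a competitor for the later problem: the lower half of dynamic programming. -/
theorem Lagr.Tame.cost_add_value_le (h : Λ.Tame p C₀) (hp : 1 < p) (hg : ∀ x, |g x| ≤ M) {t s : ℝ}
    (hts : t ≤ s) (hs : s ≤ T) {y : ℝ → Junction N} (hy : AdmOn p t T y) :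
    Λ.cost t s y + Λ.value p T g (y s) s ≤ Λ.cost t T y + g (y T) := by
  have h1 := h.value_le (g := g) hp hg hs (mem_Gam.2 ⟨hy.mono hp hts hs le_rfl, rfl⟩)
  have h2 := h.cost_add hp hts hs hy
  linarith

/-- Cost of moving inside an edge with speed at most one. -/
theorem Lagr.Tame.cost_segment_le_mul (h : Λ.Tame p C₀) (hp : 1 < p) (R : ℝ) :
    ∃ K, 0 ≤ K ∧ ∀ (i : Fin N) (a b r v : ℝ), a ≤ b → |v| ≤ 1 →
      (∀ s ∈ Icc a b, r + v * (s - a) ∈ Icc 0 R) →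
      Λ.cost a b (fun s => pt i (r + v * (s - a))) ≤ K * (b - a) := by
  obtain ⟨K, hK, hb⟩ := h.bound R
  refine ⟨2 * K, by linarith, fun i a b r v hab hv hr => ?_⟩
  refine (h.cost_segment_le hp i hab fun s hs => (hr s hs).1).trans ?_
  have e : 2 * K * (b - a) = ∫ _ in a..b, 2 * K := by
    rw [intervalIntegral.integral_const]; simp; ring
  rw [e]
  refine intervalIntegral.integral_mono_on hab ?_ intervalIntegrable_const fun τ hτ => ?_
  · refine Continuous.intervalIntegrable ?_ a b
    have := h.cont i
    exact this.comp (g := fun q : ℝ × ℝ × ℝ => Λ.edgeCost i q.1 q.2.1 q.2.2)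
      (f := fun τ : ℝ => (τ, r + v * (τ - a), v)) (by fun_prop)
  · have h1 := (abs_le.1 (hb i τ _ (hr τ hτ) v)).2
    have h2 : |v| ^ p ≤ 1 := Real.rpow_le_one (abs_nonneg v) hv (by linarith)
    nlinarith

theorem Lagr.Tame.value_le_of_move (h : Λ.Tame p C₀) (hp : 1 < p) (R : ℝ) :
    ∃ K, 0 ≤ K ∧ ∀ (M : ℝ) (g : Junction N → ℝ), (∀ x, |g x| ≤ M) → ∀ (T : ℝ) (i : Fin N)
      (a b r r' : ℝ), a ≤ b → b ≤ T → r ∈ Icc 0 R → r' ∈ Icc 0 R → |r' - r| ≤ b - a →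
      Λ.value p T g (pt i r) a ≤ K * (b - a) + Λ.value p T g (pt i r') b := by
  obtain ⟨K, hK, hb⟩ := h.cost_segment_le_mul hp R
  refine ⟨K, hK, fun M g hg T i a b r r' hab hbT hr hr' hd => ?_⟩
  -- With no time to move, the speed would be a division by zero; but then the two endpoints
  -- coincide.
  rcases hab.eq_or_lt with e | e
  · subst e
    rw [sub_self] at hd
    have : r' = r := by linarith [abs_nonpos_iff.1 hd]
    simp [this]
  have hba : 0 < b - a := by linarith
  set v := (r' - r) / (b - a) with hv
  have hv1 : |v| ≤ 1 := by
    rw [hv, abs_div, abs_of_pos hba]; exact (div_le_one hba).2 hd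
  have hvb : r + v * (b - a) = r' := by rw [hv]; field_simp; ring
  have hmem : ∀ s ∈ Icc a b, r + v * (s - a) ∈ Icc 0 R := by
    intro s hs
    have e1 : r + v * (s - a) = r * ((b - s) / (b - a)) + r' * ((s - a) / (b - a)) := by
      rw [hv]; field_simp; ring
    have h1 : 0 ≤ (b - s) / (b - a) := div_nonneg (by linarith [hs.2]) hba.le
    have h2 : 0 ≤ (s - a) / (b - a) := div_nonneg (by linarith [hs.1]) hba.le
    have h3 : (b - s) / (b - a) + (s - a) / (b - a) = 1 := by field_simp; ring
    rw [e1]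
    constructor
    · have := mul_nonneg hr.1 h1; have := mul_nonneg hr'.1 h2; linarith
    · have := mul_le_mul_of_nonneg_right hr.2 h1
      have := mul_le_mul_of_nonneg_right hr'.2 h2
      have e3 : R * ((b - s) / (b - a)) + R * ((s - a) / (b - a)) = R := by
        rw [← mul_add, h3, mul_one]
      linarith
  have h1 := h.value_le_cost_add (g := g) hp hg hab hbT
    (admOn_segment i hab fun s hs => (hmem s hs).1)
  simp only [sub_self, mul_zero, add_zero, hvb] at h1
  linarith [hb i a b r v hab hv1 hmem]

/-- Cost of a curve shifted inside its edge by an affine function of time. -/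
theorem Lagr.Tame.cost_shift_le (h : Λ.Tame p C₀) (hp : 1 < p) (R : ℝ) :
    ∃ K, 0 ≤ K ∧ ∀ (i : Fin N) (a b d v D : ℝ) (y : ℝ → Junction N), a ≤ b → AdmOn p a b y →
      (∀ s ∈ Icc a b, y s = pt i (y s).abs) → (∀ s ∈ Ioo a b, 0 < (y s).abs) →
      (∀ s ∈ Icc a b, (y s).abs ≤ R) →
      (∀ s ∈ Icc a b, (y s).abs + (d + v * (s - a)) ∈ Icc 0 R) →
      (∀ s ∈ Icc a b, |d + v * (s - a)| ≤ D) → |v| ≤ 1 →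
      AdmOn p a b (fun s => pt i ((y s).abs + (d + v * (s - a)))) ∧
      Λ.cost a b (fun s => pt i ((y s).abs + (d + v * (s - a)))) ≤ Λ.cost a b y +
        K * (D + |v|) * ((b - a) + ∫ τ in a..b, |vel y τ| ^ p) := by
  obtain ⟨K, hK, hl⟩ := h.lip R
  refine ⟨K, hK, fun i a b d v D y hab hy hyi hpos hyR hzR hD hv => ?_⟩
  set r : ℝ → ℝ := fun s => (y s).abs + (d + v * (s - a)) with hr
  have hvi := hy.vel_integrable hp hab
  have hz : AdmOn p a b (fun s => pt i (r s)) := by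
    refine admOn_pt i (β := fun τ => vel y τ + v) (fun s hs => (hzR s hs).1) ?_ hab
      ((hy.vel_memLp hp hab).add (memLp_const _)) (fun s hs => ?_)
      (hvi.add intervalIntegrable_const)
    · exact (continuous_abs'.comp_continuousOn hy.1).add (by fun_prop)
    · rw [intervalIntegral.integral_add (hvi.mono_set (by
        rw [uIcc_of_le hs.1, uIcc_of_le hab]; exact Icc_subset_Icc le_rfl hs.2))
        intervalIntegrable_const, intervalIntegral.integral_const]
      simp only [hr]
      rw [hy.abs_eq_add_integral hp hab s hs]
      simp; ring
  refine ⟨hz, ?_⟩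
  have h1 := h.cost_le_edge hp hab hz (i := i) fun τ hτ => by
    rw [pt_abs i (hzR τ (Ioo_subset_Icc_self hτ)).1]
  have h2 : Λ.cost a b y = _ := Lagr.cost_eq_edge hab (i := i)
    (fun τ hτ => hyi τ (Ioo_subset_Icc_self hτ)) hpos
  have hp1 : IntervalIntegrable (fun τ => K * (D + |v|) * (1 + |vel y τ| ^ p)) volume a b :=
    (intervalIntegrable_const.add (hy.vel_pow_integrable hp hab)).const_mul _
  have e : Λ.cost a b y + K * (D + |v|) * ((b - a) + ∫ τ in a..b, |vel y τ| ^ p) =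
      ∫ τ in a..b, (Λ.edgeCost i τ (y τ).abs (vel y τ) + K * (D + |v|) * (1 + |vel y τ| ^ p)) := by
    rw [intervalIntegral.integral_add (h.edge_integrable hp hab hy i) hp1, h2,
      intervalIntegral.integral_const_mul, intervalIntegral.integral_add intervalIntegrable_const
      (hy.vel_pow_integrable hp hab), intervalIntegral.integral_const]
    simp
  rw [e]
  refine h1.trans ?_
  rw [intervalIntegral.integral_of_le hab, intervalIntegral.integral_of_le hab]
  have hint := (h.edge_integrable hp hab hz i)
  have hint2 := (h.edge_integrable hp hab hy i).add hp1
  rw [intervalIntegrable_iff_integrableOn_Ioc_of_le hab] at hint hint2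
  refine integral_mono_ae hint hint2 ?_
  filter_upwards [hy.ae_hasDerivAt hp hab] with τ hτ
  have hτI := Ioo_subset_Icc_self hτ.1
  have hvz : vel (fun s => pt i (r s)) τ = vel y τ + v := by
    refine vel_pt ?_ ?_
    · filter_upwards [Ioo_mem_nhds hτ.1.1 hτ.1.2] with s hs
      exact (hzR s (Ioo_subset_Icc_self hs)).1
    · refine hτ.2.add ?_
      simpa using (((hasDerivAt_id τ).sub_const a).const_mul v).const_add d
  -- The shift changes the position by `d + v (τ - a)` and the velocity by `v`; `|v| ≤ 1` is the
  -- range allowed by `lip`.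
  have hl1 := hl i τ (y τ).abs ⟨(y τ).abs_nn, hyR τ hτI⟩ (r τ) (hzR τ hτI) (vel y τ) (vel y τ + v)
    (by simpa using hv)
  simp only [hvz, pt_abs i (show 0 ≤ r τ from (hzR τ hτI).1)]
  have e1 : (y τ).abs - r τ = -(d + v * (τ - a)) := by simp [hr]
  have e2 : vel y τ - (vel y τ + v) = -v := by ring
  rw [e1, e2, abs_neg, abs_neg] at hl1
  have h3 : K * (1 + |vel y τ| ^ p) * (|d + v * (τ - a)| + |v|) ≤
      K * (1 + |vel y τ| ^ p) * (D + |v|) :=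
    mul_le_mul_of_nonneg_left (by linarith [hD τ hτI])
      (mul_nonneg hK (by have := Real.rpow_nonneg (abs_nonneg (vel y τ)) p; linarith))
  have h4 := (abs_le.1 hl1).1
  linarith

/-- Bounds for nearly optimal trajectories. -/
theorem Lagr.Tame.apriori (h : Λ.Tame p C₀) (hp : 1 < p) (T M r : ℝ) :
    ∃ A, 0 ≤ A ∧ r ≤ A ∧ ∀ g : Junction N → ℝ, (∀ x, |g x| ≤ M) → ∀ t ∈ Icc 0 T, ∀ x : Junction N,
      x.abs ≤ r → |Λ.value p T g x t| ≤ A ∧ ∀ y, AdmOn p t T y → y t = x →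
      Λ.cost t T y + g (y T) < Λ.value p T g x t + 1 →
      (∫ τ in t..T, |vel y τ| ^ p) ≤ A ∧ ∀ s ∈ Icc t T, (y s).abs ≤ A := by
  obtain ⟨K, hK, hm⟩ := h.value_le_of_move hp r
  have hC := h.pos
  set B := (|K| * |T| + |M| + |M| + 1 + C₀ * |T|) / C₀ with hB
  have hB0 : 0 ≤ B := by positivity
  set A := |r| + |T| + B + (|K| * |T| + C₀ * |T| + |M|) with hA
  have hKT : 0 ≤ |K| * |T| := by positivity
  have hCT : 0 ≤ C₀ * |T| := by positivity
  have hr0 := abs_nonneg r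
  have hT0 := abs_nonneg T
  have hM0 := abs_nonneg M
  refine ⟨A, by rw [hA]; positivity, by rw [hA]; linarith [le_abs_self r], ?_⟩
  intro g hg t ht x hx
  obtain ⟨i, hxi⟩ := exists_eq_pt x
  have h1 := hm M g hg T i t T x.abs x.abs ht.2 le_rfl ⟨x.abs_nn, hx⟩ ⟨x.abs_nn, hx⟩
    (by simpa using ht.2)
  rw [← hxi, Lagr.value_terminal] at h1
  have hT : 0 ≤ T := ht.1.trans ht.2
  have h2 : K * (T - t) ≤ |K| * |T| := by
    rw [abs_of_nonneg hK, abs_of_nonneg hT]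
    exact mul_le_mul_of_nonneg_left (by linarith [ht.1]) hK
  have h2' : C₀ * (T - t) ≤ C₀ * |T| := by
    rw [abs_of_nonneg hT]
    exact mul_le_mul_of_nonneg_left (by linarith [ht.1]) hC.le
  have h3 := abs_le.1 (hg x)
  have h3' := le_abs_self M
  constructor
  · rw [abs_le]
    constructor
    · refine Λ.le_value ht.2 fun y hy hyt => ?_
      have h4 := h.neg_le_cost hp ht.2 hy
      have h5 := abs_le.1 (hg (y T))
      rw [hA]; linarith
    · rw [hA]; linarith
  · intro y hy hyt hlt
    have h4 := h.pow_le_cost hp ht.2 hy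
    have h5 := abs_le.1 (hg (y T))
    have h6 : (∫ τ in t..T, |vel y τ| ^ p) ≤ B := by
      rw [hB, le_div_iff₀ hC]; linarith
    refine ⟨h6.trans (by rw [hA]; linarith), fun s hs => ?_⟩
    have h7 := hy.abs_eq_add_integral hp ht.2 s hs
    -- The radial displacement is controlled by the energy through `v ≤ 1 + |v|^p`.
    have h8 : (∫ τ in t..s, vel y τ) ≤ (T - t) + ∫ τ in t..T, |vel y τ| ^ p := by
      have e : (T - t) + ∫ τ in t..T, |vel y τ| ^ p = ∫ τ in t..T, (1 + |vel y τ| ^ p) := by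
        rw [intervalIntegral.integral_add intervalIntegrable_const (hy.vel_pow_integrable hp ht.2),
          intervalIntegral.integral_const]
        simp
      have hi := (intervalIntegrable_const (c := (1 : ℝ))).add (hy.vel_pow_integrable hp ht.2)
      rw [e]
      have hsub : IntervalIntegrable (fun τ => 1 + |vel y τ| ^ p) volume t s := hi.mono_set (by
        rw [uIcc_of_le hs.1, uIcc_of_le ht.2]; exact Icc_subset_Icc le_rfl hs.2)
      refine (intervalIntegral.integral_mono_on hs.1
        ((hy.mono hp le_rfl hs.1 hs.2).vel_integrable hp hs.1) hsub fun τ _ => ?_).trans ?_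
      · have h0 := abs_nonneg (vel y τ)
        by_cases h9 : |vel y τ| ≤ 1
        · linarith [le_abs_self (vel y τ), Real.rpow_nonneg h0 p]
        · have := Real.self_le_rpow_of_one_le (not_le.1 h9).le hp.le
          linarith [le_abs_self (vel y τ)]
      · refine intervalIntegral.integral_mono_interval le_rfl hs.1 hs.2 ?_ hi
        exact ae_of_all _ fun τ => by
          have := Real.rpow_nonneg (abs_nonneg (vel y τ)) p
          simp only [Pi.zero_apply]; linarith
    rw [h7, hyt, hA]
    linarith [le_abs_self r, le_abs_self T, ht.1]

end Value

end JunctionMFG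

/-! ### Lipschitz estimates near the vertex -/

namespace JunctionMFG

open JunctionMFG.Junction (pt edge vertex)

/-- Take the greatest point of the compact set where `f ≤ c`; the intermediate value theorem turns
the inequality there into an equality. -/
theorem exists_last_crossing {f : ℝ → ℝ} {a b c : ℝ} (hab : a ≤ b) (hf : ContinuousOn f (Icc a b))
    (ha : f a ≤ c) (hb : c < f b) :
    ∃ σ ∈ Ico a b, f σ = c ∧ ∀ τ ∈ Ioc σ b, c < f τ := by
  have hcl : IsCompact (Icc a b ∩ f ⁻¹' Iic c) :=
    isCompact_Icc.of_isClosed_subset (hf.preimage_isClosed_of_isClosed isClosed_Icc isClosed_Iic)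
      inter_subset_left
  obtain ⟨σ, ⟨hσ, hσc⟩, hmax⟩ := hcl.exists_isGreatest ⟨a, left_mem_Icc.2 hab, ha⟩
  have hσb : σ < b := lt_of_le_of_ne hσ.2 (by rintro rfl; exact absurd hb (not_lt.2 hσc))
  have hgt : ∀ τ ∈ Ioc σ b, c < f τ := by
    intro τ hτ
    by_contra hle
    exact absurd (hmax ⟨⟨hσ.1.trans hτ.1.le, hτ.2⟩, not_lt.1 hle⟩) (not_le.2 hτ.1)
  refine ⟨σ, ⟨hσ.1, hσb⟩, ?_, hgt⟩
  obtain ⟨τ, hτ, hτc⟩ := intermediate_value_Icc hσb.le (hf.mono (Icc_subset_Icc hσ.1 le_rfl))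
    ⟨hσc, hb.le⟩
  rcases hτ.1.eq_or_lt with e | e
  · rw [e]; exact hτc
  · exact absurd hτc (hgt τ ⟨e, hτ.2⟩).ne'

theorem forall_gt_or_exists_first {f : ℝ → ℝ} {a b c : ℝ} (hf : ContinuousOn f (Icc a b))
    (ha : c ≤ f a) :
    (∀ τ ∈ Icc a b, c < f τ) ∨ ∃ σ ∈ Icc a b, f σ = c ∧ ∀ τ ∈ Ico a σ, c < f τ := by
  by_cases h : ∀ τ ∈ Icc a b, c < f τ
  · exact Or.inl h
  right
  push Not at h
  obtain ⟨τ₀, hτ₀, hle⟩ := h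
  have hcl : IsCompact (Icc a b ∩ f ⁻¹' Iic c) :=
    isCompact_Icc.of_isClosed_subset (hf.preimage_isClosed_of_isClosed isClosed_Icc isClosed_Iic)
      inter_subset_left
  obtain ⟨σ, ⟨hσ, hσc⟩, hmin⟩ := hcl.exists_isLeast ⟨τ₀, hτ₀, hle⟩
  have hgt : ∀ τ ∈ Ico a σ, c < f τ := by
    intro τ hτ
    by_contra hle
    exact absurd (hmin ⟨⟨hτ.1, hτ.2.le.trans hσ.2⟩, not_lt.1 hle⟩) (not_le.2 hτ.2)
  refine ⟨σ, hσ, ?_, hgt⟩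
  obtain ⟨τ, hτ, hτc⟩ := intermediate_value_Icc' hσ.1 (hf.mono (Icc_subset_Icc le_rfl hσ.2))
    ⟨hσc, ha⟩
  rcases hτ.2.eq_or_lt with e | e
  · rw [← e]; exact hτc
  · exact absurd hτc (hgt τ ⟨hτ.1, e⟩).ne'

/-- Local Lipschitz continuity of a terminal cost on each edge, the value at the vertex being at
most its limit along each edge. -/
def EdgeLip {N : ℕ} (g : Junction N → ℝ) : Prop :=
  ∀ R, ∃ L, 0 ≤ L ∧ ∀ i, ∀ r ∈ Icc 0 R, ∀ r' ∈ Ioc 0 R, g (pt i r) ≤ g (pt i r') + L * |r - r'|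

section Estimates

variable {N : ℕ} {p C₀ T M : ℝ} {Λ : Lagr N} {g : Junction N → ℝ}

theorem eq_pt_zero {x : Junction N} (hx : x.abs = 0) (i : Fin N) : x = pt i 0 := by
  obtain ⟨j, hj⟩ := exists_eq_pt x
  rw [hj, hx, pt_zero j i]

theorem AdmOn.abs_le_add {a b : ℝ} {y : ℝ → Junction N} (h : AdmOn p a b y) (hp : 1 < p)
    (hab : a ≤ b) : (y b).abs ≤ (y a).abs + ∫ τ in a..b, |vel y τ| := by
  have h1 := abs_sub_abs_le_dist (y b) (y a)
  have h2 := h.dist_le hp hab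
  rw [dist_comm] at h1
  linarith [le_abs_self ((y b).abs - (y a).abs)]

theorem AdmOn.continuousOn_abs {a b : ℝ} {y : ℝ → Junction N} (h : AdmOn p a b y) :
    ContinuousOn (fun σ => (y σ).abs) (Icc a b) :=
  continuous_abs'.comp_continuousOn h.1

theorem integral_pow_mono {a b a' b' : ℝ} {y : ℝ → Junction N} (h : AdmOn p a b y) (hp : 1 < p)
    (ha : a ≤ a') (hab : a' ≤ b') (hb : b' ≤ b) :
    (∫ τ in a'..b', |vel y τ| ^ p) ≤ ∫ τ in a..b, |vel y τ| ^ p :=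
  intervalIntegral.integral_mono_interval ha hab hb
    (ae_of_all _ fun _ => Real.rpow_nonneg (abs_nonneg _) _)
    (h.vel_pow_integrable hp (ha.trans (hab.trans hb)))

variable [NeZero N]

set_option maxHeartbeats 1000000 in
/-- The value at the vertex is at most the value nearby, up to a multiple of the distance. -/
theorem Lagr.Tame.value_vertex_le (h : Λ.Tame p C₀) (hp : 1 < p) (hT : 0 ≤ T)
    (hg : ∀ x, |g x| ≤ M) (hgL : EdgeLip g) (r : ℝ) :
    ∃ C, 0 ≤ C ∧ ∀ i, ∀ δ ∈ Icc 0 r, ∀ s ∈ Icc 0 T,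
      Λ.value p T g (pt i 0) s ≤ Λ.value p T g (pt i δ) s + C * δ := by
  obtain ⟨A, hA0, hrA, hA⟩ := h.apriori hp T M r
  obtain ⟨K₁, hK₁, hmv⟩ := h.value_le_of_move hp A
  obtain ⟨K₂, hK₂, hsh⟩ := h.cost_shift_le hp A
  obtain ⟨L, hL0, hL⟩ := hgL A
  obtain ⟨K₃, hK₃, hlen⟩ := h.length_le_cost hp L
  have hC := h.pos
  -- Threshold for the mean energy: above it, coercivity makes the curve at least as expensive as
  -- motion at speed at most one over the same time.
  set A₀ := (K₁ + C₀) / C₀ with hA₀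
  have hA₀0 : 0 ≤ A₀ := by positivity
  set C := 2 * K₁ + 2 * C₀ + K₂ * (T + A + 1 + A₀) + L + 2 * K₃ with hCd
  have hKTA : 0 ≤ K₂ * (T + A + 1 + A₀) := by positivity
  refine ⟨C, by positivity, fun i δ hδ s hs => ?_⟩
  rcases hδ.1.eq_or_lt with e | hδ0
  · rw [← e]; simp
  refine le_of_forall_pos_lt_add fun ε hε => ?_
  obtain ⟨y, hy, hys, hlt⟩ := Λ.exists_lt_value (p := p) (g := g) hs.2 (pt i δ)
    (lt_min hε one_pos)
  have hδA : δ ≤ A := hδ.2.trans hrA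
  obtain ⟨hpow, hyA⟩ := (hA g hg s hs (pt i δ) (by rw [pt_abs i hδ.1]; exact hδ.2)).2 y hy hys
    (hlt.trans_le (by linarith [min_le_right ε 1]))
  suffices hmain : Λ.value p T g (pt i 0) s ≤ Λ.cost s T y + g (y T) + C * δ by
    linarith [min_le_left ε 1]
  have hysa : (y s).abs = δ := by rw [hys, pt_abs i hδ.1]
  have h0A : (0 : ℝ) ∈ Icc 0 A := ⟨le_rfl, hA0⟩
  have hCδ : 0 ≤ C₀ * δ := by positivity
  have hKδ1 : 0 ≤ K₁ * δ := by positivity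
  have hKδ2 : 0 ≤ K₂ * (T + A + 1 + A₀) * δ := by positivity
  have hKδ3 : 0 ≤ K₃ * δ := by positivity
  have hLδ : 0 ≤ L * δ := by positivity
  -- splitting off an initial piece of bounded duration
  have hpiece : ∀ σ ∈ Icc s T, σ ≤ s + 2 * δ → -(2 * (C₀ * δ)) ≤ Λ.cost s σ y := by
    intro σ hσ hσ2
    have := h.neg_le_cost hp hσ.1 (hy.mono hp le_rfl hσ.1 hσ.2)
    nlinarith
  by_cases hsT : T < s + 2 * δ
  · have h1 := hmv M g hg T i s T 0 0 hs.2 le_rfl h0A h0A (by simpa using hs.2)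
    rw [Lagr.value_terminal] at h1
    have h2 := hlen s T y hs.2 hy
    have h3 := hy.abs_le_add hp hs.2
    have h4 : g (pt i 0) ≤ g (y T) + L * (y T).abs := by
      rcases (y T).abs_nn.eq_or_lt with e | e
      · rw [← e, ← eq_pt_zero e.symm i]; simp
      · obtain ⟨j, hj⟩ := exists_eq_pt (y T)
        have := hL j 0 h0A (y T).abs ⟨e, hyA T (right_mem_Icc.2 hs.2)⟩
        rw [← hj, pt_zero j i, zero_sub, abs_neg, abs_of_pos e] at this
        exact this
    have h5 : K₁ * (T - s) ≤ K₁ * (2 * δ) := mul_le_mul_of_nonneg_left (by linarith) hK₁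
    have h6 : K₃ * (T - s) ≤ K₃ * (2 * δ) := mul_le_mul_of_nonneg_left (by linarith) hK₃
    have h7 : L * (y T).abs ≤ L * (δ + ∫ τ in s..T, |vel y τ|) :=
      mul_le_mul_of_nonneg_left (by rw [← hysa]; exact h3) hL0
    rw [hCd]; linarith
  have hsT : s + 2 * δ ≤ T := not_lt.1 hsT
  have hcont := hy.continuousOn_abs
  by_cases hzero : ∃ σ ∈ Icc s (s + 2 * δ), (y σ).abs = 0
  · obtain ⟨σ, hσ, hσ0⟩ := hzero
    have hσT : σ ≤ T := hσ.2.trans hsT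
    have h1 := hmv M g hg T i s σ 0 0 hσ.1 hσT h0A h0A (by simpa using hσ.1)
    rw [← eq_pt_zero hσ0 i] at h1
    rw [← eq_pt_zero hσ0 i]
    have h2 := h.cost_add_value_le (g := g) hp hg hσ.1 hσT hy
    have h3 := hpiece σ ⟨hσ.1, hσT⟩ hσ.2
    have h5 : K₁ * (σ - s) ≤ K₁ * (2 * δ) := mul_le_mul_of_nonneg_left (by linarith [hσ.2]) hK₁
    rw [hCd]; linarith
  push Not at hzero
  have hpos : ∀ σ ∈ Icc s (s + 2 * δ), 0 < (y σ).abs := fun σ hσ =>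
    lt_of_le_of_ne (y σ).abs_nn (Ne.symm (hzero σ hσ))
  have hys_edge : y s ∈ edge i := by rw [hys]; exact mem_edge_iff.2 (by rw [pt_abs i hδ.1])
  -- The curve is within `δ` of the vertex after a time at least `δ`: it can be caught at speed at
  -- most one.
  by_cases hback : ∃ σ ∈ Icc (s + δ) (s + 2 * δ), (y σ).abs ≤ δ
  · obtain ⟨σ, hσ, hσδ⟩ := hback
    have hsσ : s ≤ σ := by linarith [hσ.1]
    have hσT : σ ≤ T := hσ.2.trans hsT
    have hσe := eq_pt_of_preconnected isPreconnected_Icc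
      (hy.1.mono (Icc_subset_Icc le_rfl hsT)) hpos ⟨le_rfl, by linarith⟩ hys_edge σ ⟨hsσ, hσ.2⟩
    have h1 := hmv M g hg T i s σ 0 (y σ).abs hsσ hσT h0A ⟨(y σ).abs_nn, hyA σ ⟨hsσ, hσT⟩⟩
      (by rw [sub_zero, abs_of_nonneg (y σ).abs_nn]; linarith [hσ.1])
    rw [← hσe] at h1
    have h2 := h.cost_add_value_le (g := g) hp hg hsσ hσT hy
    have h3 := hpiece σ ⟨hsσ, hσT⟩ hσ.2
    have h5 : K₁ * (σ - s) ≤ K₁ * (2 * δ) := mul_le_mul_of_nonneg_left (by linarith [hσ.2]) hK₁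
    rw [hCd]; linarith
  push Not at hback
  -- At `σ₁` the curve shifted by `-δ` is at the vertex, and it stays in the edge until the next
  -- return to distance `δ`. The competitor waits at the vertex up to `σ₁`.
  obtain ⟨σ₁, hσ₁, hσ₁δ, hσ₁gt⟩ := exists_last_crossing (f := fun σ => (y σ).abs) (c := δ)
    (a := s) (b := s + δ) (by linarith)
    (hcont.mono (Icc_subset_Icc le_rfl (by linarith))) hysa.le
    (hback _ ⟨le_rfl, by linarith⟩)
  have hσ₁T : σ₁ ≤ T := by linarith [hσ₁.2]
  have hstart : Λ.value p T g (pt i 0) s ≤ K₁ * δ + Λ.value p T g (pt i 0) σ₁ := by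
    have h1 := hmv M g hg T i s σ₁ 0 0 hσ₁.1 hσ₁T h0A h0A (by simpa using hσ₁.1)
    have h5 : K₁ * (σ₁ - s) ≤ K₁ * δ := mul_le_mul_of_nonneg_left (by linarith [hσ₁.2]) hK₁
    linarith
  have hpc := hpiece σ₁ ⟨hσ₁.1, hσ₁T⟩ (by linarith [hσ₁.2])
  rcases forall_gt_or_exists_first (f := fun σ => (y σ).abs) (c := δ) (a := s + 2 * δ) (b := T)
    (hcont.mono (Icc_subset_Icc (by linarith) le_rfl)) (hback _ ⟨by linarith, le_rfl⟩).le
    with hall | ⟨β, hβ, hβδ, hβgt⟩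
  -- No return to distance `δ`: the shift stays constant up to `T`, and the terminal cost loses `L
  -- δ`.
  · have hge : ∀ σ ∈ Icc σ₁ T, δ ≤ (y σ).abs := by
      intro σ hσ
      rcases hσ.1.eq_or_lt with e | e
      · rw [← e]; exact hσ₁δ.ge
      · by_cases h1 : σ ≤ s + δ
        · exact (hσ₁gt σ ⟨e, h1⟩).le
        · by_cases h2 : σ ≤ s + 2 * δ
          · exact (hback σ ⟨(not_le.1 h1).le, h2⟩).le
          · exact (hall σ ⟨(not_le.1 h2).le, hσ.2⟩).le
    have hpos' : ∀ σ ∈ Icc s T, 0 < (y σ).abs := by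
      intro σ hσ
      by_cases h1 : σ ≤ s + 2 * δ
      · exact hpos σ ⟨hσ.1, h1⟩
      · exact hδ0.trans (hall σ ⟨(not_le.1 h1).le, hσ.2⟩)
    have hye := eq_pt_of_preconnected isPreconnected_Icc hy.1 hpos' ⟨le_rfl, hs.2⟩ hys_edge
    obtain ⟨hz, hzc⟩ := hsh i σ₁ T (-δ) 0 δ y hσ₁T (hy.mono hp hσ₁.1 hσ₁T le_rfl)
      (fun σ hσ => hye σ ⟨hσ₁.1.trans hσ.1, hσ.2⟩)
      (fun σ hσ => hpos' σ ⟨hσ₁.1.trans hσ.1.le, hσ.2.le⟩)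
      (fun σ hσ => hyA σ ⟨hσ₁.1.trans hσ.1, hσ.2⟩)
      (fun σ hσ => ⟨by linarith [hge σ hσ], by linarith [hyA σ ⟨hσ₁.1.trans hσ.1, hσ.2⟩]⟩)
      (fun σ hσ => by simp [abs_of_pos hδ0]) (by simp)
    have h1 := h.value_le_cost_add (g := g) hp hg hσ₁T le_rfl hz
    simp only [zero_mul, add_zero] at h1 hzc
    rw [Lagr.value_terminal, hσ₁δ, add_neg_cancel] at h1
    have h2 := h.cost_add hp hσ₁.1 hσ₁T hy
    have hyT := hyA T (right_mem_Icc.2 hs.2)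
    have hyTδ := hall T ⟨hsT, le_rfl⟩
    have h3 := hL i ((y T).abs + -δ) ⟨by linarith, by linarith⟩ (y T).abs
      ⟨by linarith, hyT⟩
    rw [← hye T (right_mem_Icc.2 hs.2), show (y T).abs + -δ - (y T).abs = -δ by ring, abs_neg,
      abs_of_pos hδ0] at h3
    have h4 := integral_pow_mono hy hp hσ₁.1 hσ₁T le_rfl
    have h5 : K₂ * δ * (T - σ₁ + ∫ τ in σ₁..T, |vel y τ| ^ p) ≤ K₂ * δ * (T + A + 1 + A₀) :=
      mul_le_mul_of_nonneg_left (by linarith [hs.1, hσ₁.1]) (by positivity)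
    simp only [abs_zero, add_zero] at hzc
    rw [hCd]; linarith
  · have hβT := hβ.2
    have hσβ : δ ≤ β - σ₁ := by linarith [hσ₁.2, hβ.1]
    have hσβ' : σ₁ ≤ β := by linarith
    have hsβ : s ≤ β := by linarith [hβ.1]
    have hℓ : 0 < β - σ₁ := by linarith
    have hge : ∀ σ ∈ Icc σ₁ β, δ ≤ (y σ).abs := by
      intro σ hσ
      rcases hσ.1.eq_or_lt with e | e
      · rw [← e]; exact hσ₁δ.ge
      · by_cases h1 : σ ≤ s + δ
        · exact (hσ₁gt σ ⟨e, h1⟩).le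
        · by_cases h2 : σ ≤ s + 2 * δ
          · exact (hback σ ⟨(not_le.1 h1).le, h2⟩).le
          · rcases hσ.2.eq_or_lt with e' | e'
            · rw [e']; exact hβδ.ge
            · exact (hβgt σ ⟨(not_le.1 h2).le, e'⟩).le
    have hpos' : ∀ σ ∈ Icc s β, 0 < (y σ).abs := by
      intro σ hσ
      by_cases h1 : σ ≤ s + 2 * δ
      · exact hpos σ ⟨hσ.1, h1⟩
      · exact hδ0.trans_le (hge σ ⟨by linarith [hσ₁.2], hσ.2⟩)
    have hye := eq_pt_of_preconnected isPreconnected_Icc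
      (hy.1.mono (Icc_subset_Icc le_rfl hβT)) hpos' ⟨le_rfl, hsβ⟩ hys_edge
    have hyβ : y β = pt i δ := by rw [hye β ⟨hsβ, le_rfl⟩]; rw [show (y β).abs = δ from hβδ]
    have hyσβ := hy.mono hp hσ₁.1 hσβ' hβT
    have h2 := h.cost_add hp hσ₁.1 hσβ' (hy.mono hp le_rfl hsβ hβT)
    have h3 := h.cost_add_value_le (g := g) hp hg hsβ hβT hy
    suffices hmid : Λ.value p T g (pt i 0) σ₁ ≤
        Λ.cost σ₁ β y + Λ.value p T g (y β) β + K₂ * (T + A + 1 + A₀) * δ by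
      rw [hCd]; linarith
    set I := ∫ τ in σ₁..β, |vel y τ| ^ p with hI
    have h6 := h.pow_le_cost hp hσβ' hyσβ
    -- An excursion with too much energy is replaced by a straight motion from the vertex to
    -- distance `δ`, possible since `δ ≤ β - σ₁`.
    by_cases hbig : K₁ * (β - σ₁) ≤ C₀ * I - C₀ * (β - σ₁)
    · have h7 := hmv M g hg T i σ₁ β 0 δ hσβ' hβT h0A ⟨hδ0.le, hδA⟩
        (by rw [sub_zero, abs_of_pos hδ0]; exact hσβ)
      rw [hyβ]
      linarith
    · have hIA : I ≤ A₀ * (β - σ₁) := by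
        rw [hA₀, div_mul_eq_mul_div, le_div_iff₀ hC]; linarith
      -- Otherwise the shift shrinks linearly from `-δ` to `0` and the competitor rejoins the curve
      -- at `β`. Its speed `v` multiplies a duration plus energy of order `β - σ₁`, so the loss is
      -- of order `δ`.
      set v := δ / (β - σ₁) with hv
      have hv0 : 0 ≤ v := by positivity
      have hv1 : v ≤ 1 := (div_le_one hℓ).2 hσβ
      have hvℓ : v * (β - σ₁) = δ := by rw [hv]; field_simp
      have hvs : ∀ σ ∈ Icc σ₁ β, -δ ≤ -δ + v * (σ - σ₁) ∧ -δ + v * (σ - σ₁) ≤ 0 := by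
        intro σ hσ
        have h8 : 0 ≤ v * (σ - σ₁) := mul_nonneg hv0 (by linarith [hσ.1])
        have h9 : v * (σ - σ₁) ≤ v * (β - σ₁) :=
          mul_le_mul_of_nonneg_left (by linarith [hσ.2]) hv0
        constructor <;> linarith
      obtain ⟨hz, hzc⟩ := hsh i σ₁ β (-δ) v δ y hσβ' hyσβ
        (fun σ hσ => hye σ ⟨hσ₁.1.trans hσ.1, hσ.2⟩)
        (fun σ hσ => hpos' σ ⟨hσ₁.1.trans hσ.1.le, hσ.2.le⟩)
        (fun σ hσ => hyA σ ⟨hσ₁.1.trans hσ.1, hσ.2.trans hβT⟩)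
        (fun σ hσ => ⟨by linarith [hge σ hσ, (hvs σ hσ).1],
          by linarith [hyA σ ⟨hσ₁.1.trans hσ.1, hσ.2.trans hβT⟩, (hvs σ hσ).2]⟩)
        (fun σ hσ => abs_le.2 ⟨(hvs σ hσ).1, by linarith [(hvs σ hσ).2]⟩)
        (by rw [abs_of_nonneg hv0]; exact hv1)
      have h7 := h.value_le_cost_add (g := g) hp hg hσβ' hβT hz
      simp only [sub_self, mul_zero, add_zero, hvℓ, neg_add_cancel, hσ₁δ, add_neg_cancel,
        ← hye β ⟨hsβ, le_rfl⟩] at h7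
      rw [abs_of_nonneg hv0, ← hI] at hzc
      have h8 : I ≤ A := (integral_pow_mono hy hp hσ₁.1 hσβ' hβT).trans hpow
      have h9 : δ * (β - σ₁ + I) ≤ δ * (T + A) :=
        mul_le_mul_of_nonneg_left (by linarith [hs.1, hσ₁.1]) hδ0.le
      have h10 : v * (β - σ₁ + I) ≤ δ * (1 + A₀) := by
        have : v * I ≤ v * (A₀ * (β - σ₁)) := mul_le_mul_of_nonneg_left hIA hv0
        nlinarith
      have h11 : K₂ * (δ + v) * (β - σ₁ + I) ≤ K₂ * (T + A + 1 + A₀) * δ := by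
        have : K₂ * ((δ + v) * (β - σ₁ + I)) ≤ K₂ * ((T + A + 1 + A₀) * δ) :=
          mul_le_mul_of_nonneg_left (by linarith) hK₂
        linarith
      linarith

end Estimates

end JunctionMFG

/-! ### Lipschitz estimates in space and time -/

namespace JunctionMFG

open JunctionMFG.Junction (pt edge vertex)

/-- For points on different edges the distance splits at the vertex, so the two edge estimates chain
through it. -/
theorem le_of_edge_lipschitz {N : ℕ} {f : Junction N → ℝ} {r C : ℝ}
    (hf : ∀ i, ∀ r₁ ∈ Icc 0 r, ∀ r₂ ∈ Icc 0 r, f (pt i r₁) ≤ f (pt i r₂) + C * |r₁ - r₂|)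
    {x x' : Junction N} (hx : x.abs ≤ r) (hx' : x'.abs ≤ r) : f x ≤ f x' + C * dist x x' := by
  obtain ⟨i, hi⟩ := exists_eq_pt x
  obtain ⟨j, hj⟩ := exists_eq_pt x'
  have h1 := x.abs_nn
  have h2 := x'.abs_nn
  by_cases hij : i = j
  · subst hij
    have := hf i x.abs ⟨h1, hx⟩ x'.abs ⟨h2, hx'⟩
    rwa [← dist_pt i h1 h2, ← hi, ← hj] at this
  · have e1 := hf i x.abs ⟨h1, hx⟩ 0 ⟨le_rfl, h1.trans hx⟩
    have e2 := hf j 0 ⟨le_rfl, h1.trans hx⟩ x'.abs ⟨h2, hx'⟩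
    have e3 := dist_pt_of_ne hij h1 h2
    rw [← hi, ← hj] at e3
    rw [← hi, sub_zero, abs_of_nonneg h1] at e1
    rw [← hj, zero_sub, abs_neg, abs_of_nonneg h2, pt_zero j i] at e2
    rw [e3]; linarith

section Estimates

variable {N : ℕ} [NeZero N] {p C₀ T M : ℝ} {Λ : Lagr N} {g : Junction N → ℝ}

/-- The value near the vertex is at most the value at the vertex, up to a multiple of the
distance, when there is enough time left to reach the vertex. -/
theorem Lagr.Tame.value_le_vertex (h : Λ.Tame p C₀) (hp : 1 < p) (hT : 0 ≤ T)
    (hg : ∀ x, |g x| ≤ M) (hgL : EdgeLip g) (r : ℝ) :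
    ∃ C, 0 ≤ C ∧ ∀ i, ∀ δ ∈ Icc 0 r, ∀ s ∈ Icc 0 T, s + δ ≤ T →
      Λ.value p T g (pt i δ) s ≤ Λ.value p T g (pt i 0) s + C * δ := by
  obtain ⟨A, hA0, hrA, hA⟩ := h.apriori hp T M r
  obtain ⟨C₁, hC₁, h1⟩ := h.value_vertex_le hp hT hg hgL A
  obtain ⟨K₁, hK₁, hmv⟩ := h.value_le_of_move hp r
  obtain ⟨K₂, hK₂, hlen⟩ := h.length_le_cost hp C₁
  refine ⟨K₁ + K₂, by positivity, fun i δ hδ s hs hsδ => ?_⟩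
  refine le_of_forall_pos_lt_add fun ε hε => ?_
  have hr : 0 ≤ r := hδ.1.trans hδ.2
  obtain ⟨y, hy, hys, hlt⟩ := Λ.exists_lt_value (p := p) (g := g) hs.2 (pt i 0) (lt_min hε one_pos)
  have hyA := ((hA g hg s hs (pt i 0) (by rw [pt_abs i le_rfl]; exact hr)).2 y hy hys
    (hlt.trans_le (by linarith [min_le_right ε 1]))).2
  have hsδ' : s ≤ s + δ := by linarith [hδ.1]
  -- Walk to the vertex in time `δ`, then compare the vertex with `y (s + δ)`. The error is `C₁`
  -- times the length travelled by `y`, which its own cost pays for.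
  have h2 := hmv M g hg T i s (s + δ) δ 0 hsδ' hsδ hδ ⟨le_rfl, hr⟩
    (by rw [zero_sub, abs_neg, abs_of_nonneg hδ.1]; linarith)
  obtain ⟨j, hj⟩ := exists_eq_pt (y (s + δ))
  have hyδ := hy.mono hp le_rfl hsδ' hsδ
  have h3 := h1 j (y (s + δ)).abs ⟨(y (s + δ)).abs_nn, hyA _ ⟨hsδ', hsδ⟩⟩ (s + δ)
    ⟨by linarith [hs.1], hsδ⟩
  rw [← hj, pt_zero j i] at h3
  have h4 := hyδ.abs_le_add hp hsδ'
  rw [hys, pt_abs i le_rfl, zero_add] at h4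
  have h5 := hlen s (s + δ) y hsδ' hyδ
  have h6 := h.cost_add_value_le (g := g) hp hg hsδ' hsδ hy
  have h7 := mul_le_mul_of_nonneg_left h4 hC₁
  linarith [min_le_left ε 1]

/-- The same estimate up to the final time, when the terminal cost is Lipschitz at the vertex. -/
theorem Lagr.Tame.value_le_vertex' (h : Λ.Tame p C₀) (hp : 1 < p) (hT : 0 ≤ T)
    (hg : ∀ x, |g x| ≤ M) (hgL : EdgeLip g)
    (hg0 : ∀ R, ∃ L, 0 ≤ L ∧ ∀ i, ∀ r ∈ Icc 0 R, g (pt i r) ≤ g (pt i 0) + L * r) (r : ℝ) :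
    ∃ C, 0 ≤ C ∧ ∀ i, ∀ δ ∈ Icc 0 r, ∀ s ∈ Icc 0 T,
      Λ.value p T g (pt i δ) s ≤ Λ.value p T g (pt i 0) s + C * δ := by
  obtain ⟨C, hC, hC'⟩ := h.value_le_vertex hp hT hg hgL r
  obtain ⟨A, hA0, hrA, hA⟩ := h.apriori hp T M r
  obtain ⟨L, hL, hgA⟩ := hgL A
  obtain ⟨L', hL', hg0'⟩ := hg0 r
  obtain ⟨K₁, hK₁, hmv⟩ := h.value_le_of_move hp r
  obtain ⟨K₂, hK₂, hlen⟩ := h.length_le_cost hp L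
  refine ⟨C + K₁ + K₂ + L', by positivity, fun i δ hδ s hs => ?_⟩
  have e1 := mul_nonneg hC hδ.1
  have e2 := mul_nonneg hK₁ hδ.1
  have e3 := mul_nonneg hK₂ hδ.1
  have e4 := mul_nonneg hL' hδ.1
  by_cases hsδ : s + δ ≤ T
  · linarith [hC' i δ hδ s hs hsδ]
  -- No time to reach the vertex: stay at distance `δ` and compare the terminal costs through the
  -- vertex instead.
  have hTs : T - s ≤ δ := by linarith
  refine le_of_forall_pos_lt_add fun ε hε => ?_
  have hr : 0 ≤ r := hδ.1.trans hδ.2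
  obtain ⟨y, hy, hys, hlt⟩ := Λ.exists_lt_value (p := p) (g := g) hs.2 (pt i 0) (lt_min hε one_pos)
  have hyA := ((hA g hg s hs (pt i 0) (by rw [pt_abs i le_rfl]; exact hr)).2 y hy hys
    (hlt.trans_le (by linarith [min_le_right ε 1]))).2
  have h2 := hmv M g hg T i s T δ δ hs.2 le_rfl hδ hδ (by simpa using hs.2)
  rw [Lagr.value_terminal] at h2
  have h3 : g (pt i 0) ≤ g (y T) + L * (y T).abs := by
    rcases (y T).abs_nn.eq_or_lt with e | e
    · rw [← e, ← eq_pt_zero e.symm i]; simp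
    · obtain ⟨j, hj⟩ := exists_eq_pt (y T)
      have := hgA j 0 ⟨le_rfl, hA0⟩ (y T).abs ⟨e, hyA T (right_mem_Icc.2 hs.2)⟩
      rw [← hj, pt_zero j i, zero_sub, abs_neg, abs_of_pos e] at this
      exact this
  have h4 := hy.abs_le_add hp hs.2
  rw [hys, pt_abs i le_rfl, zero_add] at h4
  have h5 := hlen s T y hs.2 hy
  have h6 := hg0' i δ hδ
  have h7 := mul_le_mul_of_nonneg_left h4 hL
  have h8 := mul_le_mul_of_nonneg_left hTs hK₁
  have h9 := mul_le_mul_of_nonneg_left hTs hK₂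
  linarith [min_le_left ε 1]

/-- Comparison of the values at two points of an edge, the second one being closer to the
vertex. -/
theorem Lagr.Tame.value_shrink (h : Λ.Tame p C₀) (hp : 1 < p) (hT : 0 ≤ T)
    (hg : ∀ x, |g x| ≤ M) (hgL : EdgeLip g) (r : ℝ) :
    ∃ C, 0 ≤ C ∧ ∀ i, ∀ x ∈ Icc 0 r, ∀ δ ∈ Icc 0 x, ∀ t ∈ Icc 0 T,
      Λ.value p T g (pt i (x - δ)) t ≤ Λ.value p T g (pt i x) t + C * δ := by
  obtain ⟨A, hA0, hrA, hA⟩ := h.apriori hp T M r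
  obtain ⟨C₁, hC₁, h1⟩ := h.value_vertex_le hp hT hg hgL r
  obtain ⟨K, hK, hsh⟩ := h.cost_shift_le hp A
  obtain ⟨L, hL0, hL⟩ := hgL A
  have hKTA : 0 ≤ K * (T + A) := by positivity
  refine ⟨K * (T + A) + L + C₁, by positivity, fun i x hx δ hδ t ht => ?_⟩
  rcases hδ.1.eq_or_lt with e | hδ0
  · rw [← e]; simp
  have hLδ : 0 ≤ L * δ := by positivity
  have hCδ : 0 ≤ C₁ * δ := by positivity
  refine le_of_forall_pos_lt_add fun ε hε => ?_
  obtain ⟨y, hy, hyt, hlt⟩ := Λ.exists_lt_value (p := p) (g := g) ht.2 (pt i x) (lt_min hε one_pos)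
  obtain ⟨hpow, hyA⟩ := (hA g hg t ht (pt i x) (by rw [pt_abs i hx.1]; exact hx.2)).2 y hy hyt
    (hlt.trans_le (by linarith [min_le_right ε 1]))
  have hyta : (y t).abs = x := by rw [hyt, pt_abs i hx.1]
  have hedge : y t ∈ edge i := by rw [hyt]; exact mem_edge_iff.2 (by rw [pt_abs i hx.1])
  have key : ∀ β ∈ Icc t T, (∀ σ ∈ Icc t β, δ ≤ (y σ).abs) →
      (∀ σ ∈ Icc t β, y σ = pt i (y σ).abs) ∧
      Λ.value p T g (pt i (x - δ)) t ≤ Λ.cost t β y + K * (T + A) * δ +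
        Λ.value p T g (pt i ((y β).abs - δ)) β := by
    intro β hβ hge
    have hye := eq_pt_of_preconnected isPreconnected_Icc
      (hy.1.mono (Icc_subset_Icc le_rfl hβ.2)) (fun σ hσ => hδ0.trans_le (hge σ hσ))
      ⟨le_rfl, hβ.1⟩ hedge
    refine ⟨hye, ?_⟩
    obtain ⟨hz, hzc⟩ := hsh i t β (-δ) 0 δ y hβ.1 (hy.mono hp le_rfl hβ.1 hβ.2) hye
      (fun σ hσ => hδ0.trans_le (hge σ (Ioo_subset_Icc_self hσ)))
      (fun σ hσ => hyA σ ⟨hσ.1, hσ.2.trans hβ.2⟩)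
      (fun σ hσ => ⟨by linarith [hge σ hσ], by linarith [hyA σ ⟨hσ.1, hσ.2.trans hβ.2⟩]⟩)
      (fun σ hσ => by simp [abs_of_pos hδ0]) (by simp)
    have h2 := h.value_le_cost_add (g := g) hp hg hβ.1 hβ.2 hz
    simp only [zero_mul, add_zero, abs_zero, hyta] at h2 hzc
    have h4 := integral_pow_mono hy hp le_rfl hβ.1 hβ.2
    have h5 : K * δ * (β - t + ∫ τ in t..β, |vel y τ| ^ p) ≤ K * δ * (T + A) :=
      mul_le_mul_of_nonneg_left (by linarith [ht.1, hβ.2]) (by positivity)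
    rw [← sub_eq_add_neg, ← sub_eq_add_neg] at h2
    linarith
  rcases forall_gt_or_exists_first (c := δ) hy.continuousOn_abs (hδ.2.trans hyta.ge)
    with hall | ⟨β, hβ, hβδ, hβgt⟩
  · obtain ⟨hye, h2⟩ := key T (right_mem_Icc.2 ht.2) fun σ hσ => (hall σ hσ).le
    rw [Lagr.value_terminal] at h2
    have hTm := right_mem_Icc.2 ht.2
    have hyT := hyA T hTm
    have hyTδ := hall T hTm
    have h3 := hL i ((y T).abs - δ) ⟨by linarith, by linarith⟩ (y T).abs ⟨by linarith, hyT⟩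
    rw [← hye T hTm, show (y T).abs - δ - (y T).abs = -δ by ring, abs_neg, abs_of_pos hδ0] at h3
    linarith [min_le_left ε 1]
  -- At `β` the shifted curve reaches the vertex while `y` is at distance `δ`, which is the
  -- situation of `value_vertex_le`.
  · obtain ⟨hye, h2⟩ := key β hβ fun σ hσ => by
      rcases hσ.2.eq_or_lt with e | e
      · rw [e]; exact hβδ.ge
      · exact (hβgt σ ⟨hσ.1, e⟩).le
    have hβδ' : (y β).abs = δ := hβδ
    have h3 := h1 i δ ⟨hδ0.le, hδ.2.trans hx.2⟩ β ⟨ht.1.trans hβ.1, hβ.2⟩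
    have h4 := hye β ⟨hβ.1, le_rfl⟩
    rw [hβδ'] at h4 h2
    rw [sub_self] at h2
    rw [← h4] at h3
    have h5 := h.cost_add_value_le (g := g) hp hg hβ.1 hβ.2 hy
    linarith [min_le_left ε 1]

/-- Comparison of the values at two points of an edge, the second one being further from the
vertex, along curves shifted by an affine function of time. -/
theorem Lagr.Tame.value_expand (h : Λ.Tame p C₀) (hp : 1 < p) (hT : 0 ≤ T)
    (hg : ∀ x, |g x| ≤ M) (r : ℝ) :
    ∃ A K, 0 ≤ A ∧ 0 ≤ K ∧ ∀ i, ∀ x ∈ Icc 0 r, ∀ δ ∈ Icc 0 r, ∀ t ∈ Icc 0 T, ∀ v B : ℝ,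
      |v| ≤ 1 → 0 ≤ B → (∀ σ ∈ Icc t T, δ + v * (σ - t) ∈ Icc 0 δ) →
      (∀ σ ∈ Icc t T, Λ.value p T g (pt i (δ + v * (σ - t))) σ ≤ Λ.value p T g (pt i 0) σ + B) →
      (∀ ρ ∈ Ioc 0 A, g (pt i (ρ + (δ + v * (T - t)))) ≤ g (pt i ρ) + B) →
      Λ.value p T g (pt i (x + δ)) t ≤ Λ.value p T g (pt i x) t + K * (δ + |v|) + B := by
  obtain ⟨A, hA0, hrA, hA⟩ := h.apriori hp T M r
  obtain ⟨K, hK, hsh⟩ := h.cost_shift_le hp (A + |r|)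
  have hr0 := abs_nonneg r
  have hKTA : 0 ≤ K * (T + A) := by positivity
  refine ⟨A, K * (T + A), hA0, hKTA, fun i x hx δ hδ t ht v B hv hB hsI hV hgB => ?_⟩
  refine le_of_forall_pos_lt_add fun ε hε => ?_
  obtain ⟨y, hy, hyt, hlt⟩ := Λ.exists_lt_value (p := p) (g := g) ht.2 (pt i x) (lt_min hε one_pos)
  obtain ⟨hpow, hyA⟩ := (hA g hg t ht (pt i x) (by rw [pt_abs i hx.1]; exact hx.2)).2 y hy hyt
    (hlt.trans_le (by linarith [min_le_right ε 1]))
  have hyta : (y t).abs = x := by rw [hyt, pt_abs i hx.1]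
  have hedge : y t ∈ edge i := by rw [hyt]; exact mem_edge_iff.2 (by rw [pt_abs i hx.1])
  have hrr : δ ≤ |r| := hδ.2.trans (le_abs_self r)
  have key : ∀ β ∈ Icc t T, (∀ σ ∈ Ico t β, 0 < (y σ).abs) →
      (∀ σ ∈ Icc t β, y σ = pt i (y σ).abs) →
      Λ.value p T g (pt i (x + δ)) t ≤ Λ.cost t β y + K * (T + A) * (δ + |v|) +
        Λ.value p T g (pt i ((y β).abs + (δ + v * (β - t)))) β := by
    intro β hβ hpos hye
    have hs' : ∀ σ ∈ Icc t β, δ + v * (σ - t) ∈ Icc 0 δ :=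
      fun σ hσ => hsI σ ⟨hσ.1, hσ.2.trans hβ.2⟩
    obtain ⟨hz, hzc⟩ := hsh i t β δ v δ y hβ.1 (hy.mono hp le_rfl hβ.1 hβ.2) hye
      (fun σ hσ => hpos σ (Ioo_subset_Ico_self hσ))
      (fun σ hσ => by linarith [hyA σ ⟨hσ.1, hσ.2.trans hβ.2⟩])
      (fun σ hσ => ⟨by linarith [(y σ).abs_nn, (hs' σ hσ).1],
        by linarith [hyA σ ⟨hσ.1, hσ.2.trans hβ.2⟩, (hs' σ hσ).2]⟩)
      (fun σ hσ => by rw [abs_of_nonneg (hs' σ hσ).1]; exact (hs' σ hσ).2) hv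
    have h2 := h.value_le_cost_add (g := g) hp hg hβ.1 hβ.2 hz
    simp only [sub_self, mul_zero, add_zero, hyta] at h2
    have h4 := integral_pow_mono hy hp le_rfl hβ.1 hβ.2
    have h5 : K * (δ + |v|) * (β - t + ∫ τ in t..β, |vel y τ| ^ p) ≤ K * (δ + |v|) * (T + A) :=
      mul_le_mul_of_nonneg_left (by linarith [ht.1, hβ.2])
        (mul_nonneg hK (add_nonneg hδ.1 (abs_nonneg v)))
    linarith
  -- Either `y` avoids the vertex and only terminal costs remain to be compared, or at the first
  -- hitting time `β` the shifted curve is at distance `δ + v (β - t)` from the vertex and `hV`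
  -- applies.
  rcases forall_gt_or_exists_first (c := 0) hy.continuousOn_abs (y t).abs_nn
    with hall | ⟨β, hβ, hβ0, hβgt⟩
  · have hye := eq_pt_of_preconnected isPreconnected_Icc hy.1 hall ⟨le_rfl, ht.2⟩ hedge
    have h2 := key T (right_mem_Icc.2 ht.2) (fun σ hσ => hall σ (Ico_subset_Icc_self hσ)) hye
    rw [Lagr.value_terminal] at h2
    have hTm := right_mem_Icc.2 ht.2
    have h3 := hgB (y T).abs ⟨hall T hTm, hyA T hTm⟩
    rw [← hye T hTm] at h3
    linarith [min_le_left ε 1]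
  · have hβ0' : (y β).abs = 0 := hβ0
    have hye : ∀ σ ∈ Icc t β, y σ = pt i (y σ).abs := by
      intro σ hσ
      rcases hσ.2.eq_or_lt with e | e
      · rw [e, hβ0']; exact eq_pt_zero hβ0' i
      · exact eq_pt_of_preconnected isPreconnected_Ico
          (hy.1.mono (Ico_subset_Icc_self.trans (Icc_subset_Icc le_rfl hβ.2))) hβgt
          ⟨le_rfl, hσ.1.trans_lt e⟩ hedge σ ⟨hσ.1, e⟩
    have h2 := key β hβ hβgt hye
    have h3 := hV β hβ
    rw [hβ0', zero_add] at h2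
    rw [← eq_pt_zero hβ0' i] at h3
    have h5 := h.cost_add_value_le (g := g) hp hg hβ.1 hβ.2 hy
    linarith [min_le_left ε 1]

/-- Lipschitz continuity in space, away from the final time. -/
theorem Lagr.Tame.value_spatial (h : Λ.Tame p C₀) (hp : 1 < p) (hT : 0 ≤ T)
    (hg : ∀ x, |g x| ≤ M) (hgL : EdgeLip g) {η : ℝ} (hη : 0 < η) (r : ℝ) :
    ∃ C, 0 ≤ C ∧ ∀ t ∈ Icc 0 (T - η), ∀ x x' : Junction N, x.abs ≤ r → x'.abs ≤ r →
      Λ.value p T g x t ≤ Λ.value p T g x' t + C * dist x x' := by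
  obtain ⟨A, hA0, hrA, hA⟩ := h.apriori hp T M r
  obtain ⟨C₁, hC₁, h1⟩ := h.value_shrink hp hT hg hgL r
  obtain ⟨C₂, hC₂, h2⟩ := h.value_le_vertex hp hT hg hgL r
  obtain ⟨A', K, hA', hK, h3⟩ := h.value_expand hp hT hg r
  set C := C₁ + C₂ + K * (1 + 1 / η) + 2 * A / η with hC
  have hKη : 0 ≤ K * (1 + 1 / η) := by positivity
  have hAη : 0 ≤ 2 * A / η := by positivity
  refine ⟨C, by positivity, fun t ht x x' hx hx' =>
    le_of_edge_lipschitz (f := fun z => Λ.value p T g z t) (fun i r₁ hr₁ r₂ hr₂ => ?_) hx hx'⟩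
  have htT : t ∈ Icc 0 T := ⟨ht.1, by linarith [ht.2]⟩
  have hd0 := abs_nonneg (r₁ - r₂)
  by_cases hle : r₁ ≤ r₂
  · have := h1 i r₂ hr₂ (r₂ - r₁) ⟨by linarith, by linarith [hr₁.1]⟩ t htT
    have e := sub_nonneg.2 hle
    rw [sub_sub_cancel] at this
    rw [abs_sub_comm, abs_of_nonneg e]
    have e1 : C₁ * (r₂ - r₁) ≤ C * (r₂ - r₁) :=
      mul_le_mul_of_nonneg_right (by rw [hC]; linarith) e
    linarith
  have hlt : r₂ < r₁ := not_le.1 hle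
  rw [abs_of_pos (by linarith)]
  set δ := r₁ - r₂ with hδ
  have hδ0 : 0 < δ := by rw [hδ]; linarith
  have hδr : δ ≤ r := by linarith [hr₁.2, hr₂.1]
  have hCδ : 0 ≤ C₁ * δ := by positivity
  have hCδ2 : 0 ≤ C₂ * δ := by positivity
  have hKδ : 0 ≤ K * (1 + 1 / η) * δ := by positivity
  have hAδ : 0 ≤ 2 * A / η * δ := by positivity
  by_cases hδη : δ ≤ η
  · have hTt : η ≤ T - t := by linarith [ht.2]
    have hTt0 : 0 < T - t := by linarith
    -- The outward shift decreases linearly to `0` at `T`. Thus the terminal positions agree, and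
    -- since `δ ≤ T - t` the remaining shift at time `σ` is at most `T - σ`, as `value_le_vertex`
    -- requires.
    have hw : ∀ σ, δ + -(δ / (T - t)) * (σ - t) = δ * ((T - σ) / (T - t)) := by
      intro σ; field_simp; ring
    have hw1 : ∀ σ ∈ Icc t T, 0 ≤ (T - σ) / (T - t) ∧ (T - σ) / (T - t) ≤ 1 := fun σ hσ =>
      ⟨div_nonneg (by linarith [hσ.2]) hTt0.le, (div_le_one hTt0).2 (by linarith [hσ.1])⟩
    have hsI : ∀ σ ∈ Icc t T, δ + -(δ / (T - t)) * (σ - t) ∈ Icc 0 δ := by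
      intro σ hσ
      rw [hw]
      exact ⟨mul_nonneg hδ0.le (hw1 σ hσ).1, mul_le_of_le_one_right hδ0.le (hw1 σ hσ).2⟩
    have hva : |-(δ / (T - t))| = δ / (T - t) := by rw [abs_neg, abs_of_pos (by positivity)]
    have := h3 i r₂ hr₂ δ ⟨hδ0.le, hδr⟩ t htT (-(δ / (T - t))) (C₂ * δ)
      (by rw [hva]; exact (div_le_one hTt0).2 (by linarith)) hCδ2 hsI
      (fun σ hσ => by
        have h4 := hsI σ hσ
        have h5 := h2 i _ ⟨h4.1, h4.2.trans hδr⟩ σ ⟨ht.1.trans hσ.1, hσ.2⟩ (by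
          rw [hw]
          have : δ * ((T - σ) / (T - t)) ≤ (T - t) * ((T - σ) / (T - t)) :=
            mul_le_mul_of_nonneg_right (by linarith) (hw1 σ hσ).1
          rw [mul_div_cancel₀ _ hTt0.ne'] at this
          linarith)
        exact h5.trans (by have := mul_le_mul_of_nonneg_left h4.2 hC₂; linarith))
      (fun ρ _ => by rw [hw, sub_self, zero_div, mul_zero, add_zero]; linarith)
    rw [show r₂ + δ = r₁ by rw [hδ]; ring, hva] at this
    have h6 : δ / (T - t) ≤ δ * (1 / η) := by
      rw [mul_one_div]; exact div_le_div_of_nonneg_left hδ0.le hη hTt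
    have h7 : K * (δ + δ / (T - t)) ≤ K * (δ + δ * (1 / η)) :=
      mul_le_mul_of_nonneg_left (by linarith) hK
    rw [hC]; linarith
  -- Points more than `η` apart are covered by the uniform bound on the value.
  · have h4 := abs_le.1 (hA g hg t htT (pt i r₁) (by rw [pt_abs i hr₁.1]; exact hr₁.2)).1
    have h5 := abs_le.1 (hA g hg t htT (pt i r₂) (by rw [pt_abs i hr₂.1]; exact hr₂.2)).1
    have h6 : 2 * A ≤ 2 * A / η * δ := by
      rw [div_mul_eq_mul_div, le_div_iff₀ hη]
      exact mul_le_mul_of_nonneg_left (not_le.1 hδη).le (by linarith)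
    rw [hC]; linarith

/-- Lipschitz continuity in space up to the final time. -/
theorem Lagr.Tame.value_spatial' (h : Λ.Tame p C₀) (hp : 1 < p) (hT : 0 ≤ T)
    (hg : ∀ x, |g x| ≤ M)
    (hgL : ∀ R, ∃ L, 0 ≤ L ∧ ∀ i, ∀ r ∈ Icc 0 R, ∀ r' ∈ Icc 0 R,
      g (pt i r) ≤ g (pt i r') + L * |r - r'|) (r : ℝ) :
    ∃ C, 0 ≤ C ∧ ∀ t ∈ Icc 0 T, ∀ x x' : Junction N, x.abs ≤ r → x'.abs ≤ r →
      Λ.value p T g x t ≤ Λ.value p T g x' t + C * dist x x' := by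
  have hgE : EdgeLip g := fun R => by
    obtain ⟨L, hL, hLg⟩ := hgL R
    exact ⟨L, hL, fun i r hr r' hr' => hLg i r hr r' (Ioc_subset_Icc_self hr')⟩
  obtain ⟨C₁, hC₁, h1⟩ := h.value_shrink hp hT hg hgE r
  obtain ⟨C₂, hC₂, h2⟩ := h.value_le_vertex' hp hT hg hgE (fun R => by
    obtain ⟨L, hL, hLg⟩ := hgL R
    refine ⟨L, hL, fun i r hr => ?_⟩
    have := hLg i r hr 0 ⟨le_rfl, hr.1.trans hr.2⟩
    rwa [sub_zero, abs_of_nonneg hr.1] at this) r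
  obtain ⟨A', K, hA', hK, h3⟩ := h.value_expand hp hT hg r
  obtain ⟨L, hL, hLg⟩ := hgL (A' + |r|)
  refine ⟨C₁ + C₂ + L + K, by positivity,
    fun t ht x x' hx hx' =>
    le_of_edge_lipschitz (f := fun z => Λ.value p T g z t) (fun i r₁ hr₁ r₂ hr₂ => ?_) hx hx'⟩
  have hd0 := abs_nonneg (r₁ - r₂)
  by_cases hle : r₁ ≤ r₂
  · have := h1 i r₂ hr₂ (r₂ - r₁) ⟨by linarith, by linarith [hr₁.1]⟩ t ht
    have e := sub_nonneg.2 hle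
    rw [sub_sub_cancel] at this
    rw [abs_sub_comm, abs_of_nonneg e]
    have e1 : C₁ * (r₂ - r₁) ≤ (C₁ + C₂ + L + K) * (r₂ - r₁) :=
      mul_le_mul_of_nonneg_right (by linarith) e
    linarith
  have hlt : r₂ < r₁ := not_le.1 hle
  rw [abs_of_pos (by linarith)]
  set δ := r₁ - r₂ with hδ
  have hδ0 : 0 < δ := by rw [hδ]; linarith
  have hδr : δ ≤ r := by linarith [hr₁.2, hr₂.1]
  have hCδ : 0 ≤ C₁ * δ := by positivity
  have hCδ2 : 0 ≤ C₂ * δ := by positivity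
  have hLδ : 0 ≤ L * δ := by positivity
  -- The shift can stay constant here, because the vertex comparison is available up to time `T` and
  -- the terminal cost is Lipschitz in both directions.
  have := h3 i r₂ hr₂ δ ⟨hδ0.le, hδr⟩ t ht 0 ((C₂ + L) * δ) (by simp) (by positivity)
    (fun σ _ => by simpa using hδ0.le)
    (fun σ hσ => by
      have h5 := h2 i δ ⟨hδ0.le, hδr⟩ σ ⟨ht.1.trans hσ.1, hσ.2⟩
      rw [zero_mul, add_zero]
      linarith)
    (fun ρ hρ => by
      rw [zero_mul, add_zero]
      have h5 := hLg i (ρ + δ) ⟨by linarith [hρ.1], by linarith [hρ.2, le_abs_self r]⟩ ρ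
        ⟨hρ.1.le, by linarith [hρ.2, abs_nonneg r]⟩
      rw [add_sub_cancel_left, abs_of_pos hδ0] at h5
      linarith)
  rw [show r₂ + δ = r₁ by rw [hδ]; ring, abs_zero, add_zero] at this
  linarith

/-- Spatial Lipschitz estimates give Lipschitz estimates in time. -/
theorem Lagr.Tame.lipschitz_of_spatial (h : Λ.Tame p C₀) (hp : 1 < p)
    (hg : ∀ x, |g x| ≤ M) {S : Set ℝ} (hS : S ⊆ Icc 0 T)
    (hsp : ∀ r, ∃ C, 0 ≤ C ∧ ∀ t ∈ S, ∀ x x' : Junction N, x.abs ≤ r → x'.abs ≤ r →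
      Λ.value p T g x t ≤ Λ.value p T g x' t + C * dist x x') (r : ℝ) :
    ∃ C : NNReal, LipschitzOnWith C (fun q : Junction N × ℝ => Λ.value p T g q.1 q.2)
      ({x | x.abs ≤ r} ×ˢ S) := by
  obtain ⟨A, hA0, hrA, hA⟩ := h.apriori hp T M r
  obtain ⟨C, hC, h1⟩ := hsp A
  obtain ⟨K₁, hK₁, hmv⟩ := h.value_le_of_move hp r
  obtain ⟨K₂, hK₂, hlen⟩ := h.length_le_cost hp C
  have up : ∀ t ∈ S, ∀ s ∈ S, t ≤ s → ∀ x : Junction N, x.abs ≤ r →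
      Λ.value p T g x t ≤ Λ.value p T g x s + K₁ * (s - t) := by
    intro t ht s hs hts x hx
    obtain ⟨i, hi⟩ := exists_eq_pt x
    have := hmv M g hg T i t s x.abs x.abs hts (hS hs).2 ⟨x.abs_nn, hx⟩ ⟨x.abs_nn, hx⟩
      (by simpa using hts)
    rw [← hi] at this
    linarith
  -- By time `s` a nearly optimal curve has drifted from `x` by at most its length; the spatial
  -- estimate turns this into `C` times the length, absorbed by the cost.
  have down : ∀ t ∈ S, ∀ s ∈ S, t ≤ s → ∀ x : Junction N, x.abs ≤ r →
      Λ.value p T g x s ≤ Λ.value p T g x t + K₂ * (s - t) := by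
    intro t ht s hs hts x hx
    refine le_of_forall_pos_lt_add fun ε hε => ?_
    obtain ⟨y, hy, hyt, hlt⟩ := Λ.exists_lt_value (p := p) (g := g) (hS ht).2 x (lt_min hε one_pos)
    have hyA := ((hA g hg t (hS ht) x hx).2 y hy hyt
      (hlt.trans_le (by linarith [min_le_right ε 1]))).2
    have hys := hy.mono hp le_rfl hts (hS hs).2
    have h2 := h1 s hs x (y s) (hx.trans hrA) (hyA s ⟨hts, (hS hs).2⟩)
    have h3 := hys.dist_le hp hts
    rw [hyt] at h3
    have h4 := hlen t s y hts hys
    have h5 := h.cost_add_value_le (g := g) hp hg hts (hS hs).2 hy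
    have h6 := mul_le_mul_of_nonneg_left h3 hC
    linarith [min_le_left ε 1]
  refine ⟨⟨C + (K₁ + K₂), by positivity⟩, LipschitzOnWith.of_le_add_mul _ ?_⟩
  rintro ⟨x, t⟩ ⟨hx, ht⟩ ⟨x', s⟩ ⟨hx', hs⟩
  simp only [Set.mem_ofPred_eq] at hx hx' ht hs
  have e1 : dist x x' ≤ dist (x, t) (x', s) := le_max_left _ _
  have e2 : |t - s| ≤ dist (x, t) (x', s) := le_max_right _ _
  have h2 := h1 s hs x x' (hx.trans hrA) (hx'.trans hrA)
  have h3 : Λ.value p T g x t ≤ Λ.value p T g x s + (K₁ + K₂) * |t - s| := by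
    have h0 := abs_nonneg (t - s)
    have h01 := mul_nonneg hK₁ h0
    have h02 := mul_nonneg hK₂ h0
    rcases le_total t s with hts | hts
    · have := up t ht s hs hts x hx
      rw [abs_of_nonpos (by linarith), neg_sub] at *
      linarith
    · have := down s hs t ht hts x hx
      rw [abs_of_nonneg (by linarith)] at *
      linarith
  have h4 := mul_le_mul_of_nonneg_left e1 hC
  have h5 := mul_le_mul_of_nonneg_left e2 (add_nonneg hK₁ hK₂)
  change Λ.value p T g x t ≤ Λ.value p T g x' s + (C + (K₁ + K₂)) * dist (x, t) (x', s)
  linarith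

end Estimates

end JunctionMFG

/-! ### Continuity of the value function -/

namespace JunctionMFG

open JunctionMFG.Junction (pt edge vertex)

/-- `g` is given by continuous functions on the open edges, whose limits at the vertex are at
least the value of `g` there. -/
structure EdgeCont {N : ℕ} (g : Junction N → ℝ) (G : Fin N → ℝ → ℝ) : Prop where
  cont : ∀ i, ContinuousOn (G i) (Ici 0)
  eq : ∀ i r, 0 < r → g (pt i r) = G i r
  le : ∀ i, g (pt i 0) ≤ G i 0

section Continuity

variable {N : ℕ} {p C₀ T M : ℝ} {Λ : Lagr N} {g : Junction N → ℝ} {G : Fin N → ℝ → ℝ}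

theorem EdgeCont.eq_of_mem (hG : EdgeCont g G) {i : Fin N} {x : Junction N}
    (hx : x ∈ edge i \ vertex) : g x = G i x.abs := by
  have h1 := mem_edge_iff.1 hx.1
  have h2 : 0 < x.abs := lt_of_le_of_ne x.abs_nn fun h => hx.2 (mem_vertex_iff.2 h.symm)
  conv_lhs => rw [h1]
  exact hG.eq i _ h2

theorem EdgeCont.lowerSemicontinuous (hG : EdgeCont g G) : LowerSemicontinuous g := by
  have hcont : ∀ i, Continuous fun x : Junction N => G i x.abs := fun i =>
    (hG.cont i).comp_continuous continuous_abs' fun x => x.abs_nn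
  intro x c hc
  rcases abs_vec_pos_cases x with h0 | ⟨i, hi⟩
  · have hall : ∀ᶠ z in 𝓝 x, ∀ i, c < G i z.abs := eventually_all.2 fun i => by
      refine (hcont i).continuousAt.eventually_const_lt ?_
      change c < G i x.abs
      rw [h0]; rw [eq_pt_zero h0 i] at hc; exact hc.trans_le (hG.le i)
    filter_upwards [hall] with z hz
    rcases abs_vec_pos_cases z with h1 | ⟨i, hi⟩
    · obtain ⟨i, -⟩ := exists_eq_pt x
      rw [eq_pt_zero h1 i]; rwa [eq_pt_zero h0 i] at hc
    · rw [hG.eq_of_mem hi]; exact hz i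
  · rw [hG.eq_of_mem hi] at hc
    filter_upwards [(isOpen_edge_diff i).mem_nhds hi, (hcont i).continuousAt.eventually_const_lt hc]
      with z hz hz'
    rwa [hG.eq_of_mem hz]

/-- The estimates are uniform on such slabs; this makes them local statements on `𝒢 × [0, T)`. -/
theorem mem_nhdsWithin_slab {x : Junction N} {t η : ℝ} (ht : t < T - η) :
    ({z : Junction N | z.abs ≤ x.abs + 1} ×ˢ Icc 0 (T - η) : Set (Junction N × ℝ)) ∈
      𝓝[univ ×ˢ Ico 0 T] (x, t) := by
  have h1 : {z : Junction N | z.abs < x.abs + 1} ∈ 𝓝 x :=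
    (isOpen_lt continuous_abs' continuous_const).mem_nhds (by simp)
  have h2 : Iio (T - η) ∈ 𝓝 t := Iio_mem_nhds ht
  filter_upwards [mem_nhdsWithin_of_mem_nhds (prod_mem_nhds h1 h2), self_mem_nhdsWithin]
    with q hq hq'
  exact ⟨(show q.1.abs < x.abs + 1 from hq.1).le, hq'.2.1, le_of_lt hq.2⟩

variable [NeZero N]

/-- Dependence of the value function on the terminal cost. -/
theorem Lagr.Tame.value_le_of_terminal_le (h : Λ.Tame p C₀) (hp : 1 < p) (T M r : ℝ) :
    ∃ A, 0 ≤ A ∧ ∀ (g g' : Junction N → ℝ) (ε : ℝ), (∀ x, |g x| ≤ M) → (∀ x, |g' x| ≤ M) →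
      (∀ x, x.abs ≤ A → g x ≤ g' x + ε) → ∀ t ∈ Icc 0 T, ∀ x : Junction N, x.abs ≤ r →
      Λ.value p T g x t ≤ Λ.value p T g' x t + ε := by
  obtain ⟨A, hA0, hrA, hA⟩ := h.apriori hp T M r
  refine ⟨A, hA0, fun g g' ε hg hg' hgg t ht x hx => ?_⟩
  refine le_of_forall_pos_lt_add fun η hη => ?_
  obtain ⟨y, hy, hyt, hlt⟩ := Λ.exists_lt_value (p := p) (g := g') ht.2 x (lt_min hη one_pos)
  have hyA := ((hA g' hg' t ht x hx).2 y hy hyt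
    (hlt.trans_le (by linarith [min_le_right η 1]))).2
  have h1 := h.value_le (g := g) hp hg ht.2 (mem_Gam.2 ⟨hy, hyt⟩)
  have h2 := hgg (y T) (hyA T (right_mem_Icc.2 ht.2))
  linarith [min_le_left η 1]

/-- Uniform approximation of an edgewise continuous terminal cost by edgewise Lipschitz ones. -/
theorem EdgeCont.exists_edgeLip_near (hG : EdgeCont g G) (hg : ∀ x, |g x| ≤ M)
    (hGM : ∀ i r, 0 ≤ r → |G i r| ≤ M) {A ε : ℝ} (hA : 0 ≤ A) (hε : 0 < ε) (hε1 : ε ≤ 1) :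
    ∃ g' : Junction N → ℝ, (∀ x, |g' x| ≤ M + 1) ∧ EdgeLip g' ∧
      ∀ x, x.abs ≤ A → |g x - g' x| ≤ ε := by
  have hP : ∀ i, ∃ P : Polynomial ℝ, ∀ x ∈ Icc 0 A, |P.eval x - G i x| < ε / 2 := fun i =>
    exists_polynomial_near_of_continuousOn 0 A (G i) ((hG.cont i).mono Icc_subset_Ici_self)
      (ε / 2) (by linarith)
  choose P hP using hP
  -- Adding `ε / 2` puts `F i` above `G i` up to distance `A`, so the unchanged value at the vertex
  -- remains below its edge limits. Freezing the argument at `A` keeps `F i` bounded and Lipschitz.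
  set F : Fin N → ℝ → ℝ := fun i r => (P i).eval (min r A) + ε / 2 with hF
  have hmin : ∀ r : ℝ, 0 ≤ r → min r A ∈ Icc 0 A := fun r hr => ⟨le_min hr hA, min_le_right _ _⟩
  have hFG : ∀ i, ∀ r : ℝ, 0 ≤ r → G i (min r A) ≤ F i r ∧ F i r ≤ G i (min r A) + ε := by
    intro i r hr
    have := abs_lt.1 (hP i _ (hmin r hr))
    constructor <;> simp only [hF] <;> linarith
  -- `Lagr.run` is reused to glue functions on the open edges with a value at the vertex.
  let Λ' : Lagr N := ⟨fun i _ x _ => F i x, fun _ => g (pt 0 0)⟩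
  set g' : Junction N → ℝ := fun x => Λ'.run 0 x 0 with hg'
  have hv : ∀ x : Junction N, x.abs = 0 → g' x = g x := fun x hx => by
    rw [hg', eq_pt_zero hx 0]
    exact Lagr.run_vertex (pt_abs 0 le_rfl) 0 0
  have he : ∀ i, ∀ x ∈ edge i \ vertex, g' x = F i x.abs := fun i x hx => Lagr.run_of_mem hx 0 0
  refine ⟨g', fun x => ?_, ?_, fun x hx => ?_⟩
  · rcases abs_vec_pos_cases x with h0 | ⟨i, hi⟩
    · rw [hv x h0]; linarith [hg x]
    · rw [he i x hi]
      have h1 := abs_le.1 (hGM i _ (hmin x.abs x.abs_nn).1)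
      have h2 := hFG i x.abs x.abs_nn
      rw [abs_le]; constructor <;> linarith
  · have hL : ∀ i, ∃ L, LipschitzOnWith L (fun r => (P i).eval r) (Icc 0 A) := fun i =>
      ContDiffOn.exists_lipschitzOnWith (n := 1)
        (by simpa using (Polynomial.contDiff_aeval (P i) 1 :
          ContDiff ℝ 1 fun r : ℝ => Polynomial.aeval r (P i)).contDiffOn) one_ne_zero
        (convex_Icc 0 A) isCompact_Icc
    choose L hL using hL
    intro R
    refine ⟨∑ i, (L i : ℝ), by positivity, fun i r hr r' hr' => ?_⟩
    have h1 : g' (pt i r) ≤ F i r := by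
      rcases hr.1.eq_or_lt with e | e
      · rw [← e, hv _ (pt_abs i le_rfl)]
        refine (hG.le i).trans ?_
        have := (hFG i 0 le_rfl).1
        rwa [min_eq_left hA] at this
      · rw [he i _ ((pt_mem_edge_diff e.le).2 ⟨rfl, e⟩), pt_abs i e.le]
    have h2 : g' (pt i r') = F i r' := by
      rw [he i _ ((pt_mem_edge_diff hr'.1.le).2 ⟨rfl, hr'.1⟩), pt_abs i hr'.1.le]
    have h3 := (hL i).dist_le_mul _ (hmin r hr.1) _ (hmin r' hr'.1.le)
    rw [Real.dist_eq, Real.dist_eq] at h3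
    have h4 : |min r A - min r' A| ≤ |r - r'| := by
      simpa using abs_min_sub_min_le_max r A r' A
    have h5 : (L i : ℝ) ≤ ∑ i, (L i : ℝ) :=
      Finset.single_le_sum (f := fun i => (L i : ℝ)) (fun _ _ => NNReal.coe_nonneg _)
        (Finset.mem_univ i)
    have h6 : (L i : ℝ) * |min r A - min r' A| ≤ (∑ i, (L i : ℝ)) * |r - r'| :=
      mul_le_mul h5 h4 (abs_nonneg _) (by positivity)
    have h7 := (abs_le.1 h3).2
    rw [h2]
    simp only [hF] at h1 ⊢
    linarith
  · rcases abs_vec_pos_cases x with h0 | ⟨i, hi⟩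
    · rw [hv x h0, sub_self, abs_zero]; exact hε.le
    · rw [he i x hi, hG.eq_of_mem hi]
      have h2 := hFG i x.abs x.abs_nn
      rw [min_eq_left hx] at h2
      rw [abs_le]; constructor <;> linarith

/-- On a bounded slab away from `T`, the value is a uniform limit of values with edgewise Lipschitz
terminal costs, which are Lipschitz there. -/
theorem Lagr.Tame.continuousOn_value (h : Λ.Tame p C₀) (hp : 1 < p) (hT : 0 ≤ T)
    (hg : ∀ x, |g x| ≤ M) (hG : EdgeCont g G) (hGM : ∀ i r, 0 ≤ r → |G i r| ≤ M) :
    ContinuousOn (fun q : Junction N × ℝ => Λ.value p T g q.1 q.2) (univ ×ˢ Ico 0 T) := by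
  rintro ⟨x, t⟩ ⟨-, ht⟩
  have hη : 0 < (T - t) / 2 := by linarith [ht.2]
  set η := (T - t) / 2 with hηd
  obtain ⟨A, hA0, hA⟩ := h.value_le_of_terminal_le hp T (M + 1) (x.abs + 1)
  have hcont : ContinuousOn (fun q : Junction N × ℝ => Λ.value p T g q.1 q.2)
      ({z : Junction N | z.abs ≤ x.abs + 1} ×ˢ Icc 0 (T - η)) := by
    refine continuousOn_of_uniform_approx_of_continuousOn fun u hu => ?_
    obtain ⟨ε, hε, hεu⟩ := Metric.mem_uniformity_dist.1 hu
    obtain ⟨g', hg', hL, hgg⟩ := hG.exists_edgeLip_near hg hGM hA0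
      (lt_min (half_pos hε) one_pos) (min_le_right _ _)
    obtain ⟨K, hK⟩ := h.lipschitz_of_spatial hp hg' (S := Icc 0 (T - η))
      (Icc_subset_Icc le_rfl (by linarith)) (fun r => h.value_spatial hp hT hg' hL hη r) (x.abs + 1)
    refine ⟨_, hK.continuousOn, fun q hq => hεu ?_⟩
    have hM : ∀ x, |g x| ≤ M + 1 := fun x => (hg x).trans (by linarith)
    have hq2 : q.2 ∈ Icc 0 T := ⟨hq.2.1, by linarith [hq.2.2]⟩
    have h1 := hA g g' (min (ε / 2) 1) hM hg'
      (fun z hz => by linarith [(abs_le.1 (hgg z hz)).2]) q.2 hq2 q.1 hq.1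
    have h2 := hA g' g (min (ε / 2) 1) hg' hM
      (fun z hz => by linarith [(abs_le.1 (hgg z hz)).1]) q.2 hq2 q.1 hq.1
    rw [Real.dist_eq, abs_lt]
    constructor <;> linarith [min_le_left (ε / 2) 1]
  have hmem := mem_nhdsWithin_slab (T := T) (x := x) (t := t) (η := η) (by linarith)
  exact (hcont (x, t) ⟨by simp, ht.1, by linarith⟩).mono_of_mem_nhdsWithin hmem

theorem Lagr.Tame.locallyLipschitzOn_value (h : Λ.Tame p C₀) (hp : 1 < p) (hT : 0 ≤ T)
    (hg : ∀ x, |g x| ≤ M) (hL : EdgeLip g) :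
    LocallyLipschitzOn (univ ×ˢ Ico 0 T)
      (fun q : Junction N × ℝ => Λ.value p T g q.1 q.2) := by
  rintro ⟨x, t⟩ ⟨-, ht⟩
  have hη : 0 < (T - t) / 2 := by linarith [ht.2]
  obtain ⟨K, hK⟩ := h.lipschitz_of_spatial hp hg (S := Icc 0 (T - (T - t) / 2))
      (Icc_subset_Icc le_rfl (by linarith)) (fun r => h.value_spatial hp hT hg hL hη r) (x.abs + 1)
  exact ⟨K, _, mem_nhdsWithin_slab (by linarith), hK⟩

theorem Lagr.Tame.locallyLipschitzOn_value' (h : Λ.Tame p C₀) (hp : 1 < p) (hT : 0 ≤ T)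
    (hg : ∀ x, |g x| ≤ M)
    (hL : ∀ R, ∃ L, 0 ≤ L ∧ ∀ i, ∀ r ∈ Icc 0 R, ∀ r' ∈ Icc 0 R,
      g (pt i r) ≤ g (pt i r') + L * |r - r'|) :
    LocallyLipschitzOn (univ ×ˢ Icc 0 T)
      (fun q : Junction N × ℝ => Λ.value p T g q.1 q.2) := by
  rintro ⟨x, t⟩ ⟨-, ht⟩
  obtain ⟨K, hK⟩ := h.lipschitz_of_spatial hp hg (S := Icc 0 T)
      subset_rfl (fun r => h.value_spatial' hp hT hg hL r) (x.abs + 1)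
  refine ⟨K, _, ?_, hK⟩
  have h1 : {z : Junction N | z.abs < x.abs + 1} ∈ 𝓝 x :=
    (isOpen_lt continuous_abs' continuous_const).mem_nhds (by simp)
  filter_upwards [mem_nhdsWithin_of_mem_nhds (prod_mem_nhds h1 univ_mem), self_mem_nhdsWithin]
    with q hq hq'
  exact ⟨(show q.1.abs < x.abs + 1 from hq.1).le, hq'.2⟩

/-- The terminal condition is attained continuously. -/
theorem Lagr.Tame.continuousWithinAt_value_terminal (h : Λ.Tame p C₀) (hp : 1 < p)
    (hg : ∀ x, |g x| ≤ M) (hlsc : LowerSemicontinuous g) (x : Junction N) :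
    ContinuousWithinAt (fun t => Λ.value p T g x t) (Icc 0 T) T := by
  rw [Metric.continuousWithinAt_iff]
  intro ε hε
  obtain ⟨ρ, hρ, hρg⟩ := Metric.eventually_nhds_iff.1 (hlsc x (g x - ε / 2) (by linarith))
  -- With this slope, going farther than `ρ` from `x` costs more than the largest possible gain `2 *
  -- M` in terminal cost, up to `K` times the elapsed time.
  obtain ⟨K, hK, hlen⟩ := h.length_le_cost hp (2 * M / ρ)
  obtain ⟨K₁, hK₁, hmv⟩ := h.value_le_of_move hp x.abs
  have hM : 0 ≤ M := (abs_nonneg _).trans (hg x)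
  refine ⟨ε / (2 * (K + K₁ + 1)), by positivity, fun t ht htd => ?_⟩
  rw [Lagr.value_terminal, Real.dist_eq]
  have htT := ht.2
  have hsmall : (K + K₁ + 1) * (T - t) < ε / 2 := by
    rw [dist_comm, Real.dist_eq, abs_of_nonneg (by linarith), lt_div_iff₀ (by positivity)] at htd
    linarith
  have e1 : 0 ≤ K * (T - t) := mul_nonneg hK (by linarith)
  have e2 : 0 ≤ K₁ * (T - t) := mul_nonneg hK₁ (by linarith)
  have hup : Λ.value p T g x t < g x + ε := by
    obtain ⟨i, hi⟩ := exists_eq_pt x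
    have := hmv M g hg T i t T x.abs x.abs htT le_rfl ⟨x.abs_nn, le_rfl⟩ ⟨x.abs_nn, le_rfl⟩
      (by simpa using htT)
    rw [← hi, Lagr.value_terminal] at this
    linarith
  have hdown : g x - ε / 2 - K * (T - t) ≤ Λ.value p T g x t := by
    refine Λ.le_value htT fun y hy hyt => ?_
    have h1 := hlen t T y htT hy
    have h2 := hy.dist_le hp htT
    rw [hyt] at h2
    have hMρ : 0 ≤ 2 * M / ρ := by positivity
    have h3 := mul_le_mul_of_nonneg_left h2 hMρ
    have h4 : g x - ε / 2 ≤ g (y T) + 2 * M / ρ * dist x (y T) := by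
      by_cases hd : dist (y T) x < ρ
      · have := hρg hd
        have := mul_nonneg hMρ (dist_nonneg (x := x) (y := y T))
        linarith
      · rw [dist_comm] at hd
        have h5 : 2 * M ≤ 2 * M / ρ * dist x (y T) := by
          rw [div_mul_eq_mul_div, le_div_iff₀ hρ]
          exact mul_le_mul_of_nonneg_left (not_lt.1 hd) (by linarith)
        have := abs_le.1 (hg x)
        have := abs_le.1 (hg (y T))
        linarith
    linarith
  rw [abs_lt]
  constructor <;> linarith

theorem Lagr.Tame.continuousOn_value_time (h : Λ.Tame p C₀) (hp : 1 < p) (hT : 0 ≤ T)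
    (hg : ∀ x, |g x| ≤ M) (hG : EdgeCont g G) (hGM : ∀ i r, 0 ≤ r → |G i r| ≤ M)
    (x : Junction N) : ContinuousOn (fun t => Λ.value p T g x t) (Icc 0 T) := by
  intro t ht
  rcases ht.2.eq_or_lt with e | e
  · rw [e]; exact h.continuousWithinAt_value_terminal hp hg hG.lowerSemicontinuous x
  · have h1 := h.continuousOn_value hp hT hg hG hGM (x, t) ⟨trivial, ht.1, e⟩
    have h2 : ContinuousWithinAt (fun t => Λ.value p T g x t) (Ico 0 T) t :=
      h1.comp (f := fun t : ℝ => (x, t)) (by fun_prop) fun s hs => ⟨trivial, hs⟩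
    refine h2.mono_of_mem_nhdsWithin ?_
    filter_upwards [self_mem_nhdsWithin, mem_nhdsWithin_of_mem_nhds (Iio_mem_nhds e)] with s hs hs'
    exact ⟨hs.1, hs'⟩

end Continuity

end JunctionMFG

/-! ### Viscosity inequalities -/

namespace JunctionMFG

open JunctionMFG.Junction (pt edge vertex)

section FirstOrder

variable {N : ℕ} {T : ℝ}

/-- First order expansion of a test function along an edge. -/
theorem IsC1.expansion {φ : Junction N → ℝ → ℝ} (hφ : IsC1 T φ) {x : Junction N} {t : ℝ}
    (ht : t ∈ Ioo 0 T) {η : ℝ} (hη : 0 < η) (i : Fin N) (hx : x ∈ edge i) :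
    ∀ᶠ q : Junction N × ℝ in 𝓝 (x, t), q.1 ∈ edge i →
      |φ q.1 q.2 - φ x t - (Dx φ i x.abs t * (q.1.abs - x.abs) +
        deriv (fun s => φ x s) t * (q.2 - t))| ≤ η * (dist q.1 x + |q.2 - t|) := by
  have hxe := mem_edge_iff.1 hx
  set S : Set (ℝ × ℝ) := Ici 0 ×ˢ Ioo 0 T with hS
  set f : ℝ × ℝ → ℝ := fun q => φ (pt i q.1) q.2 with hf
  have hmem : (x.abs, t) ∈ S := ⟨x.abs_nn, ht⟩
  have hd : HasFDerivWithinAt f (fderivWithin ℝ f S (x.abs, t)) S (x.abs, t) :=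
    ((hφ.2 i).differentiableOn one_ne_zero (x.abs, t) hmem).hasFDerivWithinAt
  set L := fderivWithin ℝ f S (x.abs, t) with hL
  have h1 : L (1, 0) = Dx φ i x.abs t := by
    have e : HasDerivWithinAt (fun z : ℝ => (z, t)) ((1 : ℝ), (0 : ℝ)) (Ici 0) x.abs :=
      ((hasDerivAt_id x.abs).prodMk (hasDerivAt_const x.abs t)).hasDerivWithinAt
    have := hd.comp_hasDerivWithinAt x.abs e
      (show MapsTo (fun z : ℝ => (z, t)) (Ici 0) S from fun z hz => ⟨hz, ht⟩)
    exact (this.derivWithin (uniqueDiffOn_Ici 0 _ x.abs_nn)).symm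
  have h2 : L (0, 1) = deriv (fun s => φ x s) t := by
    have e : HasDerivWithinAt (fun z : ℝ => (x.abs, z)) ((0 : ℝ), (1 : ℝ)) (Ioo 0 T) t :=
      ((hasDerivAt_const t x.abs).prodMk (hasDerivAt_id t)).hasDerivWithinAt
    have := (hd.comp_hasDerivWithinAt t e
      (show MapsTo (fun z : ℝ => (x.abs, z)) (Ioo 0 T) S from fun z hz => ⟨x.abs_nn, hz⟩)).hasDerivAt
      (Ioo_mem_nhds ht.1 ht.2)
    have h3 := this.deriv
    rw [← h3]
    congr 1
    funext s
    simp only [hf, Function.comp_apply, ← hxe]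
  have ho := (hasFDerivWithinAt_iff_isLittleO.1 hd).def hη
  have hcont : Tendsto (fun q : Junction N × ℝ => (q.1.abs, q.2)) (𝓝 (x, t)) (𝓝 (x.abs, t)) :=
    ((continuous_abs'.comp continuous_fst).prodMk continuous_snd).tendsto (x, t)
  have hT : ∀ᶠ q : Junction N × ℝ in 𝓝 (x, t), q.2 ∈ Ioo 0 T :=
    continuous_snd.continuousAt.preimage_mem_nhds (Ioo_mem_nhds ht.1 ht.2)
  filter_upwards [hcont.eventually (eventually_nhdsWithin_iff.1 ho), hT] with q hq hqT hqe
  have hq' := hq ⟨q.1.abs_nn, hqT⟩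
  have hqe' := mem_edge_iff.1 hqe
  have e1 : L ((q.1.abs, q.2) - (x.abs, t)) = Dx φ i x.abs t * (q.1.abs - x.abs) +
      deriv (fun s => φ x s) t * (q.2 - t) := by
    have : ((q.1.abs, q.2) - (x.abs, t) : ℝ × ℝ) =
        (q.1.abs - x.abs) • ((1 : ℝ), (0 : ℝ)) + (q.2 - t) • ((0 : ℝ), (1 : ℝ)) := by
      ext <;> simp
    rw [this, map_add, map_smul, map_smul, h1, h2]
    simp only [smul_eq_mul]; ring
  rw [e1] at hq'
  simp only [hf, ← hqe', ← hxe] at hq'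
  have hdist : dist q.1 x = |q.1.abs - x.abs| := by
    conv_lhs => rw [hqe', hxe]
    exact dist_pt i q.1.abs_nn x.abs_nn
  rw [← Real.norm_eq_abs]
  refine hq'.trans (mul_le_mul_of_nonneg_left ?_ hη.le)
  rw [hdist]
  refine max_le ?_ ?_
  · simp only [Prod.fst_sub, Real.norm_eq_abs]; linarith [abs_nonneg (q.2 - t)]
  · simp only [Prod.snd_sub, Real.norm_eq_abs]; linarith [abs_nonneg (q.1.abs - x.abs)]

/-- Divide by `s`, let `s` tend to `0`, then `η`; the proof runs this by contradiction with one
explicit `η`. -/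
theorem nonneg_of_first_order {c : ℝ → ℝ} (hc : Continuous c) {t A B : ℝ} (hB : 0 ≤ B)
    (H : ∀ η > 0, ∀ᶠ s in 𝓝[>] (0 : ℝ), 0 ≤ (∫ τ in t..t + s, c τ) + s * A + η * s * B) :
    0 ≤ c t + A := by
  by_contra! hneg
  set κ := -(c t + A) with hκ
  have hκ0 : 0 < κ := by linarith
  set η := κ / (2 * (B + 1)) with hη
  have hη0 : 0 < η := by positivity
  have hηB : η * (B + 1) = κ / 2 := by rw [hη]; field_simp
  obtain ⟨ρ, hρ, hcρ⟩ := Metric.continuous_iff.1 hc t η hη0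
  obtain ⟨s, hs, hs0, hsρ⟩ := ((H η hη0).and (Ioo_mem_nhdsGT hρ)).exists
  have hint : (∫ τ in t..t + s, c τ) ≤ s * (c t + η) := by
    have e : s * (c t + η) = ∫ _ in t..t + s, (c t + η) := by
      rw [intervalIntegral.integral_const]; simp
    rw [e]
    refine intervalIntegral.integral_mono_on (by linarith) (hc.intervalIntegrable _ _)
      intervalIntegrable_const fun τ hτ => ?_
    have := hcρ τ (by rw [Real.dist_eq, abs_of_nonneg (by linarith [hτ.1])]; linarith [hτ.2])
    rw [Real.dist_eq] at this
    linarith [(abs_lt.1 this).2]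
  have : s * (c t + A + η * (B + 1)) < 0 := mul_neg_of_pos_of_neg hs0 (by linarith)
  nlinarith

/-- Since `F 0 ≥ κ`, convexity bounds every slope from a left point to `(0, κ)` by every slope from
`(0, κ)` to a right point. The supremum of the left slopes separates them, and the lower bound on
the right allows replacing it by its maximum with `0`. -/
theorem exists_supporting_slope {F : ℝ → ℝ} (hF : ConvexOn ℝ univ F) {κ : ℝ}
    (h : ∀ ζ, 0 ≤ ζ → κ ≤ F ζ) : ∃ s, 0 ≤ s ∧ ∀ ζ, κ + s * ζ ≤ F ζ := by
  set S : Set ℝ := {r | ∃ ζ < 0, r = (κ - F ζ) / (-ζ)} with hS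
  have key : ∀ ζ < 0, ∀ ζ' > 0, (κ - F ζ) / (-ζ) ≤ (F ζ' - κ) / ζ' := by
    intro ζ hζ ζ' hζ'
    have hd : 0 < ζ' - ζ := by linarith
    have hc := hF.2 (mem_univ ζ) (mem_univ ζ')
      (show 0 ≤ ζ' / (ζ' - ζ) from div_nonneg hζ'.le hd.le)
      (show 0 ≤ -ζ / (ζ' - ζ) from div_nonneg (by linarith) hd.le) (by field_simp; ring)
    have e : (ζ' / (ζ' - ζ)) • ζ + (-ζ / (ζ' - ζ)) • ζ' = 0 := by
      simp only [smul_eq_mul]; field_simp; ring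
    rw [e] at hc
    have h0 := (h 0 le_rfl).trans hc
    simp only [smul_eq_mul] at h0
    have h1 : κ * (ζ' - ζ) ≤ ζ' * F ζ + -ζ * F ζ' := by
      have := mul_le_mul_of_nonneg_right h0 hd.le
      have e2 : (ζ' / (ζ' - ζ) * F ζ + -ζ / (ζ' - ζ) * F ζ') * (ζ' - ζ) =
        ζ' * F ζ + -ζ * F ζ' := by field_simp
      linarith
    rw [div_le_div_iff₀ (by linarith) hζ']
    nlinarith
  have hbdd : BddAbove S := ⟨(F 1 - κ) / 1, by rintro _ ⟨ζ, hζ, rfl⟩; exact key ζ hζ 1 one_pos⟩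
  refine ⟨max 0 (sSup S), le_max_left _ _, fun ζ => ?_⟩
  rcases lt_trichotomy ζ 0 with hζ | hζ | hζ
  · have h1 : (κ - F ζ) / (-ζ) ≤ max 0 (sSup S) :=
      (le_csSup hbdd ⟨ζ, hζ, rfl⟩).trans (le_max_right _ _)
    rw [div_le_iff₀ (by linarith)] at h1
    linarith
  · rw [hζ]; linarith [h 0 le_rfl]
  · have h1 : max 0 (sSup S) ≤ (F ζ - κ) / ζ := by
      refine max_le (div_nonneg (by linarith [h ζ hζ.le]) hζ.le) ?_
      refine csSup_le ⟨_, -1, by norm_num, rfl⟩ ?_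
      rintro _ ⟨ζ₁, hζ₁, rfl⟩
      exact key ζ₁ hζ₁ ζ hζ
    rw [le_div_iff₀ hζ] at h1
    linarith

theorem mem_edge_of_abs_eq_zero {x : Junction N} (hx : x.abs = 0) (i : Fin N) : x ∈ edge i :=
  mem_edge_iff.2 (by rw [hx]; exact eq_pt_zero hx i)

/-- A test function touching from below gives a first order minorant. -/
theorem IsC1.minorant {φ V : Junction N → ℝ → ℝ} (hφ : IsC1 T φ) {x : Junction N} {t : ℝ}
    (ht : t ∈ Ioo 0 T) (hφx : φ x t = V x t)
    (hφle : ∀ᶠ q : Junction N × ℝ in 𝓝 (x, t), φ q.1 q.2 ≤ V q.1 q.2) {q : Fin N → ℝ}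
    (hq : ∀ i, x ∈ edge i → q i = Dx φ i x.abs t ∨ (x.abs = 0 ∧ q i ≤ Dx φ i x.abs t)) :
    ∀ η > 0, ∀ᶠ w : Junction N × ℝ in 𝓝 (x, t),
      V x t + deriv (fun s => φ x s) t * (w.2 - t) + ∑ k, q k * (w.1.vec k - x.vec k) -
        η * (dist w.1 x + |w.2 - t|) ≤ V w.1 w.2 := by
  intro η hη
  have h1 : ∀ᶠ w : Junction N × ℝ in 𝓝 (x, t), ∀ i, x ∈ edge i → w.1 ∈ edge i →
      |φ w.1 w.2 - φ x t - (Dx φ i x.abs t * (w.1.abs - x.abs) +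
        deriv (fun s => φ x s) t * (w.2 - t))| ≤ η * (dist w.1 x + |w.2 - t|) := by
    refine eventually_all.2 fun i => ?_
    by_cases hi : x ∈ edge i
    · filter_upwards [hφ.expansion ht hη i hi] with w hw _ using hw
    · exact Eventually.of_forall fun w hi' => absurd hi' hi
  have h2 : ∀ᶠ w : Junction N × ℝ in 𝓝 (x, t), ∃ i, x ∈ edge i ∧ w.1 ∈ edge i := by
    rcases abs_vec_pos_cases x with h0 | ⟨j, hj⟩
    · refine Eventually.of_forall fun w => ?_
      obtain ⟨i, hi⟩ := exists_eq_pt w.1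
      exact ⟨i, mem_edge_of_abs_eq_zero h0 i, mem_edge_iff.2 hi⟩
    · filter_upwards [continuous_fst.continuousAt.preimage_mem_nhds
          ((isOpen_edge_diff j).mem_nhds hj)] with w hw
      have hw' : w.1 ∈ edge j \ vertex := hw
      exact ⟨j, hj.1, hw'.1⟩
  filter_upwards [hφle, h1, h2] with w hw0 hw1 ⟨i, hxi, hwi⟩
  have h3 := (abs_le.1 (hw1 i hxi hwi)).1
  have hsum : ∑ k, q k * (w.1.vec k - x.vec k) = q i * (w.1.abs - x.abs) := by
    rw [Finset.sum_eq_single i, coord_eq_abs hwi, coord_eq_abs hxi]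
    · intro k _ hk
      have hz : ∀ z : Junction N, z ∈ edge i → z.vec k = 0 := fun z hz => by
        rw [mem_edge_iff.1 hz, pt_vec i z.abs_nn]; simp [hk]
      rw [hz _ hwi, hz _ hxi, sub_self, mul_zero]
    · simp
  -- At the vertex the increment of the norm is nonnegative, so a smaller slope only lowers the
  -- minorant.
  have h4 : q i * (w.1.abs - x.abs) ≤ Dx φ i x.abs t * (w.1.abs - x.abs) := by
    rcases hq i hxi with e | ⟨e0, e⟩
    · rw [e]
    · exact mul_le_mul_of_nonneg_right e (by rw [e0, sub_zero]; exact w.1.abs_nn)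
  rw [hsum]
  linarith

end FirstOrder

/-! ### The two viscosity inequalities for a tame Lagrangian -/

section Viscosity

variable {N : ℕ} {p C₀ T M : ℝ} {Λ : Lagr N} {g : Junction N → ℝ}

/-- Robustness of a strict lower bound of the Lagrangian of an edge. -/
theorem Lagr.Tame.eventually_edge_lower (h : Λ.Tame p C₀) (hp : 1 < p) (i : Fin N)
    {t r q c κ : ℝ} (hκ : 0 < κ) (hlow : ∀ ζ, κ ≤ Λ.edgeCost i t r ζ + q * ζ + c) :
    ∀ᶠ η in 𝓝[>] (0 : ℝ), ∀ᶠ w : ℝ × ℝ in 𝓝 (t, r), 0 ≤ w.2 →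
      ∀ ζ, κ / 2 ≤ Λ.edgeCost i w.1 w.2 ζ + q * ζ + c - η * |ζ| - η := by
  -- Of the two extra units of slope, one absorbs `η |ζ|` and the other beats the constants once
  -- `|ζ| > B`. Smaller velocities form a compact set, where continuity suffices.
  obtain ⟨K, hK, hl⟩ := exists_linear_le_pow hp h.pos (|q| + 2)
  set B := K + |c| + 1 + κ with hB
  have hB0 : 0 < B := by positivity
  filter_upwards [Ioo_mem_nhdsGT (lt_min one_pos (show 0 < κ / (4 * (B + 1)) by positivity))]
    with η hη
  have hη0 : 0 < η := hη.1
  have hη1 : η ≤ 1 := hη.2.le.trans (min_le_left _ _)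
  have hηB : η * (B + 1) ≤ κ / 4 := by
    have := hη.2.le.trans (min_le_right _ _)
    rw [le_div_iff₀ (by positivity)] at this
    linarith
  have hcomp : ∀ᶠ w : ℝ × ℝ in 𝓝 (t, r), ∀ ζ ∈ Icc (-B) B,
      3 * κ / 4 < Λ.edgeCost i w.1 w.2 ζ + q * ζ + c := by
    refine isCompact_Icc.eventually_forall_of_forall_eventually fun ζ _ => ?_
    have hcont : Continuous fun z : (ℝ × ℝ) × ℝ =>
        Λ.edgeCost i z.1.1 z.1.2 z.2 + q * z.2 + c := by
      have := (h.cont i).comp (g := fun q : ℝ × ℝ × ℝ => Λ.edgeCost i q.1 q.2.1 q.2.2)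
        (f := fun z : (ℝ × ℝ) × ℝ => (z.1.1, z.1.2, z.2)) (by fun_prop)
      exact (this.add (by fun_prop)).add continuous_const
    exact hcont.continuousAt.eventually_const_lt (by
      change 3 * κ / 4 < Λ.edgeCost i t r ζ + q * ζ + c
      linarith [hlow ζ])
  filter_upwards [hcomp] with w hw hw0 ζ
  have hζ0 := abs_nonneg ζ
  by_cases hζ : |ζ| ≤ B
  · have h1 := hw ζ (abs_le.1 hζ)
    have h2 : η * |ζ| ≤ η * B := mul_le_mul_of_nonneg_left hζ hη0.le
    linarith
  · have h1 := h.coercive i w.1 w.2 ζ hw0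
    have h2 := hl ζ
    have h3 : -(|q| * |ζ|) ≤ q * ζ := by rw [← abs_mul]; exact neg_abs_le _
    have h4 : η * |ζ| ≤ 1 * |ζ| := mul_le_mul_of_nonneg_right hη1 hζ0
    have h5 := neg_abs_le c
    have h6 := not_le.1 hζ
    linarith

/-- Robustness of a strict lower bound of the running cost near a point. -/
theorem Lagr.Tame.eventually_run_lower (h : Λ.Tame p C₀) (hp : 1 < p)
    {x : Junction N} {t : ℝ} {q : Fin N → ℝ} {c κ : ℝ} (hκ : 0 < κ)
    (hedge : ∀ i, x ∈ edge i → ∀ ζ, κ ≤ Λ.edgeCost i t x.abs ζ + q i * ζ + c)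
    (hvertex : x.abs = 0 → κ ≤ Λ.vertexCost t + c) :
    ∃ η > 0, ∀ᶠ w : Junction N × ℝ in 𝓝 (x, t), ∀ v : ℝ, (w.1.abs = 0 → v = 0) →
      κ / 2 ≤ Λ.run w.2 w.1 v + c + ∑ k, q k * (edge k \ vertex).indicator (fun _ => v) w.1 -
        η * |v| - η := by
  have hη : ∀ᶠ η in 𝓝[>] (0 : ℝ), η < κ / 4 ∧ ∀ i, x ∈ edge i →
      ∀ᶠ w : ℝ × ℝ in 𝓝 (t, x.abs), 0 ≤ w.2 →
        ∀ ζ, κ / 2 ≤ Λ.edgeCost i w.1 w.2 ζ + q i * ζ + c - η * |ζ| - η := by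
    refine (Eventually.filter_mono nhdsWithin_le_nhds (Iio_mem_nhds (by linarith))).and
      (eventually_all.2 fun i => ?_)
    by_cases hi : x ∈ edge i
    · filter_upwards [h.eventually_edge_lower hp i hκ (hedge i hi)] with η hη _ using hη
    · exact Eventually.of_forall fun η hi' => absurd hi' hi
  obtain ⟨η, ⟨hηκ, hηe⟩, hη0⟩ := (hη.and self_mem_nhdsWithin).exists
  have hη0 : 0 < η := hη0
  refine ⟨η, hη0, ?_⟩
  have hcont : Tendsto (fun w : Junction N × ℝ => (w.2, w.1.abs)) (𝓝 (x, t)) (𝓝 (t, x.abs)) :=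
    (continuous_snd.prodMk (continuous_abs'.comp continuous_fst)).tendsto (x, t)
  have h1 : ∀ᶠ w : Junction N × ℝ in 𝓝 (x, t), ∀ i, x ∈ edge i → 0 ≤ w.1.abs →
      ∀ ζ, κ / 2 ≤ Λ.edgeCost i w.2 w.1.abs ζ + q i * ζ + c - η * |ζ| - η := by
    refine eventually_all.2 fun i => ?_
    by_cases hi : x ∈ edge i
    · filter_upwards [hcont.eventually (hηe i hi)] with w hw _ using hw
    · exact Eventually.of_forall fun w hi' => absurd hi' hi
  -- Only edges containing `x` are visited near `x`, so the hypothesis on those edges is enough.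
  have h2 : ∀ᶠ w : Junction N × ℝ in 𝓝 (x, t), ∀ i, w.1 ∈ edge i \ vertex → x ∈ edge i := by
    rcases abs_vec_pos_cases x with h0 | ⟨j, hj⟩
    · exact Eventually.of_forall fun w i _ => mem_edge_of_abs_eq_zero h0 i
    · filter_upwards [continuous_fst.continuousAt.preimage_mem_nhds
        ((isOpen_edge_diff j).mem_nhds hj)] with w hw i hi
      have hw' : w.1 ∈ edge j \ vertex := hw
      rw [mem_edge_iff.1 hi.1, pt_mem_edge_diff w.1.abs_nn] at hw'
      rw [hw'.1]; exact hj.1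
  have h3 : ∀ᶠ w : Junction N × ℝ in 𝓝 (x, t), w.1.abs = 0 →
      3 * κ / 4 ≤ Λ.vertexCost w.2 + c := by
    rcases x.abs_nn.eq_or_lt with h0 | h0
    · have hcv : Continuous fun w : Junction N × ℝ => Λ.vertexCost w.2 + c :=
        (h.cont_vertex.comp continuous_snd).add continuous_const
      have hca : ContinuousAt (fun w : Junction N × ℝ => Λ.vertexCost w.2 + c) (x, t) :=
        hcv.continuousAt
      filter_upwards [hca.eventually_const_lt
        (show 3 * κ / 4 < Λ.vertexCost t + c by linarith [hvertex h0.symm])] with w hw _ using hw.le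
    · have hca : ContinuousAt (fun w : Junction N × ℝ => w.1.abs) (x, t) :=
        (continuous_abs'.comp continuous_fst).continuousAt
      filter_upwards [hca.eventually_const_lt h0] with w hw hw0
      exact absurd hw0 (ne_of_gt hw)
  filter_upwards [h1, h2, h3] with w hw1 hw2 hw3 v hv
  rcases abs_vec_pos_cases w.1 with h0 | ⟨i, hi⟩
  · rw [Lagr.run_vertex h0, hv h0]
    have : ∑ k, q k * (edge k \ vertex).indicator (fun _ => (0 : ℝ)) w.1 = 0 := by simp
    rw [this, abs_zero]
    linarith [hw3 h0]
  · rw [Lagr.run_of_mem hi, Finset.sum_eq_single i, indicator_of_mem hi]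
    · linarith [hw1 i (hw2 i hi) w.1.abs_nn v]
    · intro k _ hk
      rw [indicator_of_notMem, mul_zero]
      intro hk'
      rw [mem_edge_iff.1 hi.1, pt_mem_edge_diff w.1.abs_nn] at hk'
      exact hk hk'.1.symm
    · simp

variable [NeZero N]

/-- The subsolution inequality for a motion inside an edge with constant speed. -/
theorem Lagr.Tame.subsolution_edge (h : Λ.Tame p C₀) (hp : 1 < p) (hg : ∀ x, |g x| ≤ M)
    {φ : Junction N → ℝ → ℝ} (hφ : IsC1 T φ) {x : Junction N} {t : ℝ} (ht : t ∈ Ioo 0 T)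
    (hφx : φ x t = Λ.value p T g x t)
    (hφle : ∀ᶠ q : Junction N × ℝ in 𝓝 (x, t), Λ.value p T g q.1 q.2 ≤ φ q.1 q.2)
    {i : Fin N} (hx : x ∈ edge i) {ζ : ℝ} (hζ : 0 < x.abs ∨ 0 ≤ ζ) :
    0 ≤ Λ.edgeCost i t x.abs ζ + (Dx φ i x.abs t * ζ + deriv (fun s => φ x s) t) := by
  have hc : Continuous fun τ => Λ.edgeCost i τ (x.abs + ζ * (τ - t)) ζ :=
    (h.cont i).comp (g := fun q : ℝ × ℝ × ℝ => Λ.edgeCost i q.1 q.2.1 q.2.2)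
      (f := fun τ : ℝ => (τ, x.abs + ζ * (τ - t), ζ)) (by fun_prop)
  have hxe := mem_edge_iff.1 hx
  have key := nonneg_of_first_order hc (t := t)
    (A := Dx φ i x.abs t * ζ + deriv (fun s => φ x s) t) (B := |ζ| + 1) (by positivity) ?_
  · simpa using key
  intro η hη
  -- The segment stays in the edge for a short time: either there is room on both sides, or the
  -- motion is outgoing.
  have hz0 : ∀ᶠ s in 𝓝[>] (0 : ℝ), ∀ σ ∈ Icc t (t + s), 0 ≤ x.abs + ζ * (σ - t) := by
    rcases hζ with hpos | hζ0
    · have hδ : 0 < x.abs / (|ζ| + 1) := by positivity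
      filter_upwards [Ioo_mem_nhdsGT hδ] with s hs σ hσ
      have h1 : |ζ * (σ - t)| ≤ (|ζ| + 1) * s := by
        rw [abs_mul, abs_of_nonneg (by linarith [hσ.1] : 0 ≤ σ - t)]
        exact mul_le_mul (by linarith) (by linarith [hσ.2]) (by linarith [hσ.1]) (by positivity)
      have h2 := (lt_div_iff₀ (by positivity)).1 hs.2
      linarith [(abs_le.1 h1).1]
    · exact Eventually.of_forall fun s σ hσ =>
        add_nonneg x.abs_nn (mul_nonneg hζ0 (by linarith [hσ.1]))
  set m : ℝ → Junction N × ℝ := fun s => (pt i (x.abs + ζ * s), t + s) with hm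
  have hmt : Tendsto m (𝓝[>] 0) (𝓝 (x, t)) := by
    have hmc : Continuous m := ((continuous_pt i).comp (by fun_prop)).prodMk (by fun_prop)
    have h0 : m 0 = (x, t) := by simp [hm, ← hxe]
    rw [← h0]
    exact hmc.continuousAt.mono_left nhdsWithin_le_nhds
  filter_upwards [hz0, hmt.eventually hφle, hmt.eventually (hφ.expansion ht hη i hx),
    Ioo_mem_nhdsGT (show 0 < T - t by linarith [ht.2]), self_mem_nhdsWithin] with s hs0 hs1 hs2 hsT hs
  have hs' : 0 < s := hs
  have hts : t ≤ t + s := by linarith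
  have hend : 0 ≤ x.abs + ζ * s := by simpa using hs0 (t + s) ⟨hts, le_rfl⟩
  have h1 := h.value_le_cost_add (g := g) hp hg hts
    (show t + s ≤ T by linarith [hsT.2])
    (admOn_segment i hts hs0)
  have h2 := h.cost_segment_le hp i hts hs0
  simp only [sub_self, mul_zero, add_zero, add_sub_cancel_left, ← hxe] at h1
  have h3 := hs2 (mem_edge_iff.2 (by rw [pt_abs i hend]))
  simp only [hm, pt_abs i hend, add_sub_cancel_left] at h3 hs1
  have hd : dist (pt i (x.abs + ζ * s)) x = |ζ| * s := by
    conv_lhs => rw [hxe]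
    rw [pt_abs i x.abs_nn, dist_pt i hend x.abs_nn, add_sub_cancel_left, abs_mul, abs_of_pos hs']
  rw [hd, abs_of_pos hs'] at h3
  have h4 := (abs_le.1 h3).2
  rw [hφx] at h4
  linarith

/-- The subsolution inequality for staying at the vertex. -/
theorem Lagr.Tame.subsolution_vertex (h : Λ.Tame p C₀) (hp : 1 < p) (hg : ∀ x, |g x| ≤ M)
    {φ : Junction N → ℝ → ℝ} (hφ : IsC1 T φ) {x : Junction N} {t : ℝ} (ht : t ∈ Ioo 0 T)
    (hφx : φ x t = Λ.value p T g x t)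
    (hφle : ∀ᶠ q : Junction N × ℝ in 𝓝 (x, t), Λ.value p T g q.1 q.2 ≤ φ q.1 q.2)
    (hx : x.abs = 0) : 0 ≤ Λ.vertexCost t + deriv (fun s => φ x s) t := by
  refine nonneg_of_first_order h.cont_vertex (B := 1) zero_le_one ?_
  intro η hη
  set m : ℝ → Junction N × ℝ := fun s => (x, t + s) with hm
  have hmt : Tendsto m (𝓝[>] 0) (𝓝 (x, t)) := by
    have hmc : Continuous m := by fun_prop
    have h0 : m 0 = (x, t) := by simp [hm]
    rw [← h0]
    exact hmc.continuousAt.mono_left nhdsWithin_le_nhds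
  have hxe : x ∈ edge (0 : Fin N) := mem_edge_of_abs_eq_zero hx 0
  filter_upwards [hmt.eventually hφle, hmt.eventually (hφ.expansion ht hη 0 hxe),
    Ioo_mem_nhdsGT (show 0 < T - t by linarith [ht.2]), self_mem_nhdsWithin] with s hs1 hs2 hsT hs
  have hs' : 0 < s := hs
  have hts : t ≤ t + s := by linarith
  have h1 := h.value_le_cost_add (g := g) hp hg hts
    (show t + s ≤ T by linarith [hsT.2]) (admOn_const hts x)
  have h2 : Λ.cost t (t + s) (fun _ => x) = ∫ τ in t..t + s, Λ.vertexCost τ :=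
    intervalIntegral.integral_congr fun τ _ => Lagr.run_vertex hx _ _
  have h3 := hs2 hxe
  simp only [hm, sub_self, mul_zero, dist_self, zero_add, add_sub_cancel_left,
    abs_of_pos hs'] at h3 hs1
  have h4 := (abs_le.1 h3).2
  rw [hφx] at h4
  linarith

/-- A strict supersolution inequality is incompatible with the dynamic programming principle. -/
theorem Lagr.Tame.not_strict_minorant (h : Λ.Tame p C₀) (hp : 1 < p) (hg : ∀ x, |g x| ≤ M)
    {x : Junction N} {t : ℝ} (ht : t ∈ Ioo 0 T) {q : Fin N → ℝ} {c κ : ℝ} (hκ : 0 < κ)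
    (hedge : ∀ i, x ∈ edge i → ∀ ζ, κ ≤ Λ.edgeCost i t x.abs ζ + q i * ζ + c)
    (hvertex : x.abs = 0 → κ ≤ Λ.vertexCost t + c)
    (hmin : ∀ η > 0, ∀ᶠ w : Junction N × ℝ in 𝓝 (x, t),
      Λ.value p T g x t + c * (w.2 - t) + ∑ k, q k * (w.1.vec k - x.vec k) -
        η * (dist w.1 x + |w.2 - t|) ≤ Λ.value p T g w.1 w.2) : False := by
  obtain ⟨η, hη0, hnear⟩ := h.eventually_run_lower hp hκ hedge hvertex
  obtain ⟨ρ, hρ, hball⟩ := Metric.eventually_nhds_iff.1 (hnear.and (hmin η hη0))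
  have htT := ht.2
  have hC := h.pos
  have hM : 0 ≤ M := (abs_nonneg _).trans (hg x)
  have hvlow : ∀ s ∈ Icc t T, ∀ z, -(C₀ * T + M) ≤ Λ.value p T g z s := by
    intro s hs z
    refine Λ.le_value hs.2 fun y hy hyt => ?_
    have h1 := h.neg_le_cost hp hs.2 hy
    have h2 := (abs_le.1 (hg (y T))).1
    have h3 : C₀ * (T - s) ≤ C₀ * T :=
      mul_le_mul_of_nonneg_left (by linarith [hs.1, ht.1]) hC.le
    linarith
  have hT0 : 0 < T := ht.1.trans ht.2
  set B := |Λ.value p T g x t| + 1 + C₀ * T + M with hB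
  have hB0 : 0 < B := by positivity
  -- With this slope, leaving the ball of radius `ρ` during the short time `a` would cost more than
  -- the possible variation of the value allows.
  obtain ⟨K, hK, hlen⟩ := h.length_le_cost hp (2 * B / ρ)
  obtain ⟨a, ha0, ha⟩ : ∃ a, 0 < a ∧ a < min (min ρ (T - t)) (min (B / (K + 1)) (1 / κ)) :=
    exists_between (lt_min (lt_min hρ (by linarith)) (lt_min (by positivity) (by positivity)))
  have haρ : a < ρ := ha.trans_le ((min_le_left _ _).trans (min_le_left _ _))
  have haT : a < T - t := ha.trans_le ((min_le_left _ _).trans (min_le_right _ _))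
  have haB : K * a < B := by
    have := ha.trans_le ((min_le_right _ _).trans (min_le_left _ _))
    rw [lt_div_iff₀ (by positivity)] at this
    linarith
  have haκ : κ * a < 1 := by
    have := ha.trans_le ((min_le_right _ _).trans (min_le_right _ _))
    rw [lt_div_iff₀ hκ] at this
    linarith
  -- The defect `κ a / 4` is smaller than the gain `κ a / 2` that integration of the strict
  -- inequality yields in `hint`.
  obtain ⟨y, hy, hyt, hlt⟩ := Λ.exists_lt_value (p := p) (g := g) htT.le x
    (show 0 < κ * a / 4 by positivity)
  have hsub : ∀ s ∈ Icc t (t + a), dist (y s) x < ρ := by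
    intro s hs
    have hsT : s ≤ T := by linarith [hs.2]
    have hys := hy.mono hp le_rfl hs.1 hsT
    have h1 := hlen t s y hs.1 hys
    have h2 := h.cost_add_value_le (g := g) hp hg hs.1 hsT hy
    have h3 := hvlow s ⟨hs.1, hsT⟩ (y s)
    have h4 := hys.dist_le hp hs.1
    rw [hyt, dist_comm] at h4
    have h5 : K * (s - t) ≤ K * a := mul_le_mul_of_nonneg_left (by linarith [hs.2]) hK
    have h6 : 2 * B / ρ * dist (y s) x ≤ 2 * B / ρ * ∫ τ in t..s, |vel y τ| :=
      mul_le_mul_of_nonneg_left h4 (by positivity)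
    have h7 : 2 * B / ρ * dist (y s) x < 2 * B := by
      linarith [le_abs_self (Λ.value p T g x t)]
    rw [div_mul_eq_mul_div, div_lt_iff₀ hρ] at h7
    exact lt_of_mul_lt_mul_left h7 (by positivity)
  have hta : t ≤ t + a := by linarith
  have htaT : t + a ≤ T := by linarith
  have hya := hy.mono hp le_rfl hta htaT
  have hin : ∀ s ∈ Icc t (t + a), dist (y s, s) (x, t) < ρ := fun s hs => by
    refine max_lt (hsub s hs) ?_
    rw [Real.dist_eq, abs_of_nonneg (by linarith [hs.1])]; linarith [hs.2]
  have hend := (hball (hin (t + a) ⟨hta, le_rfl⟩)).2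
  have h2 := h.cost_add_value_le (g := g) hp hg hta htaT hy
  have h4 := hya.dist_le hp hta
  rw [hyt, dist_comm] at h4
  have hsum : ∑ k, q k * ((y (t + a)).vec k - x.vec k) =
      ∫ τ in t..t + a, ∑ k, q k * {τ | y τ ∈ edge k \ vertex}.indicator (vel y) τ := by
    rw [intervalIntegral.integral_finsetSum fun k _ =>
      (hya.indicator_integrable hp hta k).const_mul (q k)]
    refine Finset.sum_congr rfl fun k _ => ?_
    rw [intervalIntegral.integral_const_mul, ← hya.coord_eq hp hta k, hyt]
  have hi1 := h.run_integrable hp hta hya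
  have hi2 : IntervalIntegrable
      (fun τ => ∑ k, q k * {τ | y τ ∈ edge k \ vertex}.indicator (vel y) τ) volume t (t + a) := by
    simpa only [Finset.sum_fn] using IntervalIntegrable.sum Finset.univ
      fun k _ => (hya.indicator_integrable hp hta k).const_mul (q k)
  have hi3 := (hya.vel_integrable hp hta).abs.const_mul η
  have hint : κ / 2 * a ≤ Λ.cost t (t + a) y + c * a +
      (∑ k, q k * ((y (t + a)).vec k - x.vec k)) - η * (∫ τ in t..t + a, |vel y τ|) - η * a := by
    have e1 : κ / 2 * a = ∫ _ in t..t + a, κ / 2 := by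
      rw [intervalIntegral.integral_const]; simp; ring
    have e2 : Λ.cost t (t + a) y + c * a +
        (∑ k, q k * ((y (t + a)).vec k - x.vec k)) - η * (∫ τ in t..t + a, |vel y τ|) - η * a =
        ∫ τ in t..t + a, (Λ.run τ (y τ) (vel y τ) + c +
          ∑ k, q k * {τ | y τ ∈ edge k \ vertex}.indicator (vel y) τ - η * |vel y τ| - η) := by
      rw [intervalIntegral.integral_sub (((hi1.add intervalIntegrable_const).add hi2).sub hi3)
        intervalIntegrable_const,
        intervalIntegral.integral_sub ((hi1.add intervalIntegrable_const).add hi2) hi3,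
        intervalIntegral.integral_add (hi1.add intervalIntegrable_const) hi2,
        intervalIntegral.integral_add hi1 intervalIntegrable_const,
        intervalIntegral.integral_const, intervalIntegral.integral_const, hsum,
        intervalIntegral.integral_const_mul, Lagr.cost]
      simp; ring
    rw [e1, e2]
    refine intervalIntegral.integral_mono_on hta intervalIntegrable_const
      ((((hi1.add intervalIntegrable_const).add hi2).sub hi3).sub intervalIntegrable_const)
      fun τ hτ => ?_
    exact (hball (hin τ hτ)).1 (vel y τ) fun h0 => vel_eq_zero h0
  simp only [add_sub_cancel_left, abs_of_pos ha0] at hend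
  have h6 : η * dist (y (t + a)) x ≤ η * ∫ τ in t..t + a, |vel y τ| :=
    mul_le_mul_of_nonneg_left h4 hη0.le
  have : 0 < κ * a := by positivity
  linarith

end Viscosity

end JunctionMFG

/-! ### The Lagrangian of a mild solution -/

namespace JunctionMFG

open JunctionMFG.Junction (pt edge vertex)

section Marginals

variable {N : ℕ} {p T C : ℝ} {hT : 0 < T}

theorem toMeasure_marginal (μ : ProbabilityMeasure (GamC N p hT C)) (t : ℝ) :
    (marginal μ t).toMeasure = (μ : Measure (GamC N p hT C)).map (evalAt t) := by
  simp [marginal, P1.toMeasure, ProbabilityMeasure.toMeasure_map]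

/-- The pair of evaluations couples the two marginals, so their distance is at most the mean
displacement. That tends to zero by dominated convergence, all curves being bounded by `C`. -/
theorem tendsto_d1_marginal (μ : ProbabilityMeasure (GamC N p hT C)) {s : ℕ → ℝ} {t : ℝ}
    (hs : Tendsto s atTop (𝓝 t)) :
    Tendsto (fun n => d1 (marginal μ (s n)) (marginal μ t)) atTop (𝓝 0) := by
  have habs : ∀ (r : ℝ) (y : GamC N p hT C), (evalAt r y).abs ≤ C := fun r y => y.2.1 _
  have hdm : ∀ r, Continuous fun y : GamC N p hT C => dist (evalAt r y) (evalAt t y) := fun r =>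
    (continuous_evalAt r).dist (continuous_evalAt t)
  have hdb : ∀ r (y : GamC N p hT C), ‖dist (evalAt r y) (evalAt t y)‖ ≤ 2 * C := fun r y => by
    rw [Real.norm_of_nonneg dist_nonneg]
    linarith [dist_le_abs_add (evalAt r y) (evalAt t y), habs r y, habs t y]
  have hlim : Tendsto (fun n => ∫ y, dist (evalAt (s n) y) (evalAt t y)
      ∂(μ : Measure (GamC N p hT C))) atTop (𝓝 0) := by
    have h0 : (0 : ℝ) = ∫ y, (0 : ℝ) ∂(μ : Measure (GamC N p hT C)) := by simp
    rw [h0]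
    refine tendsto_integral_of_dominated_convergence (fun _ => 2 * C)
      (fun n => (hdm (s n)).measurable.aestronglyMeasurable) (integrable_const _)
      (fun n => ae_of_all _ (hdb (s n))) (ae_of_all _ fun y => ?_)
    rw [← dist_self (evalAt t y)]
    have hc : Continuous fun r => evalAt r y := y.1.continuous.comp continuous_projIcc
    exact ((hc.tendsto t).comp hs).dist tendsto_const_nhds
  have hle : ∀ n, ∀ f : Junction N → ℝ, LipschitzWith 1 f →
      ∫ x, f x ∂(marginal μ (s n)).toMeasure - ∫ x, f x ∂(marginal μ t).toMeasure ≤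
        ∫ y, dist (evalAt (s n) y) (evalAt t y) ∂(μ : Measure (GamC N p hT C)) := by
    intro n f hf
    have hi : ∀ r, Integrable (fun y : GamC N p hT C => f (evalAt r y))
        (μ : Measure (GamC N p hT C)) := by
      intro r
      have hne : Nonempty (GamC N p hT C) := (μ : Measure _).nonempty_of_neZero
      obtain ⟨y₀⟩ := hne
      refine Integrable.of_bound
        (hf.continuous.comp (continuous_evalAt r)).measurable.aestronglyMeasurable
        (|f (evalAt t y₀)| + 2 * C) (ae_of_all _ fun y => ?_)
      have h1 := hf.dist_le_mul (evalAt r y) (evalAt t y₀)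
      rw [Real.dist_eq, NNReal.coe_one, one_mul] at h1
      have h2 := dist_le_abs_add (evalAt r y) (evalAt t y₀)
      have h3 := abs_sub_abs_le_abs_sub (f (evalAt r y)) (f (evalAt t y₀))
      rw [Real.norm_eq_abs]
      linarith [habs r y, habs t y₀]
    have hmap : ∀ r, ∫ x, f x ∂(marginal μ r).toMeasure =
        ∫ y, f (evalAt r y) ∂(μ : Measure (GamC N p hT C)) := fun r => by
      rw [toMeasure_marginal]
      exact integral_map (continuous_evalAt r).measurable.aemeasurable
        hf.continuous.measurable.aestronglyMeasurable
    rw [hmap, hmap, ← integral_sub (hi _) (hi _)]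
    refine integral_mono ((hi _).sub (hi _)) (Integrable.of_bound
      (hdm (s n)).measurable.aestronglyMeasurable (2 * C) (ae_of_all _ (hdb (s n)))) fun y => ?_
    have h1 := hf.dist_le_mul (evalAt (s n) y) (evalAt t y)
    rw [Real.dist_eq, NNReal.coe_one, one_mul] at h1
    exact (le_abs_self _).trans h1
  refine squeeze_zero (fun n => ?_) (fun n => ?_) hlim
  · refine le_csSup ⟨∫ y, dist (evalAt (s n) y) (evalAt t y) ∂(μ : Measure (GamC N p hT C)), ?_⟩
      ⟨fun _ => 0, LipschitzWith.const 0 |>.weaken zero_le_one, by simp⟩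
    rintro r ⟨f, hf, rfl⟩
    exact hle n f hf
  · refine csSup_le ⟨0, fun _ => 0, LipschitzWith.const 0 |>.weaken zero_le_one, by simp⟩ ?_
    rintro r ⟨f, hf, rfl⟩
    exact hle n f hf

end Marginals

/-! ### From the costs of the game to a tame Lagrangian and an admissible terminal cost -/

namespace Costs

variable {N : ℕ} {p T : ℝ} {c : Costs N}

theorem HMFG1.lip_x (hreg : c.Regular) {r K : ℝ}
    (hK : ∀ i m, ∀ x ∈ Icc 0 r, ∀ a, |c.dxL i m x a| ≤ K * (|a| ^ p + 1)) (i : Fin N) (m : P1 N)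
    {x x' : ℝ} (hx : x ∈ Icc 0 r) (hx' : x' ∈ Icc 0 r) (a : ℝ) :
    |c.L i m x a - c.L i m x' a| ≤ K * (|a| ^ p + 1) * |x - x'| := by
  have hd : ∀ z ∈ Icc 0 r, HasDerivWithinAt (fun z => c.L i m z a) (c.dxL i m z a) (Icc 0 r) z := by
    intro z hz
    have h1 := (hreg.L_contDiff i m).differentiableOn one_ne_zero (z, a) ⟨hz.1, trivial⟩
    have h2 : HasDerivWithinAt (fun z : ℝ => (z, a)) ((1 : ℝ), (0 : ℝ)) (Ici 0) z :=
      ((hasDerivAt_id z).prodMk (hasDerivAt_const z a)).hasDerivWithinAt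
    have h3 := h1.hasFDerivWithinAt.comp_hasDerivWithinAt z h2
      (show MapsTo (fun z : ℝ => (z, a)) (Ici 0) (Ici (0 : ℝ) ×ˢ (univ : Set ℝ)) from
        fun z hz => ⟨hz, trivial⟩)
    exact h3.differentiableWithinAt.hasDerivWithinAt.mono Icc_subset_Ici_self
  exact (convex_Icc 0 r).norm_image_sub_le_of_norm_hasDerivWithin_le hd
    (fun z hz => hK i m z hz a) hx' hx

theorem HMFG1.lip_a (hreg : c.Regular) (hp : 1 < p) {r K : ℝ} (hK0 : 0 ≤ K)
    (hK : ∀ i m, ∀ x ∈ Icc 0 r, ∀ a, |c.daL i m x a| ≤ K * (|a| ^ (p - 1) + 1)) (i : Fin N)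
    (m : P1 N) {x : ℝ} (hx : x ∈ Icc 0 r) {a a' B : ℝ} (ha : |a| ≤ B) (ha' : |a'| ≤ B) :
    |c.L i m x a - c.L i m x a'| ≤ K * (B ^ (p - 1) + 1) * |a - a'| := by
  have hd : ∀ z ∈ Icc (-B) B,
      HasDerivWithinAt (fun z => c.L i m x z) (c.daL i m x z) (Icc (-B) B) z := by
    intro z _
    have h1 := (hreg.L_contDiff i m).differentiableOn one_ne_zero (x, z) ⟨hx.1, trivial⟩
    have h2 : HasDerivWithinAt (fun z : ℝ => (x, z)) ((0 : ℝ), (1 : ℝ)) univ z :=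
      ((hasDerivAt_const z x).prodMk (hasDerivAt_id z)).hasDerivWithinAt
    have h3 := h1.hasFDerivWithinAt.comp_hasDerivWithinAt z h2
      (show MapsTo (fun z : ℝ => (x, z)) univ (Ici (0 : ℝ) ×ˢ (univ : Set ℝ)) from
        fun z _ => ⟨hx.1, trivial⟩)
    exact (hasDerivWithinAt_univ.1 h3).differentiableAt.hasDerivAt.hasDerivWithinAt
  refine (convex_Icc (-B) B).norm_image_sub_le_of_norm_hasDerivWithin_le hd
    (fun z hz => (hK i m x hx z).trans ?_) (abs_le.1 ha') (abs_le.1 ha)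
  have := Real.rpow_le_rpow (abs_nonneg z) (abs_le.2 hz) (show 0 ≤ p - 1 by linarith)
  exact mul_le_mul_of_nonneg_left (by linarith) hK0

/-- Truncation of the time to `[0, T]`. -/
noncomputable def clamp (T τ : ℝ) : ℝ := max 0 (min T τ)

theorem clamp_mem (hT : 0 ≤ T) (τ : ℝ) : clamp T τ ∈ Icc 0 T :=
  ⟨le_max_left _ _, max_le hT (min_le_left _ _)⟩

theorem clamp_of_mem {τ : ℝ} (hτ : τ ∈ Icc 0 T) : clamp T τ = τ := by
  rw [clamp, min_eq_right hτ.2, max_eq_right hτ.1]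

/-- The Lagrangian associated with the costs and a flow of measures. -/
noncomputable def lagr (c : Costs N) (T : ℝ) (m : ℝ → P1 N) : Lagr N :=
  ⟨fun i τ x a => c.L i (m (clamp T τ)) (max x 0) a, fun τ => c.L0 (m (clamp T τ))⟩

variable {m : ℝ → P1 N}

/-- Uniform convergence on the compact set formed by a sequence of points and its limit handles the
measure; continuity of the limiting cost handles the points. -/
theorem continuous_lagr (hreg : c.Regular) (hm : ∀ (s : ℕ → ℝ) (t : ℝ), Tendsto s atTop (𝓝 t) →
    Tendsto (fun n => d1 (m (clamp T (s n))) (m (clamp T t))) atTop (𝓝 0)) (i : Fin N) :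
    Continuous fun q : ℝ × ℝ × ℝ => (c.lagr T m).edgeCost i q.1 q.2.1 q.2.2 := by
  rw [continuous_iff_seqContinuous]
  intro q q₀ hq
  set z : ℕ → ℝ × ℝ := fun n => (max (q n).2.1 0, (q n).2.2) with hz
  set z₀ : ℝ × ℝ := (max q₀.2.1 0, q₀.2.2) with hz₀
  have hzt : Tendsto z atTop (𝓝 z₀) := by
    have hc : Continuous fun q : ℝ × ℝ × ℝ => (max q.2.1 0, q.2.2) := by fun_prop
    exact (hc.tendsto q₀).comp hq
  have hmem : ∀ n, z n ∈ Ici (0 : ℝ) ×ˢ (univ : Set ℝ) := fun n =>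
    ⟨show (0 : ℝ) ≤ max (q n).2.1 0 from le_max_right _ _, trivial⟩
  have hmem₀ : z₀ ∈ Ici (0 : ℝ) ×ˢ (univ : Set ℝ) :=
    ⟨show (0 : ℝ) ≤ max q₀.2.1 0 from le_max_right _ _, trivial⟩
  have hτ := hm (fun n => (q n).1) q₀.1 ((continuous_fst.tendsto q₀).comp hq)
  have hu := (hreg.L_cont i (fun n => m (clamp T (q n).1)) (m (clamp T q₀.1)) hτ _
    hzt.isCompact_insert_range (insert_subset hmem₀ (range_subset_iff.2 hmem))).1
  have h1 : Tendsto (fun n => c.L i (m (clamp T q₀.1)) (z n).1 (z n).2) atTop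
      (𝓝 (c.L i (m (clamp T q₀.1)) z₀.1 z₀.2)) :=
    (((hreg.L_contDiff i (m (clamp T q₀.1))).continuousOn z₀ hmem₀).tendsto.comp
      (tendsto_nhdsWithin_iff.2 ⟨hzt, Eventually.of_forall hmem⟩))
  refine tendsto_of_tendsto_of_dist h1 ?_
  rw [Metric.tendsto_atTop]
  intro ε hε
  obtain ⟨n₀, hn₀⟩ := eventually_atTop.1 (Metric.tendstoUniformlyOn_iff.1 hu ε hε)
  refine ⟨n₀, fun n hn => ?_⟩
  have := hn₀ n hn (z n) (mem_insert_of_mem _ (mem_range_self n))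
  rw [Real.dist_eq, sub_zero, abs_of_nonneg dist_nonneg]
  exact this

/-- Clamping times to `[0, T]` and positions to the half-line makes all bounds hold for every real
time, with constants coming from compactness. -/
theorem tame_lagr [NeZero N] (hp : 1 < p) (hT : 0 ≤ T) (hreg : c.Regular) (h₁ : c.HMFG1 p)
    (hm : ∀ (s : ℕ → ℝ) (t : ℝ), Tendsto s atTop (𝓝 t) →
      Tendsto (fun n => d1 (m (clamp T (s n))) (m (clamp T t))) atTop (𝓝 0)) :
    ∃ C₀, (c.lagr T m).Tame p C₀ := by
  obtain ⟨C₀, hC₀, hco, hcs⟩ := h₁.coercive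
  have hcont := continuous_lagr hreg hm
  have hmax : ∀ {x r : ℝ}, x ∈ Icc 0 r → max x 0 = x := fun hx => max_eq_left hx.1
  have hgrow : ∀ r : ℝ, ∃ K, 0 ≤ K ∧ (∀ i m, ∀ x ∈ Icc 0 r, ∀ a,
      |c.dxL i m x a| ≤ K * (|a| ^ p + 1)) ∧ ∀ i m, ∀ x ∈ Icc 0 r, ∀ a,
      |c.daL i m x a| ≤ K * (|a| ^ (p - 1) + 1) := by
    intro r
    obtain ⟨K, hK, hKb⟩ := h₁.growth (max r 1) (by positivity)
    have hsub : Icc 0 r ⊆ Icc 0 (max r 1) := Icc_subset_Icc le_rfl (le_max_left _ _)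
    exact ⟨K, hK, fun i m x hx a => (hKb i m x (hsub hx) a).1,
      fun i m x hx a => (hKb i m x (hsub hx) a).2⟩
  refine ⟨C₀, hcont, ?_, hC₀, ?_, ?_, ?_, ?_, ?_⟩
  · have h1 : Continuous fun τ => c.Lstar (m (clamp T τ)) := by
      rw [continuous_iff_seqContinuous]
      exact fun s t hs => hreg.Lstar_cont _ _ (hm s t hs)
    have h2 : Continuous fun τ => ⨅ i, c.L i (m (clamp T τ)) 0 0 := by
      have h3 : ∀ i, Continuous fun τ => c.L i (m (clamp T τ)) 0 0 := fun i => by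
        have := (hcont i).comp (f := fun τ : ℝ => (τ, (0 : ℝ), (0 : ℝ)))
          (g := fun q : ℝ × ℝ × ℝ => (c.lagr T m).edgeCost i q.1 q.2.1 q.2.2) (by fun_prop)
        simpa [lagr, Function.comp_def] using this
      simp only [← Finset.inf'_univ_eq_ciInf]
      exact Continuous.finset_inf'_apply _ fun i _ => h3 i
    exact h1.min h2
  · intro i τ x a hx
    simpa [lagr, max_eq_left hx] using hco i (m (clamp T τ)) x a hx
  · intro τ
    refine le_min (hcs _) (le_ciInf fun i => ?_)
    have := hco i (m (clamp T τ)) 0 0 le_rfl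
    rw [abs_zero, Real.zero_rpow (by linarith)] at this
    linarith
  · intro i τ
    refine (min_le_right _ _).trans ?_
    simpa [lagr] using ciInf_le (Finite.bddBelow_range fun i => c.L i (m (clamp T τ)) 0 0) i
  · intro r
    obtain ⟨K, hK, -, hKa⟩ := hgrow r
    -- The cost at rest is bounded by compactness; the bound on the velocity derivative then carries
    -- this to every velocity with growth `|a|^p`.
    have hcpt : ∀ i, ∃ B, ∀ q ∈ Icc 0 T ×ˢ Icc 0 r ×ˢ ({0} : Set ℝ),
        ‖(c.lagr T m).edgeCost i q.1 q.2.1 q.2.2‖ ≤ B := fun i =>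
      (isCompact_Icc.prod (isCompact_Icc.prod isCompact_singleton)).exists_bound_of_continuousOn
        (hcont i).continuousOn
    choose B hB using hcpt
    refine ⟨∑ i, |B i| + 2 * K, by positivity, fun i τ x hx a => ?_⟩
    have h0 := abs_nonneg a
    have hap : 0 ≤ |a| ^ p := Real.rpow_nonneg h0 p
    have h1 := hB i (clamp T τ, x, 0) ⟨clamp_mem hT τ, hx, rfl⟩
    have h2 := HMFG1.lip_a hreg hp hK hKa i (m (clamp T τ)) hx (le_refl |a|)
      (show |(0 : ℝ)| ≤ |a| by rw [abs_zero]; exact h0)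
    simp only [lagr, hmax hx, clamp_of_mem (clamp_mem hT τ), Real.norm_eq_abs] at h1 ⊢
    have h3 : |B i| ≤ ∑ i, |B i| :=
      Finset.single_le_sum (f := fun i => |B i|) (fun _ _ => abs_nonneg _) (Finset.mem_univ i)
    have h4 : (|a| ^ (p - 1) + 1) * |a| ≤ 2 * (1 + |a| ^ p) := by
      have e : |a| ^ (p - 1) * |a| = |a| ^ p := by
        rcases h0.eq_or_lt with e | e
        · rw [← e, mul_zero, Real.zero_rpow (by linarith)]
        · rw [← Real.rpow_add_one e.ne']; ring_nf
      have : |a| ≤ 1 + |a| ^ p := by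
        by_cases h : |a| ≤ 1
        · linarith
        · linarith [Real.self_le_rpow_of_one_le (not_le.1 h).le hp.le]
      rw [add_mul, e]; linarith
    rw [sub_zero] at h2
    have h5 : K * (|a| ^ (p - 1) + 1) * |a| ≤ K * (2 * (1 + |a| ^ p)) := by
      rw [mul_assoc]; exact mul_le_mul_of_nonneg_left h4 hK
    have h6 := abs_sub_abs_le_abs_sub (c.L i (m (clamp T τ)) x a) (c.L i (m (clamp T τ)) x 0)
    have h7 : 0 ≤ (∑ i, |B i|) * |a| ^ p := by positivity
    linarith [le_abs_self (B i)]
  · intro r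
    obtain ⟨K, hK, hKx, hKa⟩ := hgrow r
    refine ⟨K * (2 ^ p + 1), by positivity, fun i τ x hx x' hx' a a' haa => ?_⟩
    have h0 := abs_nonneg a
    have hap : 0 ≤ |a| ^ p := Real.rpow_nonneg h0 p
    simp only [lagr, hmax hx, hmax hx']
    have h1 := HMFG1.lip_x hreg hKx i (m (clamp T τ)) hx hx' a
    have ha' : |a'| ≤ |a| + 1 := by
      have := abs_sub_abs_le_abs_sub a' a
      rw [abs_sub_comm] at this
      linarith
    have h2 := HMFG1.lip_a hreg hp hK hKa i (m (clamp T τ)) hx' (show |a| ≤ |a| + 1 by linarith) ha'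
    have h3 := abs_sub_le (c.L i (m (clamp T τ)) x a) (c.L i (m (clamp T τ)) x' a)
      (c.L i (m (clamp T τ)) x' a')
    have h2p : (1 : ℝ) ≤ 2 ^ p := Real.one_le_rpow one_le_two (by linarith)
    -- The condition `|a - a'| ≤ 1` keeps both velocities below `|a| + 1`, so the constant can be
    -- expressed through `|a|` alone.
    have h4 : (|a| + 1) ^ (p - 1) ≤ 2 ^ p * (1 + |a| ^ p) := by
      have e1 : (|a| + 1) ^ (p - 1) ≤ (|a| + 1) ^ p :=
        Real.rpow_le_rpow_of_exponent_le (by linarith) (by linarith)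
      have e2 : (|a| + 1) ^ p ≤ (2 * max |a| 1) ^ p :=
        Real.rpow_le_rpow (by linarith) (by linarith [le_max_left |a| 1, le_max_right |a| 1])
          (by linarith)
      rw [Real.mul_rpow (by norm_num) (by positivity)] at e2
      have e3 : (max |a| 1) ^ p ≤ 1 + |a| ^ p := by
        rcases le_total |a| 1 with h | h
        · rw [max_eq_right h, Real.one_rpow]; linarith
        · rw [max_eq_left h]; linarith
      have e4 : (2 : ℝ) ^ p * (max |a| 1) ^ p ≤ 2 ^ p * (1 + |a| ^ p) :=
        mul_le_mul_of_nonneg_left e3 (by positivity)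
      linarith
    have h5 : K * (|a| ^ p + 1) * |x - x'| ≤ K * (2 ^ p + 1) * (1 + |a| ^ p) * |x - x'| := by
      refine mul_le_mul_of_nonneg_right ?_ (abs_nonneg _)
      rw [mul_assoc]
      exact mul_le_mul_of_nonneg_left (by nlinarith) hK
    have h6 : K * ((|a| + 1) ^ (p - 1) + 1) * |a - a'| ≤
        K * (2 ^ p + 1) * (1 + |a| ^ p) * |a - a'| := by
      refine mul_le_mul_of_nonneg_right ?_ (abs_nonneg _)
      rw [mul_assoc]
      exact mul_le_mul_of_nonneg_left (by nlinarith) hK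
    rw [mul_add]
    linarith

theorem run_lagr {τ : ℝ} (hτ : τ ∈ Icc 0 T) (x : Junction N) (a : ℝ) :
    (c.lagr T m).run τ x a = c.running (m τ) x a := by
  have e : ∀ z : Junction N, max z.abs 0 = z.abs := fun z => max_eq_left z.abs_nn
  simp only [Lagr.run, lagr, running, clamp_of_mem hτ, e]

theorem cost_lagr {t s : ℝ} (ht : 0 ≤ t) (hts : t ≤ s) (hs : s ≤ T) (y : ℝ → Junction N) :
    c.runningCost m t s y = (c.lagr T m).cost t s y := by
  refine intervalIntegral.integral_congr fun τ hτ => ?_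
  rw [uIcc_of_le hts] at hτ
  exact (run_lagr ⟨ht.trans hτ.1, hτ.2.trans hs⟩ _ _).symm

theorem value_lagr {t : ℝ} (ht : t ∈ Icc 0 T) (x : Junction N) :
    c.value p T m x t = (c.lagr T m).value p T (c.terminal (m T)) x t := by
  rw [value, Lagr.value]
  congr 1
  refine image_congr fun y _ => ?_
  rw [J, cost_lagr ht.1 ht.2 le_rfl]

/-- The terminal cost is continuous on the open edges. -/
theorem edgeCont_terminal (hreg : c.Regular) (n : P1 N) :
    EdgeCont (c.terminal n) fun i => c.G i n where
  cont i := hreg.G_contOn i n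
  eq i r hr := by
    -- The terminal cost unfolds to `Lagr.run` for a Lagrangian independent of time and velocity, so
    -- the edge and vertex evaluations are inherited.
    have := Lagr.run_of_mem (Λ := ⟨fun i _ x _ => c.G i n x,
      fun _ => min (c.Gstar n) (⨅ i, c.G i n 0)⟩) ((pt_mem_edge_diff (i := i) hr.le).2 ⟨rfl, hr⟩) 0 0
    rw [pt_abs i hr.le] at this
    exact this
  le i := by
    have := Lagr.run_vertex (Λ := ⟨fun i _ x _ => c.G i n x,
      fun _ => min (c.Gstar n) (⨅ i, c.G i n 0)⟩) (pt_abs i le_rfl) 0 0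
    refine (show c.terminal n (pt i 0) = _ from this).trans_le ?_
    exact (min_le_right _ _).trans (ciInf_le (Finite.bddBelow_range fun i => c.G i n 0) i)

theorem exists_terminal_bound [NeZero N] (hreg : c.Regular) :
    ∃ M, (∀ n x, |c.terminal n x| ≤ M) ∧ ∀ i n r, 0 ≤ r → |c.G i n r| ≤ M := by
  choose B hB using hreg.G_bdd
  obtain ⟨B', hB'⟩ := hreg.Gstar_bdd
  have hG : ∀ i n r, 0 ≤ r → |c.G i n r| ≤ ∑ i, |B i| + |B'| := fun i n r hr => by
    have h3 : |B i| ≤ ∑ i, |B i| :=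
      Finset.single_le_sum (f := fun i => |B i|) (fun _ _ => abs_nonneg _) (Finset.mem_univ i)
    linarith [hB i n r hr, le_abs_self (B i), abs_nonneg B']
  refine ⟨∑ i, |B i| + |B'|, fun n x => ?_, hG⟩
  rcases abs_vec_pos_cases x with h0 | ⟨i, hi⟩
  · have := Lagr.run_vertex (Λ := ⟨fun i _ x _ => c.G i n x,
      fun _ => min (c.Gstar n) (⨅ i, c.G i n 0)⟩) h0 0 0
    rw [show c.terminal n x = _ from this, abs_le]
    have hs : 0 ≤ ∑ i, |B i| := Finset.sum_nonneg fun _ _ => abs_nonneg _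
    have h1 := abs_le.1 (hB' n)
    have h2 := le_abs_self B'
    exact ⟨le_min (by linarith) (le_ciInf fun i => (abs_le.1 (hG i n 0 le_rfl)).1),
      (min_le_left _ _).trans (by linarith)⟩
  · rw [(edgeCont_terminal hreg n).eq_of_mem hi]
    exact hG i n _ x.abs_nn

theorem edgeLip_terminal (hreg : c.Regular) (h₂ : c.HMFG2) (n : P1 N) :
    EdgeLip (c.terminal n) := by
  intro R
  have hL : ∀ i, ∃ L, LipschitzOnWith L (c.G i n) (Icc 0 R) := fun i =>
    ((h₂ i n).mono Icc_subset_Ici_self).exists_lipschitzOnWith one_ne_zero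
      (convex_Icc 0 R) isCompact_Icc
  choose L hL using hL
  refine ⟨∑ i, (L i : ℝ), by positivity, fun i r hr r' hr' => ?_⟩
  have hE := edgeCont_terminal hreg n
  have h1 : c.terminal n (pt i r) ≤ c.G i n r := by
    rcases hr.1.eq_or_lt with e | e
    · rw [← e]; exact hE.le i
    · exact (hE.eq i r e).le
  have h3 := (hL i).dist_le_mul _ hr _ (Ioc_subset_Icc_self hr')
  rw [Real.dist_eq, Real.dist_eq] at h3
  have h5 : (L i : ℝ) ≤ ∑ i, (L i : ℝ) :=
    Finset.single_le_sum (f := fun i => (L i : ℝ)) (fun _ _ => NNReal.coe_nonneg _)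
      (Finset.mem_univ i)
  have h6 := mul_le_mul_of_nonneg_right h5 (abs_nonneg (r - r'))
  rw [hE.eq i r' hr'.1]
  linarith [(abs_le.1 h3).2]

end Costs

/-- The only missing case is the vertex on the right-hand side, reached by letting `r'` tend to `0`.
-/
theorem EdgeLip.of_continuous {N : ℕ} {g : Junction N → ℝ} (hg : EdgeLip g) (hc : Continuous g) :
    ∀ R, ∃ L, 0 ≤ L ∧ ∀ i, ∀ r ∈ Icc 0 R, ∀ r' ∈ Icc 0 R,
      g (pt i r) ≤ g (pt i r') + L * |r - r'| := by
  intro R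
  obtain ⟨L, hL, hLg⟩ := hg R
  refine ⟨L, hL, fun i r hr r' hr' => ?_⟩
  rcases hr'.1.eq_or_lt with e | e
  · rcases (hr.1.trans hr.2).eq_or_lt with eR | eR
    · have : r = r' := le_antisymm (by linarith [hr.2]) (by linarith [hr.1])
      simp [this]
    have hcont : Continuous fun s => g (pt i s) + L * |r - s| :=
      (hc.comp (continuous_pt i)).add (by fun_prop)
    have ht : Tendsto (fun s => g (pt i s) + L * |r - s|) (𝓝[>] r') (𝓝 (g (pt i r') + L * |r - r'|)) :=
      hcont.continuousAt.mono_left nhdsWithin_le_nhds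
    refine ge_of_tendsto ht ?_
    rw [← e]
    filter_upwards [Ioc_mem_nhdsGT eR] with s hs
    exact hLg i r hr s hs
  · exact hLg i r hr r' ⟨e, hr'.2⟩

end JunctionMFG

/-! ### Dynamic programming and viscosity properties of the value function -/

namespace JunctionMFG

open JunctionMFG.Junction (pt edge vertex)

section Value

variable {N : ℕ} {p C₀ T M : ℝ} {Λ : Lagr N} {g : Junction N → ℝ}

/-- Superlinearity beats the linear term. This is what makes the suprema in the Hamiltonians bound
each of their terms. -/
theorem Lagr.Tame.bddAbove_hamiltonian (h : Λ.Tame p C₀) (hp : 1 < p) (i : Fin N) (t q : ℝ)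
    {x : ℝ} (hx : 0 ≤ x) : BddAbove (range fun ζ => -q * ζ - Λ.edgeCost i t x ζ) := by
  obtain ⟨K, -, hK⟩ := Lagr.exists_linear_le_pow hp h.pos |q|
  refine ⟨K, ?_⟩
  rintro _ ⟨ζ, rfl⟩
  have h1 := h.coercive i t x ζ hx
  have h2 := neg_abs_le (q * ζ)
  rw [abs_mul] at h2
  linarith [hK ζ]

variable [NeZero N]

/-- The dynamic programming principle. -/
theorem Lagr.Tame.isGLB_value (h : Λ.Tame p C₀) (hp : 1 < p) (hg : ∀ x, |g x| ≤ M) {t s : ℝ}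
    (hts : t ≤ s) (hs : s ≤ T) (x : Junction N) :
    IsGLB ((fun y : ℝ → Junction N => Λ.value p T g (y s) s + Λ.cost t s y) ''
      GamRestr p T t s x) (Λ.value p T g x t) := by
  constructor
  · rintro _ ⟨z, ⟨y, hy, hzy⟩, rfl⟩
    obtain ⟨hy1, hy2⟩ := mem_Gam.1 hy
    have h1 := h.value_le_cost_add (g := g) hp hg hts hs (hy1.mono hp le_rfl hts hs)
    have h2 : Λ.cost t s z = Λ.cost t s y :=
      Lagr.cost_congr hts fun σ hσ => hzy (Ioo_subset_Icc_self hσ)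
    rw [hy2] at h1
    change Λ.value p T g x t ≤ Λ.value p T g (z s) s + Λ.cost t s z
    rw [h2, hzy ⟨hts, le_rfl⟩]
    linarith
  · intro b hb
    refine le_of_forall_pos_le_add fun ε hε => ?_
    obtain ⟨y, hy, hyt, hlt⟩ := Λ.exists_lt_value (p := p) (g := g) (hts.trans hs) x hε
    have h1 := hb ⟨y, ⟨y, mem_Gam.2 ⟨hy, hyt⟩, eqOn_refl _ _⟩, rfl⟩
    have h2 := h.cost_add_value_le (g := g) hp hg hts hs hy
    change b ≤ Λ.value p T g (y s) s + Λ.cost t s y at h1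
    linarith

variable {ℓ : ℝ → Fin N → ℝ → ℝ → ℝ} {ℓ₀ : ℝ → ℝ}

/-- Each velocity in the supremum is realized by a short motion: any velocity in an open edge, and
at the vertex an outgoing velocity or rest. -/
theorem Lagr.Tame.isViscositySubsolution_value (h : Λ.Tame p C₀) (hp : 1 < p)
    (hg : ∀ x, |g x| ≤ M)
    (hcont : ContinuousOn (fun q : Junction N × ℝ => Λ.value p T g q.1 q.2) (univ ×ˢ Ioo 0 T))
    (hℓ : ∀ t ∈ Ioo 0 T, ∀ i x a, 0 ≤ x → ℓ t i x a = Λ.edgeCost i t x a)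
    (hℓ₀ : ∀ t ∈ Ioo 0 T, ℓ₀ t = Λ.vertexCost t) :
    IsViscositySubsolution T ℓ ℓ₀ (Λ.value p T g) := by
  refine ⟨hcont, fun φ hφ x t ht ⟨hφx, hφle⟩ => ⟨fun i hi => ?_, fun hx => ?_⟩⟩
  · have hx0 : 0 < x.abs := lt_of_le_of_ne x.abs_nn fun h => hi.2 (mem_vertex_iff.2 h.symm)
    have h1 : Ham (ℓ t i) x.abs (Dx φ i x.abs t) ≤ deriv (fun s => φ x s) t := by
      refine ciSup_le fun ζ => ?_
      have := h.subsolution_edge hp hg hφ ht hφx hφle hi.1 (ζ := ζ) (Or.inl hx0)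
      rw [hℓ t ht i _ _ x.abs_nn]
      linarith
    linarith
  · have hx0 := mem_vertex_iff.1 hx
    have h1 : HamVertex (ℓ t) (ℓ₀ t) (fun i => Dx φ i 0 t) ≤ deriv (fun s => φ x s) t := by
      refine max_le ?_ (ciSup_le fun i => ?_)
      · have := h.subsolution_vertex hp hg hφ ht hφx hφle hx0
        rw [hℓ₀ t ht]
        linarith
      · have : Nonempty {ζ : ℝ // 0 ≤ ζ} := ⟨⟨0, le_rfl⟩⟩
        refine ciSup_le fun ζ => ?_
        have := h.subsolution_edge hp hg hφ ht hφx hφle (mem_edge_of_abs_eq_zero hx0 i)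
          (Or.inr ζ.2)
        rw [hx0] at this
        rw [hℓ t ht i _ _ le_rfl]
        linarith
    linarith

/-- A strict violation gives a uniform gain `κ` in the integrated running cost, contradicting
dynamic programming. Convexity is needed only at the vertex, to pass from outgoing velocities to all
of them. -/
theorem Lagr.Tame.isViscositySupersolution_value (h : Λ.Tame p C₀) (hp : 1 < p)
    (hg : ∀ x, |g x| ≤ M)
    (hcont : ContinuousOn (fun q : Junction N × ℝ => Λ.value p T g q.1 q.2) (univ ×ˢ Ioo 0 T))
    (hconv : ∀ i, ∀ t ∈ Ioo 0 T, ConvexOn ℝ univ (Λ.edgeCost i t 0))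
    (hℓ : ∀ t ∈ Ioo 0 T, ∀ i x a, 0 ≤ x → ℓ t i x a = Λ.edgeCost i t x a)
    (hℓ₀ : ∀ t ∈ Ioo 0 T, ℓ₀ t = Λ.vertexCost t) :
    IsViscositySupersolution T ℓ ℓ₀ (Λ.value p T g) := by
  refine ⟨hcont, fun φ hφ x t ht ⟨hφx, hφle⟩ => ⟨fun i hi => ?_, fun hx => ?_⟩⟩
  · by_contra hneg
    rw [not_le] at hneg
    have hx0 : 0 < x.abs := lt_of_le_of_ne x.abs_nn fun h => hi.2 (mem_vertex_iff.2 h.symm)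
    refine h.not_strict_minorant hp hg ht (q := fun k => Dx φ k x.abs t)
      (c := deriv (fun s => φ x s) t)
      (κ := deriv (fun s => φ x s) t - Ham (ℓ t i) x.abs (Dx φ i x.abs t)) (by linarith)
      (fun j hj ζ => ?_) (fun hx => absurd hx hx0.ne')
      (hφ.minorant ht hφx hφle fun j _ => Or.inl rfl)
    have hji : i = j := by
      have h1 := hi
      rw [mem_edge_iff.1 hj, pt_mem_edge_diff x.abs_nn] at h1
      exact h1.1.symm
    subst hji
    have h1 : -(Dx φ i x.abs t) * ζ - Λ.edgeCost i t x.abs ζ ≤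
        Ham (ℓ t i) x.abs (Dx φ i x.abs t) := by
      have e : Ham (ℓ t i) x.abs (Dx φ i x.abs t) =
          ⨆ ζ : ℝ, (-(Dx φ i x.abs t) * ζ - Λ.edgeCost i t x.abs ζ) :=
        iSup_congr fun ζ => by rw [hℓ t ht i _ _ x.abs_nn]
      rw [e]
      exact le_ciSup (h.bddAbove_hamiltonian hp i t (Dx φ i x.abs t) x.abs_nn) ζ
    linarith
  · by_contra hneg
    rw [not_le] at hneg
    have hx0 := mem_vertex_iff.1 hx
    set d := deriv (fun s => φ x s) t with hd
    set κ := d - HamVertex (ℓ t) (ℓ₀ t) (fun i => Dx φ i 0 t) with hκ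
    -- The vertex Hamiltonian bounds the cost from below only for `ζ ≥ 0`; the supporting slope
    -- compensates for incoming velocities.
    have hslope : ∀ i, ∃ s ≥ 0, ∀ ζ, κ + s * ζ ≤ Λ.edgeCost i t 0 ζ + (Dx φ i 0 t * ζ + d) := by
      intro i
      refine exists_supporting_slope ((hconv i t ht).add ?_) fun ζ hζ => ?_
      · refine ⟨convex_univ, fun a _ b _ α β _ _ hαβ => le_of_eq ?_⟩
        simp only [smul_eq_mul]
        linear_combination (-d) * hαβ
      · have h1 : -(Dx φ i 0 t) * ζ - Λ.edgeCost i t 0 ζ ≤ HamDown (ℓ t i) 0 (Dx φ i 0 t) := by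
          obtain ⟨B, hB⟩ := h.bddAbove_hamiltonian hp i t (Dx φ i 0 t) le_rfl
          rw [← hℓ t ht i _ _ le_rfl]
          refine le_ciSup (f := fun ζ : {ζ : ℝ // 0 ≤ ζ} => -(Dx φ i 0 t) * ζ.1 - ℓ t i 0 ζ.1)
            ⟨B, ?_⟩ ⟨ζ, hζ⟩
          rintro _ ⟨z, rfl⟩
          change -(Dx φ i 0 t) * z.1 - ℓ t i 0 z.1 ≤ B
          rw [hℓ t ht i _ _ le_rfl]
          exact hB ⟨z.1, rfl⟩
        have h2 : HamDown (ℓ t i) 0 (Dx φ i 0 t) ≤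
            HamVertex (ℓ t) (ℓ₀ t) (fun i => Dx φ i 0 t) :=
          (le_ciSup (f := fun i => HamDown (ℓ t i) 0 (Dx φ i 0 t))
            (Set.finite_range _).bddAbove i).trans (le_max_right _ _)
        change κ ≤ Λ.edgeCost i t 0 ζ + (Dx φ i 0 t * ζ + d)
        linarith
    choose s hs0 hs using hslope
    -- Subtracting `s k` makes the lower bound valid for every velocity, and the sign of `s k`
    -- preserves the minorant.
    refine h.not_strict_minorant hp hg ht (q := fun k => Dx φ k 0 t - s k) (c := d) (κ := κ)
      (by linarith) (fun j _ ζ => ?_) (fun _ => ?_)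
      (hφ.minorant ht hφx hφle fun j _ => Or.inr ⟨hx0, ?_⟩)
    · rw [hx0]
      linarith [hs j ζ]
    · have h1 : -ℓ₀ t ≤ HamVertex (ℓ t) (ℓ₀ t) (fun i => Dx φ i 0 t) := le_max_left _ _
      have h2 := hℓ₀ t ht
      linarith
    · rw [hx0]
      linarith [hs0 j]

end Value

/-! ### Transfer to functions that agree on the relevant times -/

section Transfer

variable {N : ℕ} {T : ℝ} {u v : Junction N → ℝ → ℝ} {ℓ : ℝ → Fin N → ℝ → ℝ → ℝ} {ℓ₀ : ℝ → ℝ}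

theorem eventually_eq_of_mem_Ioo (huv : ∀ x, ∀ t ∈ Ioo 0 T, u x t = v x t) (x : Junction N)
    {t : ℝ} (ht : t ∈ Ioo 0 T) : ∀ᶠ q : Junction N × ℝ in 𝓝 (x, t), u q.1 q.2 = v q.1 q.2 := by
  filter_upwards [continuous_snd.continuousAt.preimage_mem_nhds
    (isOpen_Ioo.mem_nhds (show (x, t).2 ∈ Ioo 0 T from ht))] with q hq
  exact huv q.1 q.2 hq

theorem IsViscositySolution.congr (h : IsViscositySolution T ℓ ℓ₀ v)
    (huv : ∀ x, ∀ t ∈ Ioo 0 T, u x t = v x t) : IsViscositySolution T ℓ ℓ₀ u := by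
  have hc := h.1.1.congr fun q hq => huv q.1 q.2 (mem_prod.1 hq).2
  refine ⟨⟨hc, fun φ hφ x t ht hφu => h.1.2 φ hφ x t ht ⟨hφu.1.trans (huv x t ht), ?_⟩⟩,
    ⟨hc, fun φ hφ x t ht hφu => h.2.2 φ hφ x t ht ⟨hφu.1.trans (huv x t ht), ?_⟩⟩⟩
  · filter_upwards [hφu.2, eventually_eq_of_mem_Ioo huv x ht] with q h1 h2
    rwa [h2] at h1
  · filter_upwards [hφu.2, eventually_eq_of_mem_Ioo huv x ht] with q h1 h2
    rwa [h2] at h1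

end Transfer

theorem LocallyLipschitzOn.congr_of_eqOn {X Y : Type*} [PseudoEMetricSpace X]
    [PseudoEMetricSpace Y] {s : Set X} {f f' : X → Y} (hf : LocallyLipschitzOn s f)
    (h : EqOn f' f s) : LocallyLipschitzOn s f' := by
  intro x hx
  obtain ⟨K, t, ht, hK⟩ := hf hx
  refine ⟨K, t ∩ s, inter_mem ht self_mem_nhdsWithin, fun a ha b hb => ?_⟩
  rw [h ha.2, h hb.2]
  exact hK ha.1 hb.1

end JunctionMFG

/-! ### The theorem for mild solutions -/

theorem mainTheorem12 {N : ℕ} (hN : 1 < N) {p T C : ℝ} (hp : 1 < p) (hT : 0 < T) (hC : 0 < C)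
    (c : Costs N) (hreg : c.Regular) (h₁ : c.HMFG1 p)
    (m₀ : ProbabilityMeasure (Junction N))
    (hm₀ : Bornology.IsBounded (m₀ : Measure (Junction N)).support)
    (μ : ProbabilityMeasure (GamC N p hT C)) (hμ : c.IsRelaxedEquilibrium m₀ μ)
    (u : Junction N → ℝ → ℝ) (m : ℝ → P1 N) (hum : c.IsMildSolution μ u m) :
    (∀ t s : ℝ, 0 ≤ t → t ≤ s → s ≤ T → ∀ x : Junction N,
      IsGLB ((fun y : ℝ → Junction N => u (y s) s + c.runningCost m t s y) ''
        GamRestr p T t s x) (u x t)) ∧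
    (ContinuousOn (fun q : Junction N × ℝ => u q.1 q.2) ((univ : Set (Junction N)) ×ˢ Ico 0 T) ∧
      ∀ x : Junction N, ContinuousOn (fun t => u x t) (Icc 0 T) ∧ u x T = c.terminal (m T) x) ∧
    IsViscositySolution T (fun t i => c.L i (m t)) (fun t => c.L0 (m t)) u ∧
    (c.HMFG2 →
      LocallyLipschitzOn ((univ : Set (Junction N)) ×ˢ Ico 0 T)
        (fun q : Junction N × ℝ => u q.1 q.2) ∧
      ((∀ n : P1 N, Continuous (c.terminal n)) →
        LocallyLipschitzOn ((univ : Set (Junction N)) ×ˢ Icc 0 T)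
          (fun q : Junction N × ℝ => u q.1 q.2))) := by
  have : NeZero N := ⟨by omega⟩
  have hm : ∀ (s : ℕ → ℝ) (t : ℝ), Tendsto s atTop (𝓝 t) →
      Tendsto (fun n => d1 (m (Costs.clamp T (s n))) (m (Costs.clamp T t))) atTop (𝓝 0) := by
    intro s t hs
    -- Clamped times lie in `[0, T]`, where `m` is prescribed to be the flow of marginals.
    simp only [hum.1 _ (Costs.clamp_mem hT.le _)]
    have hc : Continuous (Costs.clamp T) := by unfold Costs.clamp; fun_prop
    exact tendsto_d1_marginal μ ((hc.tendsto t).comp hs)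
  obtain ⟨C₀, h⟩ := Costs.tame_lagr hp hT.le hreg h₁ hm
  obtain ⟨M, hM, hGM⟩ := Costs.exists_terminal_bound hreg
  set Λ := c.lagr T m with hΛ
  have hu : ∀ x, ∀ t ∈ Icc 0 T, u x t = Λ.value p T (c.terminal (m T)) x t := fun x t ht =>
    (hum.2 x t ht).trans (Costs.value_lagr ht x)
  have hE := Costs.edgeCont_terminal hreg (m T)
  have hg := hM (m T)
  have hcont := h.continuousOn_value hp hT.le hg hE fun i r hr => hGM i (m T) r hr
  refine ⟨fun t s ht hts hs x => ?_, ⟨hcont.congr fun q hq =>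
    hu q.1 q.2 (Ico_subset_Icc_self hq.2), fun x => ⟨?_, ?_⟩⟩, ?_, fun h₂ => ⟨?_, fun hcg => ?_⟩⟩
  · have e : (fun y : ℝ → Junction N => u (y s) s + c.runningCost m t s y) =
        fun y => Λ.value p T (c.terminal (m T)) (y s) s + Λ.cost t s y := by
      funext y
      rw [hu _ s ⟨ht.trans hts, hs⟩, Costs.cost_lagr ht hts hs]
    rw [e, hu x t ⟨ht, hts.trans hs⟩]
    exact h.isGLB_value hp hg hts hs x
  · exact (h.continuousOn_value_time hp hT.le hg hE (fun i r hr => hGM i (m T) r hr) x).congr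
      fun t ht => hu x t ht
  · rw [hu x T ⟨hT.le, le_rfl⟩, Lagr.value_terminal]
  · have hcl : ∀ t ∈ Ioo 0 T, Costs.clamp T t = t := fun t ht =>
      Costs.clamp_of_mem (Ioo_subset_Icc_self ht)
    have hcont' := hcont.mono (prod_mono_right (s := univ) Ioo_subset_Ico_self)
    have hℓ : ∀ t ∈ Ioo 0 T, ∀ i x a, 0 ≤ x → c.L i (m t) x a = Λ.edgeCost i t x a :=
      fun t ht i x a hx => by simp only [hΛ, Costs.lagr, hcl t ht, max_eq_left hx]
    have hℓ₀ : ∀ t ∈ Ioo 0 T, c.L0 (m t) = Λ.vertexCost t := fun t ht => by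
      simp only [hΛ, Costs.lagr, hcl t ht]
    refine IsViscositySolution.congr
      ⟨h.isViscositySubsolution_value hp hg hcont' hℓ hℓ₀,
        h.isViscositySupersolution_value hp hg hcont' (fun i t ht => ?_) hℓ hℓ₀⟩
      fun x t ht => hu x t (Ioo_subset_Icc_self ht)
    rw [← funext fun a => hℓ t ht i 0 a le_rfl]
    exact (h₁.convex i (m t) 0 le_rfl).convexOn
  · exact LocallyLipschitzOn.congr_of_eqOn
      (h.locallyLipschitzOn_value hp hT.le hg (Costs.edgeLip_terminal hreg h₂ (m T)))
      fun q hq => hu q.1 q.2 (Ico_subset_Icc_self hq.2)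
  · exact LocallyLipschitzOn.congr_of_eqOn
      (h.locallyLipschitzOn_value' hp hT.le hg
        ((Costs.edgeLip_terminal hreg h₂ (m T)).of_continuous (hcg (m T))))
      fun q hq => hu q.1 q.2 hq.2
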